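/- **Setting.** Two parties $A,B$ hold feature matrices $X_A\in\mathbb Z^{n\times d_A}$, $X_B\in\mathbb Z^{n\times d_B}$ (fixed-point numbers, represented as integers). Weights $W_\diamond=U_\diamond+V_\diamond\in\mathbb Z^{d_\diamond\times m}$, $\diamond\in\{A,B\}$, are additively shared: party $\diamond$ holds $U_\diamond$ and a Paillier encryption $[\![V_\diamond]\!]_{\bar\diamond}$ under the public key of the other party $\bar\diamond$. Each party has generated, independently, a Paillier key pair ($pk=N=pq$ with distinct primes $p,q$ of $\ell(\kappa)$ bits and $\gcd(N,(p-1)(q-1))=1$, $sk=(p,q)$, $\mathrm{Enc}(v;r)=(1+N)^v r^N \bmod N^2$) and knows the other's public key. Here $\kappa$ is the security parameter and $\kappa\le\ell(\kappa)\le\mathrm{poly}(\kappa)$. The entries of $X_\diamond,V_\diamond,\nabla Z$ have absolute value $<2^{b(\kappa)}$; random masks have independent entries uniform in $[0,2^{s(\kappa)})$; $2^{2b(\kappa)-s(\kappa)}$ is negligible, and $2\big((n+d_A+d_B+1)2^{2b(\kappa)}+2^{s(\kappa)}\big)<N$ for every modulus $N$ that is generated. **HE2SS.** A party holding $[\![v]\!]_{\bar\diamond}$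 draws a random mask $\phi$, sends $[\![v]\!]_{\bar\diamond}+\mathrm{Enc}(-\phi)$ with fresh encryption randomness, and keeps $\phi$; party $\bar\diamond$ decrypts $v-\phi$. **Protocol $\Pi_{\rm MatMulFw}$.** Each party $\diamond$ computes $[\![X_\diamond V_\diamond]\!]_{\bar\diamond}$ homomorphically and converts it by HE2SS into shares $\varepsilon_\diamond$ (kept) and $X_\diamond V_\diamond-\varepsilon_\diamond$ (for $\bar\diamond$). Then it computes $Z'_\diamond=X_\diamond U_\diamond+\varepsilon_\diamond+(X_{\bar\diamond}V_{\bar\diamond}-\varepsilon_{\bar\diamond})$. $A$ sends $Z'_A$ to $B$, who outputs $Z'_A+Z'_B$; $A$ outputs nothing. **Functionality $\mathcal F_{\rm MatMulFw}$.** From $X_\diamond,U_\diamond,[\![V_\diamond]\!]_{\bar\diamond}$ and the keys, $A$ gets nothing and $B$ gets $Z=X_AW_A+X_BW_B$. **Protocol $\Pi_{\rm MatMulBw}$.** $B$, who has the additional input $\nabla Z\in\mathbb Z^{n\times m}$, sends $[\![\nabla Z]\!]_B$ to $A$. $A$ computes $[\![\nabla W_A]\!]_B=X_A^{T}[\![\nabla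 Z]\!]_B$ and converts it by HE2SS into shares $\phi$ for $A$ and $\nabla W_A-\phi$ for $B$. $B$ sends a fresh encryption $[\![\nabla W_A-\phi]\!]_B$ to $A$. $A$ outputs $\phi$, and $B$ outputs $\nabla W_A-\phi$ and $\nabla W_B=X_B^T\nabla Z$ (the shares of the weights are then updated locally). **Functionality $\mathcal F_{\rm MatMulBw}$.** $A$ gets a random mask $\phi$; $B$ gets $X_A^T\nabla Z-\phi$ and $X_B^T\nabla Z$. **Security.** $\Pi$ *securely realizes* $\mathcal F$ in the presence of a semi-honest adversary corrupting one party if, for either corrupted party and every probabilistic polynomial-time (PPT) adversary $\mathcal A$, which is given the view of that party (its input, random choices and received messages), there is a PPT simulator $\mathcal S$, which is given only that party's input and its output from $\mathcal F$, such that no PPT environment can tell the real from the ideal interaction, except with negligible probability in $\kappa$. All of them get the same auxiliary input of polynomial length, and the negligible bound is uniform in it. The environment sees the keys of the corrupted party and the public keys, chooses the inputs of both parties (including $V_\diamond$ and the randomness of the ciphertext $[\![V_\diamond]\!]_{\bar\diamond}$), and finally sees the value computed by $\mathcal A$ (respectively $\mathcal S$) and the outputs of both parties. **Theorem.** Assume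 that the decisional composite residuosity assumption holds for the key generator, against PPT distinguishers with polynomially long auxiliary input (for $r$ uniform in $(\mathbb Z/N^2)^\times$, the pairs $(N, r^N \bmod N^2)$ and $(N,r)$ are indistinguishable). Then, for all fixed dimensions $n,d_A,d_B,m$, the MatMul source-layer protocol securely realizes both functionalities in the presence of a semi-honest adversary that corrupts one party: $\Pi_{\rm MatMulFw}$ securely realizes $\mathcal F_{\rm MatMulFw}$, and $\Pi_{\rm MatMulBw}$ securely realizes $\mathcal F_{\rm MatMulBw}$. -/

import Mathlib

namespace MatMulSource

/-! ### Probabilistic polynomial time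

Random access programs over finitely many integer registers, with logarithmic cost. Every
instruction is charged at least the number of bit operations of its schoolbook implementation, a
loop is charged for each of its rounds, and a random string is charged for each of its bits, so
that the programs of polynomial cost are the probabilistic polynomial-time algorithms. -/

/-- The contents of the registers. -/
abbrev Store := ℕ → ℤ

/-- Binary arithmetic instructions (division and remainder are Euclidean). -/
inductive BinOp
  | add | sub | mul | div | mod

/-- The value of an arithmetic instruction. -/
def BinOp.eval : BinOp → ℤ → ℤ → ℤ
  | .add, x, y => x + y
  | .sub, x, y => x - y
  | .mul, x, y => x * y
  | .div, x, y => x / y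
  | .mod, x, y => x % y

/-- Programs; `d`, `a`, `b` are register numbers. -/
inductive Prog
  /-- do nothing -/
  | skip
  /-- `R_d := c` -/
  | const (d : ℕ) (c : ℤ)
  /-- `R_d := R_a o R_b` -/
  | bin (o : BinOp) (d a b : ℕ)
  /-- `R_d :=` the number of binary digits of `|R_a|` -/
  | size (d a : ℕ)
  /-- toss `R_a` fair coins and put the number with these binary digits into `R_d` -/
  | coins (d a : ℕ)
  /-- `P; Q` -/
  | seq (P Q : Prog)
  /-- `if R_a > 0 then P else Q` -/
  | ite (a : ℕ) (P Q : Prog)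
  /-- repeat `P` as many times as `R_a` says on entry (not at all if `R_a ≤ 0`) -/
  | loop (a : ℕ) (P : Prog)

/-- The number of binary digits of `|x|`. -/
def bits (x : ℤ) : ℕ := x.natAbs.size

/-- `n` rounds of a randomized step, with the accumulated cost. -/
noncomputable def rounds (step : Store → PMF (Store × ℕ)) : ℕ → Store → PMF (Store × ℕ)
  | 0, s => PMF.pure (s, 1)
  | n + 1, s => (step s).bind fun x =>
      (rounds step n x.1).map fun y => (y.1, x.2 + y.2 + 1)

/-- The distribution of the final store together with the cost of the run. -/
noncomputable def Prog.run : Prog → Store → PMF (Store × ℕ)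
  | .skip => fun s => PMF.pure (s, 1)
  | .const d c => fun s => PMF.pure (Function.update s d c, 1 + bits c)
  | .bin o d a b => fun s =>
      PMF.pure (Function.update s d (o.eval (s a) (s b)), (1 + bits (s a)) * (1 + bits (s b)))
  | .size d a => fun s => PMF.pure (Function.update s d (bits (s a) : ℤ), 1 + bits (s a))
  | .coins d a => fun s =>
      (PMF.uniformOfFintype (Fin (2 ^ (s a).toNat))).map fun r =>
        (Function.update s d ((r : ℕ) : ℤ), 1 + (s a).toNat)
  | .seq P Q => fun s => (P.run s).bind fun x =>
      (Q.run x.1).map fun y => (y.1, x.2 + y.2)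
  | .ite a P Q => fun s =>
      if 0 < s a then (P.run s).map fun x => (x.1, x.2 + (1 + bits (s a)))
      else (Q.run s).map fun x => (x.1, x.2 + (1 + bits (s a)))
  | .loop a P => fun s => rounds P.run (s a).toNat s

/-- The initial store: the input in the registers `0, 1, …`, all others `0`. -/
def load (l : List ℤ) : Store := fun i => l.getD i 0

/-- The cost of every run on the security parameter `κ` and an input `l` is at most a fixed
polynomial in `κ` and the length of `l` in bits. -/
def Prog.PolyTime (P : Prog) : Prop :=
  ∃ p : Polynomial ℕ, ∀ (κ : ℕ) (l : List ℤ),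
    ∀ x ∈ (P.run (load ((κ : ℤ) :: l))).support, x.2 ≤ p.eval (κ + (l.map fun v => 1 + bits v).sum)

/-- A program together with the number of registers that it returns. -/
structure Alg where
  code : Prog
  outLen : ℕ

/-- The distribution of the output on the security parameter `κ` and the input `l`. -/
noncomputable def Alg.output (P : Alg) (κ : ℕ) (l : List ℤ) : PMF (List ℤ) :=
  (P.code.run (load ((κ : ℤ) :: l))).map fun x => (List.range P.outLen).map x.1

/-- The distribution of the decision of a distinguisher, which accepts by `R_0 = 1`. -/
noncomputable def Prog.decision (P : Prog) (κ : ℕ) (l : List ℤ) : PMF Bool :=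
  (P.run (load ((κ : ℤ) :: l))).map fun x => decide (x.1 0 = 1)

/-- Negligible functions of the security parameter: `κ ^ c * μ κ → 0` for every `c`. -/
def Negligible (μ : ℕ → ℝ) : Prop :=
  Asymptotics.SuperpolynomialDecay Filter.atTop (fun κ : ℕ => (κ : ℝ)) μ

/-- The advantage in telling two experiments apart. -/
noncomputable def advantage (P Q : PMF Bool) : ℝ := |(P true).toReal - (Q true).toReal|

/-! ### The ideal–real paradigm, semi-honest corruption of one of two parties -/

inductive Party
  | A | B

/-- What an execution of a protocol leaves behind: the view of each party (its input, its random
choices and the messages that it received) and the output of each party. -/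
structure Execution where
  view : Party → List ℤ
  out : Party → List ℤ

section Paradigm

variable {K I : Type}

/-- The real interaction. Keys are set up (`known` is what the setup tells a party); the environment,
seeing what the corrupted party `c` knows, chooses the inputs of both parties; the protocol is
run; the adversary computes an arbitrary value from the view of `c`; the environment decides
on the basis of that value and of the outputs of both parties. `z` is an auxiliary input. -/
noncomputable def realExperiment (gen : ℕ → PMF K) (known : ℕ → Party → K → List ℤ)
    (parse : ℕ → K → List ℤ → I) (protocol : ℕ → I → PMF Execution)
    (c : Party) (adv choose : Alg) (guess : Prog) (κ : ℕ) (z : ℤ) : PMF Bool :=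
  (gen κ).bind fun k =>
  (choose.output κ (z :: known κ c k)).bind fun l =>
  (protocol κ (parse κ k l)).bind fun e =>
  (adv.output κ (z :: e.view c)).bind fun a =>
  guess.decision κ (z :: (known κ c k ++ l ++ a ++ e.out .A ++ e.out .B))

/-- The ideal interaction. The simulator only has the input of the corrupted party and what the
ideal functionality returns to that party. -/
noncomputable def idealExperiment (gen : ℕ → PMF K) (known : ℕ → Party → K → List ℤ)
    (parse : ℕ → K → List ℤ → I) (input : ℕ → Party → I → List ℤ)
    (functionality : ℕ → I → PMF (Party → List ℤ))
    (c : Party) (sim choose : Alg) (guess : Prog) (κ : ℕ) (z : ℤ) : PMF Bool :=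
  (gen κ).bind fun k =>
  (choose.output κ (z :: known κ c k)).bind fun l =>
  (functionality κ (parse κ k l)).bind fun o =>
  (sim.output κ (z :: (input κ c (parse κ k l) ++ o c))).bind fun a =>
  guess.decision κ (z :: (known κ c k ++ l ++ a ++ o .A ++ o .B))

/-- For either corrupted party and every adversary there is a simulator such that no environment
with polynomially long auxiliary input tells the two interactions apart, except with negligible
probability; adversary, simulator and environment are probabilistic polynomial-time. -/
def SecurelyRealizes (gen : ℕ → PMF K) (known : ℕ → Party → K → List ℤ)
    (parse : ℕ → K → List ℤ → I) (input : ℕ → Party → I → List ℤ)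
    (protocol : ℕ → I → PMF Execution) (functionality : ℕ → I → PMF (Party → List ℤ)) : Prop :=
  ∀ (c : Party) (adv : Alg), adv.code.PolyTime →
    ∃ sim : Alg, sim.code.PolyTime ∧
      ∀ (choose : Alg) (guess : Prog), choose.code.PolyTime → guess.PolyTime →
        ∀ q : Polynomial ℕ, ∃ μ : ℕ → ℝ, Negligible μ ∧
          ∀ (κ : ℕ) (z : ℤ), bits z ≤ q.eval κ →
            advantage
              (realExperiment gen known parse protocol c adv choose guess κ z)
              (idealExperiment gen known parse input functionality c sim choose guess κ z) ≤ μ κ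

end Paradigm

/-! ### The Paillier cryptosystem -/

/-- A secret key: the prime factors of the modulus. -/
structure PaillierKey where
  p : ℕ
  q : ℕ
  prime_p : p.Prime
  prime_q : q.Prime
  ne : p ≠ q
  coprime : Nat.Coprime (p * q) ((p - 1) * (q - 1))

/-- The public key: the modulus `N = p q`. -/
def PaillierKey.N (k : PaillierKey) : ℕ := k.p * k.q

theorem PaillierKey.one_lt_N (k : PaillierKey) : 1 < k.N :=
  Nat.one_lt_mul_iff.2 ⟨k.prime_p.pos, k.prime_q.pos, Or.inl k.prime_p.one_lt⟩

/-- Representatives of the units modulo `n`. -/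
def unitReps (n : ℕ) : Finset ℕ := (Finset.range n).filter fun r => Nat.Coprime r n

theorem unitReps_nonempty {n : ℕ} (h : 1 < n) : (unitReps n).Nonempty :=
  ⟨1, by simp [unitReps, h]⟩

/-- A plaintext `m : ℤ`, taken modulo `N`, with encryption randomness `r`:
`(1 + N) ^ m * r ^ N mod N ^ 2`. -/
def enc (N : ℕ) (m : ℤ) (r : ℕ) : ℕ := ((1 + N) ^ (m % (N : ℤ)).toNat * r ^ N) % N ^ 2

/-- Decryption `L(c ^ λ mod N ^ 2) * λ⁻¹ mod N` with `λ = (p - 1) (q - 1)`, `L(u) = (u - 1) / N`;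
the result is the representative of least absolute value. -/
def dec (k : PaillierKey) (c : ℕ) : ℤ :=
  Int.bmod
    ((((((c ^ ((k.p - 1) * (k.q - 1)) % k.N ^ 2 - 1) / k.N : ℕ) : ZMod k.N)
      * (((k.p - 1) * (k.q - 1) : ℕ) : ZMod k.N)⁻¹).val : ℕ) : ℤ) k.N

/-- Homomorphic addition. -/
def hAdd (N : ℕ) (c c' : ℕ) : ℕ := (c * c') % N ^ 2

/-- Entrywise encryption. -/
def encMat {m n : ℕ} (N : ℕ) (M : Matrix (Fin m) (Fin n) ℤ) (r : Matrix (Fin m) (Fin n) ℕ) :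
    Matrix (Fin m) (Fin n) ℕ :=
  Matrix.of fun i j => enc N (M i j) (r i j)

/-- Entrywise decryption. -/
def decMat {m n : ℕ} (k : PaillierKey) (C : Matrix (Fin m) (Fin n) ℕ) :
    Matrix (Fin m) (Fin n) ℤ :=
  Matrix.of fun i j => dec k (C i j)

/-- The product of a plaintext and an encrypted matrix: a scalar multiple `x ⟦v⟧` is the power
`c ^ x` of the ciphertext (exponent modulo `N`), a sum of ciphertexts is their product. -/
def hMatMul {m d n : ℕ} (N : ℕ) (X : Matrix (Fin m) (Fin d) ℤ) (C : Matrix (Fin d) (Fin n) ℕ) :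
    Matrix (Fin m) (Fin n) ℕ :=
  Matrix.of fun i j => (∏ k, C k j ^ (X i k % (N : ℤ)).toNat) % N ^ 2

/-- The message of the conversion of an encrypted into a secretly shared matrix:
`⟦v - φ⟧ = ⟦v⟧ + Enc(-φ)`, the latter with fresh randomness `r`. -/
def he2ss {m n : ℕ} (N : ℕ) (C : Matrix (Fin m) (Fin n) ℕ) (φ : Matrix (Fin m) (Fin n) ℤ)
    (r : Matrix (Fin m) (Fin n) ℕ) : Matrix (Fin m) (Fin n) ℕ :=
  Matrix.of fun i j => hAdd N (C i j) (enc N (-φ i j) (r i j))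

/-- A matrix with independent entries, uniform in a finite set. -/
noncomputable def uniformMat {α : Type} (m n : ℕ) (S : Finset α) (h : S.Nonempty) :
    PMF (Matrix (Fin m) (Fin n) α) :=
  (PMF.uniformOfFinset (Fintype.piFinset fun _ : Fin m => Fintype.piFinset fun _ : Fin n => S)
    (Fintype.piFinset_nonempty.2 fun _ => Fintype.piFinset_nonempty.2 fun _ => h)).map Matrix.of

/-- Fresh encryption randomness for a matrix. -/
noncomputable def encCoins (m n : ℕ) (k : PaillierKey) : PMF (Matrix (Fin m) (Fin n) ℕ) :=
  uniformMat m n (unitReps k.N) (unitReps_nonempty k.one_lt_N)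

/-- A random mask, the share `φ` of the party that starts the conversion: entries uniform in
`[0, 2 ^ s)`. -/
noncomputable def maskCoins (m n s : ℕ) : PMF (Matrix (Fin m) (Fin n) ℤ) :=
  uniformMat m n (Finset.Ico (0 : ℤ) (2 ^ s)) ⟨0, by simp⟩

/-- The decisional composite residuosity assumption for the key generator `gen`, against
probabilistic polynomial-time distinguishers with auxiliary input: `N`-th powers are
indistinguishable from arbitrary units modulo `N ^ 2`. -/
def DCRAssumption (gen : ℕ → PMF PaillierKey) : Prop :=
  ∀ D : Prog, D.PolyTime → ∀ q : Polynomial ℕ, ∃ μ : ℕ → ℝ, Negligible μ ∧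
    ∀ (κ : ℕ) (z : ℤ), bits z ≤ q.eval κ →
      advantage
        ((gen κ).bind fun k =>
          (PMF.uniformOfFinset (unitReps (k.N ^ 2))
            (unitReps_nonempty (Nat.one_lt_pow two_ne_zero k.one_lt_N))).bind fun r =>
          D.decision κ [z, k.N, (r ^ k.N % k.N ^ 2 : ℕ)])
        ((gen κ).bind fun k =>
          (PMF.uniformOfFinset (unitReps (k.N ^ 2))
            (unitReps_nonempty (Nat.one_lt_pow two_ne_zero k.one_lt_N))).bind fun r =>
          D.decision κ [z, k.N, r]) ≤ μ κ

/-! ### The source layer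

Features, weights and derivatives are fixed-point numbers, represented as integers. -/

/-- The entries of a matrix, row by row. -/
def flat {m n : ℕ} (M : Matrix (Fin m) (Fin n) ℤ) : List ℤ :=
  (List.finRange m).flatMap fun i => (List.finRange n).map fun j => M i j

/-- The same for a matrix of ciphertexts or of encryption randomness. -/
def flatNat {m n : ℕ} (M : Matrix (Fin m) (Fin n) ℕ) : List ℤ :=
  flat (M.map fun v => (v : ℤ))

/-- Features, plaintext share and encrypted share of a party. -/
structure PartyData (bs d out : ℕ) where
  X : Matrix (Fin bs) (Fin d) ℤ
  U : Matrix (Fin d) (Fin out) ℤ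
  encV : Matrix (Fin d) (Fin out) ℕ

def PartyData.toList {bs d out : ℕ} (x : PartyData bs d out) : List ℤ :=
  flat x.X ++ flat x.U ++ flatNat x.encV

/-- The inputs of both parties: `a.encV` is encrypted under the key of `B`, `b.encV` under the key
of `A`; the derivatives `dZ` belong to `B` and are an input of the backward propagation only. -/
structure LayerInput (bs dA dB out : ℕ) where
  keyA : PaillierKey
  keyB : PaillierKey
  a : PartyData bs dA out
  b : PartyData bs dB out
  dZ : Matrix (Fin bs) (Fin out) ℤ

/-- The keys of a party after the setup: its own secret key and the public key of the other one. -/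
def keysOf (kA kB : PaillierKey) : Party → List ℤ
  | .A => [(kA.p : ℤ), kA.q, kB.N]
  | .B => [(kB.p : ℤ), kB.q, kA.N]

/-- The input of a party for the forward propagation, preceded by the public range `2 ^ s` of the
masks. -/
def fwInput {bs dA dB out : ℕ} (s : ℕ) (c : Party) (x : LayerInput bs dA dB out) : List ℤ :=
  2 ^ s :: (keysOf x.keyA x.keyB c ++
    match c with
    | .A => x.a.toList
    | .B => x.b.toList)

/-- The input of a party for the backward propagation. -/
def bwInput {bs dA dB out : ℕ} (s : ℕ) (c : Party) (x : LayerInput bs dA dB out) : List ℤ :=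
  fwInput s c x ++
    match c with
    | .A => []
    | .B => flat x.dZ

/-- Values of absolute value at least `2 ^ b` are not representable and are read as `0`. -/
def clamp (b : ℕ) (v : ℤ) : ℤ := if |v| < 2 ^ b then v else 0

/-- Encryption randomness: a value that is not a unit modulo `N` is read as `1`. -/
def toUnit (N : ℕ) (v : ℤ) : ℕ := if Nat.Coprime v.natAbs N then v.natAbs % N else 1

/-- The `m × n` matrix that starts at position `off` of a list. -/
def readMat (l : List ℤ) (off m n : ℕ) : Matrix (Fin m) (Fin n) ℤ :=
  Matrix.of fun i j => l.getD (off + i * n + j) 0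

/-- The inputs chosen by the environment, as a list holding `X_A, U_A, V_A` and the encryption
randomness of `⟦V_A⟧`, the same for `B`, and `∇Z`. -/
def parseInput (bs dA dB out b : ℕ) (k : PaillierKey × PaillierKey) (l : List ℤ) :
    LayerInput bs dA dB out :=
  let oB := bs * dA + 3 * (dA * out)
  let oZ := oB + bs * dB + 3 * (dB * out)
  { keyA := k.1
    keyB := k.2
    a :=
      { X := (readMat l 0 bs dA).map (clamp b)
        U := readMat l (bs * dA) dA out
        encV := encMat k.2.N ((readMat l (bs * dA + dA * out) dA out).map (clamp b))
          ((readMat l (bs * dA + 2 * (dA * out)) dA out).map (toUnit k.2.N)) }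
    b :=
      { X := (readMat l oB bs dB).map (clamp b)
        U := readMat l (oB + bs * dB) dB out
        encV := encMat k.1.N ((readMat l (oB + bs * dB + dB * out) dB out).map (clamp b))
          ((readMat l (oB + bs * dB + 2 * (dB * out)) dB out).map (toUnit k.1.N)) }
    dZ := (readMat l oZ bs out).map (clamp b) }

/-- The ideal functionality of the forward propagation: `A` gets nothing and `B` gets
`Z = X_A W_A + X_B W_B`, where `W = U + V`. -/
noncomputable def matMulFwFunctionality {bs dA dB out : ℕ} (x : LayerInput bs dA dB out) :
    PMF (Party → List ℤ) :=
  let WA := x.a.U + decMat x.keyB x.a.encV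
  let WB := x.b.U + decMat x.keyA x.b.encV
  PMF.pure fun
    | .A => []
    | .B => flat (x.a.X * WA + x.b.X * WB)

/-- The forward propagation. -/
noncomputable def matMulFwProtocol {bs dA dB out : ℕ} (s : ℕ) (x : LayerInput bs dA dB out) :
    PMF Execution :=
  (maskCoins bs out s).bind fun εA =>
  (encCoins bs out x.keyB).bind fun rA =>
  (maskCoins bs out s).bind fun εB =>
  (encCoins bs out x.keyA).map fun rB =>
  -- from `A` to `B`: `⟦X_A V_A - ε_A⟧` under the key of `B`; and symmetrically
  let msgAB := he2ss x.keyB.N (hMatMul x.keyB.N x.a.X x.a.encV) εA rA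
  let msgBA := he2ss x.keyA.N (hMatMul x.keyA.N x.b.X x.b.encV) εB rB
  let ZA := x.a.X * x.a.U + εA + decMat x.keyA msgBA
  let ZB := x.b.X * x.b.U + εB + decMat x.keyB msgAB
  -- `ZA` is sent from `A` to `B`
  { view := fun
      | .A => fwInput s .A x ++ flat εA ++ flatNat rA ++ flatNat msgBA
      | .B => fwInput s .B x ++ flat εB ++ flatNat rB ++ flatNat msgAB ++ flat ZA
    out := fun
      | .A => []
      | .B => flat (ZA + ZB) }

/-- The ideal functionality of the backward propagation: `A` gets a random `φ` and `B` gets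
`∇W_A - φ` and `∇W_B`, where `∇W = Xᵀ ∇Z`. -/
noncomputable def matMulBwFunctionality {bs dA dB out : ℕ} (s : ℕ)
    (x : LayerInput bs dA dB out) : PMF (Party → List ℤ) :=
  (maskCoins dA out s).map fun φ => fun
    | .A => flat φ
    | .B => flat (x.a.X.transpose * x.dZ - φ) ++ flat (x.b.X.transpose * x.dZ)

/-- The backward propagation; the updates of the shares of the weights are local. -/
noncomputable def matMulBwProtocol {bs dA dB out : ℕ} (s : ℕ) (x : LayerInput bs dA dB out) :
    PMF Execution :=
  (encCoins bs out x.keyB).bind fun t =>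
  (maskCoins dA out s).bind fun φ =>
  (encCoins dA out x.keyB).bind fun r =>
  (encCoins dA out x.keyB).map fun u =>
  -- from `B` to `A`: `⟦∇Z⟧`
  let msg₁ := encMat x.keyB.N x.dZ t
  -- from `A` to `B`: `⟦∇W_A - φ⟧`
  let msg₂ := he2ss x.keyB.N (hMatMul x.keyB.N x.a.X.transpose msg₁) φ r
  let share := decMat x.keyB msg₂
  -- from `B` to `A`: `⟦∇W_A - φ⟧`, encrypted afresh, for the update of `⟦V_A⟧`
  let msg₃ := encMat x.keyB.N share u
  { view := fun
      | .A => bwInput s .A x ++ flat φ ++ flatNat r ++ flatNat msg₁ ++ flatNat msg₃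
      | .B => bwInput s .B x ++ flatNat t ++ flatNat u ++ flatNat msg₂
    out := fun
      | .A => flat φ
      | .B => flat share ++ flat (x.b.X.transpose * x.dZ) }

/-- The parties generate their keys independently. -/
noncomputable def keySetup (gen : ℕ → PMF PaillierKey) (κ : ℕ) : PMF (PaillierKey × PaillierKey) :=
  (gen κ).bind fun kA => (gen κ).map fun kB => (kA, kB)

/-- What a party knows after the setup: the range of the masks and its keys. -/
def knownKeys (s : ℕ) (c : Party) (k : PaillierKey × PaillierKey) : List ℤ :=
  2 ^ s :: keysOf k.1 k.2 c

end MatMulSource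

/-! Modulo `N ^ 2` a Paillier ciphertext is `(1 + m N) * r ^ N`, and `a ↦ 1 + a N` is a homomorphism
from `ℤ` because `N ^ 2 = 0`. Hence the homomorphic product has a plaintext part `X V` and a
randomness part that is a unit. The fresh factor of HE2SS turns that unit into a uniform one, so a
conversion message is distributed like a fresh encryption of `X V - φ` (`he2ss_hMatMul`,
`encCoins_bind_he2ss`). The size condition on `N` excludes wraparound, so decryption is exact
(`dec_enc`, `decMat_he2ss`) and the outputs of the protocols agree with those of the
functionalities.

In the forward propagation a party only receives ciphertexts under its own key, so what has to be
simulated is the plaintext `X V - ε`. A mask that is long compared with `X V` makes it statistically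
close to `-ε` (`close_mask_shift`). The further message `Z_A` to `B` is `Z - Z_B`, computable from
the output of `B` and the rest of its view (`fwSimA_close`, `fwSimB_close`). In the backward
propagation the plaintext that `B` decrypts is its own output share (`bwSimB_close`).

The remaining view, that of `A` in the backward propagation, contains encryptions of `∇Z` and `∇W_A
- φ` under the key of `B`; the simulator encrypts `0` instead. Replacing the factors `r ^ N` by
uniform units modulo `N ^ 2` is undetectable under the residuosity assumption. With uniform units
the plaintexts may be exchanged for `0` without any change of distribution (`unitSq_bind_bwGame`),
and a second use of the assumption leads back to encryptions.

Two points need care. One sample of the assumption has to become two matrices of samples: this is a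
hybrid argument (`Indist.prod`, `Indist.sampleVec`), in which the distinguisher generates the other
samples itself, approximately, from `N` alone. Moreover, the distinguisher must run the whole
experiment although neither the key generator nor the parameters `b`, `s` need be computable: the
key of `A` and the numbers `2 ^ s`, `2 ^ b` are packed into its auxiliary input
(`exists_reduction`), which is legitimate because the bound is uniform in that input.

Polynomial time is established for concrete register programs. Calls of relocated subroutines give
closure under composition (`Alg.comp_output`, `PPT.bind`), and loops give powers with exponent `κ`,
modular powers and greatest common divisors. -/

open scoped ENNReal NNReal

namespace MatMulSource

/-! ### Statistical closeness -/

section Closeness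

variable {α β : Type*}

/-- The expectation of a nonnegative function. -/
noncomputable def expect (P : PMF α) (f : α → ℝ≥0∞) : ℝ≥0∞ := ∑' a, P a * f a

theorem expect_bind (P : PMF α) (g : α → PMF β) (f : β → ℝ≥0∞) :
    expect (P.bind g) f = expect P fun a => expect (g a) f := by
  unfold expect
  simp only [PMF.bind_apply, ← ENNReal.tsum_mul_right, ← ENNReal.tsum_mul_left]
  rw [ENNReal.tsum_comm]
  simp only [mul_assoc]

theorem expect_mono {P : PMF α} {f g : α → ℝ≥0∞} (h : ∀ a ∈ P.support, f a ≤ g a) :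
    expect P f ≤ expect P g := by
  refine ENNReal.tsum_le_tsum fun a => ?_
  by_cases ha : a ∈ P.support
  · exact mul_le_mul_right (h a ha) _
  · simp [(P.apply_eq_zero_iff a).2 ha]

theorem expect_add_const (P : PMF α) (f : α → ℝ≥0∞) (c : ℝ≥0∞) :
    expect P (fun a => f a + c) = expect P f + c := by
  simp [expect, mul_add, ENNReal.tsum_add, ENNReal.tsum_mul_right, P.tsum_coe]

theorem expect_le_one {P : PMF α} {f : α → ℝ≥0∞} (h : ∀ a, f a ≤ 1) : expect P f ≤ 1 := by
  calc expect P f ≤ expect P fun _ => 1 := expect_mono fun a _ => h a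
    _ = 1 := by simp [expect, P.tsum_coe]

theorem expect_uniformOfFinset (S : Finset α) (h : S.Nonempty) (f : α → ℝ≥0∞) :
    expect (PMF.uniformOfFinset S h) f = (∑ a ∈ S, f a) / S.card := by
  classical
  unfold expect
  rw [tsum_eq_sum (s := S)]
  · rw [div_eq_mul_inv, Finset.sum_mul]
    refine Finset.sum_congr rfl fun a ha => ?_
    rw [PMF.uniformOfFinset_apply_of_mem h ha, mul_comm]
  · intro a ha
    simp [PMF.uniformOfFinset_apply_of_notMem h ha]

/-- `P` and `Q` have statistical distance at most `ε`: the expectations of a function with values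
in `[0, 1]` differ by at most `ε`. -/
def Close (ε : ℝ≥0) (P Q : PMF α) : Prop :=
  ∀ f : α → ℝ≥0∞, (∀ a, f a ≤ 1) →
    expect P f ≤ expect Q f + ε ∧ expect Q f ≤ expect P f + ε

theorem Close.refl (P : PMF α) : Close 0 P P := fun _ _ => by simp

theorem Close.symm {ε : ℝ≥0} {P Q : PMF α} (h : Close ε P Q) : Close ε Q P :=
  fun f hf => (h f hf).symm

theorem Close.mono {ε δ : ℝ≥0} {P Q : PMF α} (h : Close ε P Q) (hle : ε ≤ δ) : Close δ P Q := by
  have : (ε : ℝ≥0∞) ≤ δ := by exact_mod_cast hle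
  exact fun f hf => ⟨(h f hf).1.trans (by gcongr), (h f hf).2.trans (by gcongr)⟩

theorem Close.trans {ε δ : ℝ≥0} {P Q R : PMF α} (h : Close ε P Q) (h' : Close δ Q R) :
    Close (ε + δ) P R := by
  intro f hf
  have h₁ := h f hf
  have h₂ := h' f hf
  push_cast
  constructor
  · calc expect P f ≤ expect Q f + ε := h₁.1
      _ ≤ expect R f + δ + ε := by gcongr; exact h₂.1
      _ = _ := by ring
  · calc expect R f ≤ expect Q f + δ := h₂.2
      _ ≤ expect P f + ε + δ := by gcongr; exact h₁.2
      _ = _ := by ring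

/-- Data processing: averaging a test over the kernel `g` gives another test with values in `[0,
1]`. -/
theorem Close.bind_left {ε : ℝ≥0} {P Q : PMF α} (h : Close ε P Q) (g : α → PMF β) :
    Close ε (P.bind g) (Q.bind g) := by
  intro f hf
  simp only [expect_bind]
  exact h _ fun a => expect_le_one hf

theorem Close.map {ε : ℝ≥0} {P Q : PMF α} (h : Close ε P Q) (g : α → β) :
    Close ε (P.map g) (Q.map g) :=
  h.bind_left _

theorem Close.bind_right {ε : ℝ≥0} (P : PMF α) {g g' : α → PMF β}
    (h : ∀ a ∈ P.support, Close ε (g a) (g' a)) : Close ε (P.bind g) (P.bind g') := by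
  intro f hf
  rw [expect_bind, expect_bind, ← expect_add_const P, ← expect_add_const P]
  exact ⟨expect_mono fun a ha => (h a ha f hf).1, expect_mono fun a ha => (h a ha f hf).2⟩

/-- A hybrid step: exchange the source under the old kernel, then the kernel under the new source;
the errors add. -/
theorem Close.bind {ε δ : ℝ≥0} {P Q : PMF α} {g g' : α → PMF β} (h : Close ε P Q)
    (h' : ∀ a ∈ Q.support, Close δ (g a) (g' a)) : Close (ε + δ) (P.bind g) (Q.bind g') :=
  (h.bind_left g).trans (Close.bind_right Q h')

theorem bind_congr_support {P : PMF α} {g g' : α → PMF β} (h : ∀ a ∈ P.support, g a = g' a) :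
    P.bind g = P.bind g' := by
  ext b
  simp only [PMF.bind_apply]
  refine tsum_congr fun a => ?_
  by_cases ha : a ∈ P.support
  · rw [h a ha]
  · simp [(P.apply_eq_zero_iff a).2 ha]

theorem map_congr_support {P : PMF α} {g g' : α → β} (h : ∀ a ∈ P.support, g a = g' a) :
    P.map g = P.map g' :=
  bind_congr_support fun a ha => by simp [h a ha]

theorem apply_true_eq_expect (P : PMF Bool) : P true = expect P fun b => if b then 1 else 0 := by
  simp [expect, tsum_fintype]

/-- The acceptance probabilities of two experiments differ by at most `ε`. -/
theorem advantage_le_iff {P Q : PMF Bool} {ε : ℝ≥0} :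
    advantage P Q ≤ ε ↔ P true ≤ Q true + ε ∧ Q true ≤ P true + ε := by
  have key : ∀ P Q : PMF Bool, P true ≤ Q true + ε ↔ (P true).toReal ≤ (Q true).toReal + ε := by
    intro P Q
    have hP := P.apply_ne_top true
    have hQ := Q.apply_ne_top true
    rw [← ENNReal.toReal_le_toReal hP (by finiteness), ENNReal.toReal_add hQ (by finiteness)]
    simp
  rw [advantage, abs_le, key P Q, key Q P]
  constructor
  · rintro ⟨h₁, h₂⟩
    constructor <;> linarith
  · rintro ⟨h₁, h₂⟩
    constructor <;> linarith

theorem Close.advantage_le {ε : ℝ≥0} {P Q : PMF Bool} (h : Close ε P Q) : advantage P Q ≤ ε := by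
  rw [advantage_le_iff, apply_true_eq_expect, apply_true_eq_expect]
  exact h _ fun b => by split_ifs <;> simp

theorem advantage_comm (P Q : PMF Bool) : advantage P Q = advantage Q P := abs_sub_comm _ _

theorem advantage_triangle (P Q R : PMF Bool) :
    advantage P R ≤ advantage P Q + advantage Q R := abs_sub_le _ _ _

theorem advantage_nonneg (P Q : PMF Bool) : 0 ≤ advantage P Q := abs_nonneg _

theorem advantage_bind_le (P : PMF α) {g g' : α → PMF Bool} {ε : ℝ≥0}
    (h : ∀ a ∈ P.support, advantage (g a) (g' a) ≤ ε) :
    advantage (P.bind g) (P.bind g') ≤ ε := by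
  rw [advantage_le_iff]
  have e : ∀ g : α → PMF Bool, P.bind g true = expect P fun a => g a true := by
    intro g
    simp [expect, PMF.bind_apply]
  simp only [e, ← expect_add_const]
  exact ⟨expect_mono fun a ha => (advantage_le_iff.1 (h a ha)).1,
    expect_mono fun a ha => (advantage_le_iff.1 (h a ha)).2⟩

end Closeness

/-! ### Independent samples -/

section Samples

variable {α β : Type}

/-- Independent samples from a finite family of distributions. -/
noncomputable def sampleVec : (n : ℕ) → (Fin n → PMF α) → PMF (Fin n → α)
  | 0, _ => PMF.pure Fin.elim0
  | n + 1, P => (P 0).bind fun a => (sampleVec n fun i => P i.succ).map fun v => Fin.cons a v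

theorem sampleVec_apply : ∀ (n : ℕ) (P : Fin n → PMF α) (v : Fin n → α),
    sampleVec n P v = ∏ i, P i (v i)
  | 0, P, v => by
    have : v = Fin.elim0 := Subsingleton.elim _ _
    simp [sampleVec, this]
  | n + 1, P, v => by
    classical
    rw [sampleVec, PMF.bind_apply, tsum_eq_single (v 0), PMF.map_apply,
      tsum_eq_single (Fin.tail v), sampleVec_apply n, Fin.prod_univ_succ]
    · rw [if_pos (Fin.cons_self_tail v).symm]
      rfl
    · intro w hw
      rw [if_neg]
      intro h
      exact hw (by rw [h, Fin.tail_cons])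
    · intro a ha
      rw [PMF.map_apply, ENNReal.tsum_eq_zero.2, mul_zero]
      intro w
      rw [if_neg]
      intro h
      exact ha (by rw [h, Fin.cons_zero])

theorem Close.sampleVec {ε : ℝ≥0} : ∀ {n : ℕ} {P Q : Fin n → PMF α},
    (∀ i, Close ε (P i) (Q i)) → Close (n * ε) (sampleVec n P) (sampleVec n Q)
  | 0, P, Q, _ => by
    simpa [MatMulSource.sampleVec] using Close.refl _
  | n + 1, P, Q, h => by
    have := (h 0).bind (g := fun a => (MatMulSource.sampleVec n fun i => P i.succ).map
      fun v => (Fin.cons a v : Fin (n + 1) → α)) fun a _ =>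
      (Close.sampleVec (n := n) fun i => h i.succ).map _
    refine this.mono (le_of_eq ?_)
    push_cast
    ring

theorem sampleVec_map : ∀ (n : ℕ) (P : Fin n → PMF α) (g : Fin n → α → β),
    (sampleVec n P).map (fun v i => g i (v i)) = sampleVec n fun i => (P i).map (g i)
  | 0, P, g => by
    rw [sampleVec, sampleVec, PMF.pure_map]
    congr 1
    exact Subsingleton.elim _ _
  | n + 1, P, g => by
    rw [sampleVec, sampleVec, PMF.map_bind, PMF.bind_map]
    congr 1
    funext a
    rw [Function.comp_apply, ← sampleVec_map n _ fun i => g i.succ, PMF.map_comp, PMF.map_comp]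
    congr 1
    funext v i
    refine Fin.cases ?_ (fun j => ?_) i <;> simp

/-- Both sides give mass `|S|⁻ⁿ` to vectors with entries in `S` and none to others. The sequential
form is the one that programs can execute and hybrid arguments can alter entry by entry. -/
theorem uniformOfFinset_piFinset (n : ℕ) (S : Finset α) (h : S.Nonempty)
    (h' : (Fintype.piFinset fun _ : Fin n => S).Nonempty) :
    PMF.uniformOfFinset (Fintype.piFinset fun _ : Fin n => S) h' =
      sampleVec n fun _ => PMF.uniformOfFinset S h := by
  classical
  ext v
  rw [sampleVec_apply]
  by_cases hv : ∀ i, v i ∈ S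
  · rw [PMF.uniformOfFinset_apply_of_mem _ (by simpa using hv)]
    simp only [PMF.uniformOfFinset_apply_of_mem _ (hv _), Fintype.card_piFinset]
    simp [ENNReal.inv_pow]
  · rw [PMF.uniformOfFinset_apply_of_notMem _ (by simpa using hv)]
    push Not at hv
    obtain ⟨i, hi⟩ := hv
    refine (Finset.prod_eq_zero (Finset.mem_univ i) ?_).symm
    exact PMF.uniformOfFinset_apply_of_notMem _ hi

/-- Independent samples from a matrix of distributions. -/
noncomputable def sampleMat (m n : ℕ) (P : Fin m → Fin n → PMF α) :
    PMF (Matrix (Fin m) (Fin n) α) :=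
  (sampleVec m fun i => sampleVec n (P i)).map Matrix.of

theorem uniformMat_eq_sampleMat (m n : ℕ) (S : Finset α) (h : S.Nonempty) :
    uniformMat m n S h = sampleMat m n fun _ _ => PMF.uniformOfFinset S h := by
  rw [uniformMat, sampleMat, uniformOfFinset_piFinset m _ (Fintype.piFinset_nonempty.2 fun _ => h)]
  simp only [uniformOfFinset_piFinset n S h]

theorem mem_support_uniformMat {m n : ℕ} {S : Finset α} {h : S.Nonempty}
    {M : Matrix (Fin m) (Fin n) α} (hM : M ∈ (uniformMat m n S h).support) (i : Fin m)
    (j : Fin n) : M i j ∈ S := by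
  simp only [uniformMat, PMF.support_map, PMF.support_uniformOfFinset] at hM
  obtain ⟨v, hv, rfl⟩ := hM
  have : v ∈ Fintype.piFinset fun _ : Fin m => Fintype.piFinset fun _ : Fin n => S := hv
  simp only [Fintype.mem_piFinset] at this
  exact this i j

theorem Close.sampleMat {ε : ℝ≥0} {m n : ℕ} {P Q : Fin m → Fin n → PMF α}
    (h : ∀ i j, Close ε (P i j) (Q i j)) :
    Close (m * (n * ε)) (sampleMat m n P) (sampleMat m n Q) :=
  (Close.sampleVec fun i => Close.sampleVec (h i)).map _

theorem sampleMat_map {m n : ℕ} (P : Fin m → Fin n → PMF α) (g : Fin m → Fin n → α → β) :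
    (sampleMat m n P).map (fun M => Matrix.of fun i j => g i j (M i j)) =
      sampleMat m n fun i j => (P i j).map (g i j) := by
  simp only [sampleMat, ← sampleVec_map, PMF.map_comp]
  rfl

end Samples

/-! ### Uniform distributions -/

section Uniform

variable {α β : Type*}

/-- A map with fibres of equal size takes uniform to uniform. -/
theorem uniformOfFinset_map [DecidableEq β] {S : Finset α} {T : Finset β} (hS : S.Nonempty)
    (hT : T.Nonempty) (f : α → β) (hf : ∀ a ∈ S, f a ∈ T) (c : ℕ)
    (hc : ∀ b ∈ T, (S.filter fun a => f a = b).card = c) :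
    (PMF.uniformOfFinset S hS).map f = PMF.uniformOfFinset T hT := by
  classical
  have hcard : S.card = T.card * c := by
    rw [Finset.card_eq_sum_card_fiberwise hf, Finset.sum_congr rfl hc, Finset.sum_const,
      smul_eq_mul]
  have hS0 : S.card ≠ 0 := hS.card_pos.ne'
  have hc0 : c ≠ 0 := by
    rintro rfl
    exact hS0 (by simpa using hcard)
  ext b
  rw [PMF.map_apply, tsum_eq_sum (s := S)]
  · by_cases hb : b ∈ T
    · rw [PMF.uniformOfFinset_apply_of_mem hT hb]
      calc _ = ∑ a ∈ S, (if f a = b then (S.card : ℝ≥0∞)⁻¹ else 0) := by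
            refine Finset.sum_congr rfl fun a ha => ?_
            rw [PMF.uniformOfFinset_apply_of_mem hS ha]
            simp only [eq_comm]
            congr
        _ = c * (S.card : ℝ≥0∞)⁻¹ := by
            rw [← Finset.sum_filter, Finset.sum_const, hc b hb, nsmul_eq_mul]
        _ = (T.card : ℝ≥0∞)⁻¹ := by
            rw [hcard]
            push_cast
            rw [ENNReal.mul_inv (by right; finiteness) (by right; exact_mod_cast hc0), mul_comm,
              mul_assoc, ENNReal.inv_mul_cancel (by exact_mod_cast hc0) (by finiteness), mul_one]
    · rw [PMF.uniformOfFinset_apply_of_notMem hT hb]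
      refine Finset.sum_eq_zero fun a ha => if_neg ?_
      rintro rfl
      exact hb (hf a ha)
  · intro a ha
    simp [PMF.uniformOfFinset_apply_of_notMem hS ha]

/-- An injection into a set that is not larger is onto, so all fibres are singletons. -/
theorem uniformOfFinset_map_of_injOn {S T : Finset α} (hS : S.Nonempty) (hT : T.Nonempty)
    (f : α → α) (hf : ∀ a ∈ S, f a ∈ T) (hi : Set.InjOn f S) (hc : T.card ≤ S.card) :
    (PMF.uniformOfFinset S hS).map f = PMF.uniformOfFinset T hT := by
  classical
  refine uniformOfFinset_map hS hT f hf 1 fun b hb => ?_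
  obtain ⟨a, ha, rfl⟩ := Finset.surj_on_of_inj_on_of_card_le (fun a _ => f a) hf
    (fun a a' ha ha' h => hi ha ha' h) hc b hb
  rw [Finset.card_eq_one]
  refine ⟨a, ?_⟩
  ext x
  simp only [Finset.mem_filter, Finset.mem_singleton]
  constructor
  · rintro ⟨hx, h⟩
    exact hi hx ha h
  · rintro rfl
    exact ⟨ha, rfl⟩

/-- Uniform distributions on sets of the same size that mostly overlap. -/
theorem close_uniformOfFinset [DecidableEq α] {S T : Finset α} (hS : S.Nonempty) (hT : T.Nonempty)
    (hc : S.card = T.card) {d : ℕ} (hd : (S \ T).card ≤ d) :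
    Close (d / S.card) (PMF.uniformOfFinset S hS) (PMF.uniformOfFinset T hT) := by
  -- The common part of the two sums cancels; each of the at most `d` remaining points contributes
  -- at most `1`.
  have key : ∀ S T : Finset α, (S \ T).card ≤ d → ∀ f : α → ℝ≥0∞, (∀ a, f a ≤ 1) →
      ∑ a ∈ S, f a ≤ ∑ a ∈ T, f a + d := by
    intro S T h f hf
    rw [← Finset.sum_inter_add_sum_sdiff S T]
    gcongr
    · exact Finset.inter_subset_right
    · calc ∑ a ∈ S \ T, f a ≤ ∑ a ∈ S \ T, 1 := Finset.sum_le_sum fun a _ => hf a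
        _ = (S \ T).card := by simp
        _ ≤ d := by exact_mod_cast h
  have hd' : (T \ S).card ≤ d := by
    rw [← Finset.card_sdiff_comm hc]
    exact hd
  have hS0 : S.card ≠ 0 := hS.card_pos.ne'
  intro f hf
  rw [expect_uniformOfFinset, expect_uniformOfFinset, ← hc, ENNReal.coe_div (by exact_mod_cast hS0)]
  simp only [ENNReal.coe_natCast, ← ENNReal.add_div]
  exact ⟨by gcongr; exact key S T hd f hf, by gcongr; exact key T S hd' f hf⟩

/-- Uniform distributions on a set and on a subset that is not much smaller. -/
theorem close_uniformOfFinset_subset {S T : Finset α} (hS : S.Nonempty) (hT : T.Nonempty)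
    (hST : S ⊆ T) {d : ℕ} (hd : T.card ≤ S.card + d) :
    Close (d / T.card) (PMF.uniformOfFinset S hS) (PMF.uniformOfFinset T hT) := by
  classical
  have hS0 : (S.card : ℝ≥0∞) ≠ 0 := by exact_mod_cast hS.card_pos.ne'
  have hT0 : (T.card : ℝ≥0∞) ≠ 0 := by exact_mod_cast hT.card_pos.ne'
  have hd' : (T.card : ℝ≥0∞) ≤ S.card + d := by exact_mod_cast hd
  intro f hf
  rw [expect_uniformOfFinset, expect_uniformOfFinset,
    ENNReal.coe_div (by exact_mod_cast hT.card_pos.ne')]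
  simp only [ENNReal.coe_natCast, ← ENNReal.add_div]
  have hle : ∑ a ∈ S, f a ≤ S.card := by
    calc ∑ a ∈ S, f a ≤ ∑ a ∈ S, 1 := Finset.sum_le_sum fun a _ => hf a
      _ = S.card := by simp
  have hsub : ∑ a ∈ S, f a ≤ ∑ a ∈ T, f a := Finset.sum_le_sum_of_subset hST
  constructor
  -- The average over `S` is at most `1`, so multiplying it by `|S| + d` instead of `|S|` costs at
  -- most `d`.
  · rw [ENNReal.le_div_iff_mul_le (by simp [hT0]) (by simp)]
    calc (∑ a ∈ S, f a) / S.card * T.card ≤ (∑ a ∈ S, f a) / S.card * (S.card + d) := by gcongr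
      _ = ∑ a ∈ S, f a + (∑ a ∈ S, f a) / S.card * d := by
          rw [mul_add, ENNReal.div_mul_cancel hS0 (by simp)]
      _ ≤ ∑ a ∈ T, f a + 1 * d := by
          gcongr
          exact ENNReal.div_le_of_le_mul (by simpa using hle)
      _ = _ := by rw [one_mul]
  · have hcard : (T \ S).card ≤ d := by
      rw [Finset.card_sdiff_of_subset hST]
      omega
    calc (∑ a ∈ T, f a) / T.card
        ≤ (∑ a ∈ S, f a + d) / T.card := by
          gcongr
          rw [← Finset.sum_sdiff hST, add_comm]
          gcongr
          calc ∑ a ∈ T \ S, f a ≤ ∑ a ∈ T \ S, 1 := Finset.sum_le_sum fun a _ => hf a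
            _ = (T \ S).card := by simp
            _ ≤ d := by exact_mod_cast hcard
      _ = (∑ a ∈ S, f a) / T.card + d / T.card := ENNReal.add_div
      _ ≤ (∑ a ∈ S, f a) / S.card + d / T.card := by
          gcongr
      _ = _ := rfl

end Uniform

/-! ### The Paillier cryptosystem -/

section Paillier

/-- `1 + a N` in the ring of integers modulo `N ^ 2`. -/
def onePlus (N : ℕ) (a : ℤ) : ZMod (N ^ 2) := 1 + (a : ZMod (N ^ 2)) * N

theorem natCast_mul_self (N : ℕ) : (N : ZMod (N ^ 2)) * N = 0 := by
  have := ZMod.natCast_self (N ^ 2)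
  push_cast at this
  rw [← this]
  ring

/-- The cross term `a b N ^ 2` vanishes. This is the source of the additive homomorphism of the
cryptosystem. -/
theorem onePlus_add (N : ℕ) (a b : ℤ) : onePlus N (a + b) = onePlus N a * onePlus N b := by
  unfold onePlus
  push_cast
  linear_combination (-(a : ZMod (N ^ 2)) * b) * natCast_mul_self N

theorem onePlus_zero (N : ℕ) : onePlus N 0 = 1 := by simp [onePlus]

theorem onePlus_natMul (N : ℕ) (k : ℕ) (a : ℤ) : onePlus N (k * a) = onePlus N a ^ k := by
  induction k with
  | zero => simp [onePlus_zero]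
  | succ k ih =>
    have h : ((k + 1 : ℕ) : ℤ) * a = k * a + a := by
      push_cast
      ring
    rw [h, onePlus_add, ih, ← pow_succ]

theorem onePlus_sum {ι : Type*} (N : ℕ) (s : Finset ι) (a : ι → ℤ) :
    onePlus N (∑ i ∈ s, a i) = ∏ i ∈ s, onePlus N (a i) := by
  classical
  induction s using Finset.induction_on with
  | empty => simp [onePlus_zero]
  | insert i s hi ih => rw [Finset.sum_insert hi, Finset.prod_insert hi, onePlus_add, ih]

/-- A multiple of `N` times `N` is zero modulo `N ^ 2`; thus plaintexts and scalar exponents may be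
reduced modulo `N`. -/
theorem onePlus_eq_of_dvd {N : ℕ} {a b : ℤ} (h : (N : ℤ) ∣ a - b) :
    onePlus N a = onePlus N b := by
  obtain ⟨c, hc⟩ := h
  have : a = b + N * c := by linarith
  subst this
  unfold onePlus
  push_cast
  linear_combination (c : ZMod (N ^ 2)) * natCast_mul_self N

theorem onePlus_emod_mul (N : ℕ) (a b : ℤ) : onePlus N (a % N * b) = onePlus N (a * b) := by
  apply onePlus_eq_of_dvd
  rw [← sub_mul]
  exact Dvd.dvd.mul_right (by
    rw [Int.emod_def]
    exact ⟨-(a / N), by ring⟩) _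

theorem toNat_emod {N : ℕ} (hN : 0 < N) (a : ℤ) : (((a % N).toNat : ℕ) : ℤ) = a % N :=
  Int.toNat_of_nonneg (Int.emod_nonneg _ (by exact_mod_cast hN.ne'))

theorem onePlus_pow_emod {N : ℕ} (hN : 0 < N) (a b : ℤ) :
    onePlus N b ^ (a % N).toNat = onePlus N (a * b) := by
  rw [← onePlus_natMul, toNat_emod hN, onePlus_emod_mul]

/-- Normal form of a ciphertext, a plaintext factor times an `N`-th power. Homomorphic identities
are checked on the two factors separately. -/
theorem cast_enc {N : ℕ} (hN : 0 < N) (m : ℤ) (r : ℕ) :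
    ((enc N m r : ℕ) : ZMod (N ^ 2)) = onePlus N m * (r : ZMod (N ^ 2)) ^ N := by
  have h := onePlus_pow_emod hN m 1
  simp only [mul_one] at h
  have h1 : onePlus N 1 = ((1 + N : ℕ) : ZMod (N ^ 2)) := by simp [onePlus]
  rw [enc, ZMod.natCast_mod, ← h, h1]
  push_cast
  rfl

theorem enc_lt {N : ℕ} (hN : 0 < N) (m : ℤ) (r : ℕ) : enc N m r < N ^ 2 :=
  Nat.mod_lt _ (by positivity)

theorem eq_of_cast_eq {n a b : ℕ} (ha : a < n) (hb : b < n) (h : (a : ZMod n) = b) : a = b := by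
  have := (ZMod.natCast_eq_natCast_iff' a b n).1 h
  rwa [Nat.mod_eq_of_lt ha, Nat.mod_eq_of_lt hb] at this

/-- The `N`-th power modulo `N ^ 2` only depends on the residue modulo `N`. -/
theorem cast_mod_pow (N r : ℕ) : (((r % N : ℕ) : ZMod (N ^ 2))) ^ N = (r : ZMod (N ^ 2)) ^ N := by
  have h : (N : ℤ) ∣ ((r % N : ℕ) : ℤ) - r := by
    push_cast
    rw [Int.emod_def]
    exact ⟨-(r / N), by ring⟩
  -- If `x ≡ y` modulo `N`, raising to the `N`-th power gains a further factor `N` in the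
  -- difference.
  have := dvd_sub_pow_of_dvd_sub h 1
  rw [pow_one] at this
  have h2 := (ZMod.intCast_zmod_eq_zero_iff_dvd
    ((((r % N : ℕ) : ℤ)) ^ N - (r : ℤ) ^ N) (N ^ 2)).2 (by push_cast at this ⊢; exact this)
  push_cast at h2
  exact_mod_cast sub_eq_zero.1 h2

/-- An encryption in terms of the `N`-th power of the randomness. -/
theorem enc_eq {N : ℕ} (hN : 0 < N) (m : ℤ) (r : ℕ) :
    ((enc N m r : ℕ) : ℤ) = (1 + m % N * N) * ((r ^ N % N ^ 2 : ℕ) : ℤ) % ((N : ℤ) * N) := by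
  have hm := toNat_emod hN m
  have h : enc N m r = (1 + (m % N).toNat * N) * (r ^ N % N ^ 2) % N ^ 2 := by
    refine eq_of_cast_eq (enc_lt hN m r) (Nat.mod_lt _ (by positivity)) ?_
    rw [cast_enc hN, ZMod.natCast_mod, Nat.cast_mul, ZMod.natCast_mod]
    have : onePlus N m = onePlus N (m % N) := by
      simpa using (onePlus_emod_mul N m 1).symm
    rw [this, ← hm]
    simp [onePlus]
  rw [h, ← sq]
  push_cast
  rw [hm]

/-- The randomness of the product of a plaintext matrix and an encrypted matrix. -/
def prodCoins {m d n : ℕ} (N : ℕ) (X : Matrix (Fin m) (Fin d) ℤ) (ρ : Matrix (Fin d) (Fin n) ℕ) :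
    Matrix (Fin m) (Fin n) ℕ :=
  Matrix.of fun i j => ∏ k, ρ k j ^ (X i k % (N : ℤ)).toNat

theorem prodCoins_coprime {m d n : ℕ} {N : ℕ} (X : Matrix (Fin m) (Fin d) ℤ)
    {ρ : Matrix (Fin d) (Fin n) ℕ} (h : ∀ i j, (ρ i j).Coprime N) (i : Fin m) (j : Fin n) :
    (prodCoins N X ρ i j).Coprime N := by
  rw [prodCoins, Matrix.of_apply]
  exact Nat.Coprime.prod_left fun k _ => (h k j).pow_left _

/-- The conversion message of a homomorphically computed product is a fresh encryption. -/
theorem he2ss_hMatMul {m d n : ℕ} {N : ℕ} (hN : 0 < N) (X : Matrix (Fin m) (Fin d) ℤ)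
    (V : Matrix (Fin d) (Fin n) ℤ) (ρ : Matrix (Fin d) (Fin n) ℕ) (φ : Matrix (Fin m) (Fin n) ℤ)
    (r : Matrix (Fin m) (Fin n) ℕ) :
    he2ss N (hMatMul N X (encMat N V ρ)) φ r =
      encMat N (X * V - φ) (Matrix.of fun i j => prodCoins N X ρ i j * r i j % N) := by
  ext i j
  simp only [he2ss, encMat, Matrix.of_apply]
  refine eq_of_cast_eq (Nat.mod_lt _ (by positivity)) (enc_lt hN _ _) ?_
  rw [hAdd, ZMod.natCast_mod, Nat.cast_mul, cast_enc hN, cast_enc hN, cast_mod_pow, hMatMul,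
    Matrix.of_apply, ZMod.natCast_mod, Nat.cast_prod]
  simp only [Nat.cast_pow, Matrix.of_apply, cast_enc hN, mul_pow, onePlus_pow_emod hN,
    Finset.prod_mul_distrib, ← onePlus_sum]
  rw [Matrix.sub_apply, Matrix.mul_apply, sub_eq_add_neg, onePlus_add, prodCoins, Matrix.of_apply]
  push_cast
  rw [mul_pow, ← Finset.prod_pow]
  simp only [← pow_mul]
  simp only [mul_comm N]
  ring

theorem totient_N (k : PaillierKey) : Nat.totient k.N = (k.p - 1) * (k.q - 1) := by
  rw [PaillierKey.N, Nat.totient_mul ((Nat.coprime_primes k.prime_p k.prime_q).2 k.ne),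
    Nat.totient_prime k.prime_p, Nat.totient_prime k.prime_q]

/-- The product formula for the totient at the pair `(N, N)`, with one factor `φ(N)` cancelled. By
Euler's theorem `r ^ (N φ(N)) = 1` for units modulo `N ^ 2`, which is how decryption removes the
randomness. -/
theorem totient_N_sq (k : PaillierKey) : Nat.totient (k.N ^ 2) = k.N * Nat.totient k.N := by
  have h := Nat.totient_gcd_mul_totient_mul k.N k.N
  have h0 : 0 < Nat.totient k.N := Nat.totient_pos.2 (Nat.zero_lt_of_lt k.one_lt_N)
  rw [Nat.gcd_self, ← sq] at h
  refine Nat.eq_of_mul_eq_mul_left h0 ?_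
  rw [h]
  ring

/-- Raising a ciphertext to `λ = φ(N)` kills `r ^ N` and leaves `1 + λ m N`, from which `L` extracts
`λ m` modulo `N`. The key condition makes `λ` invertible modulo `N`, and `2 |m| < N` singles out `m`
as the residue of least absolute value. -/
theorem dec_enc (k : PaillierKey) (m : ℤ) {r : ℕ} (hr : r.Coprime k.N)
    (hm : 2 * |m| < k.N) : dec k (enc k.N m r) = m := by
  have hN : 0 < k.N := Nat.zero_lt_of_lt k.one_lt_N
  have : NeZero k.N := ⟨hN.ne'⟩
  set l := (k.p - 1) * (k.q - 1) with hl
  set a := (((l : ℤ) * m) % k.N).toNat with ha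
  have haN : (a : ℤ) = (l : ℤ) * m % k.N := toNat_emod hN _
  have halt : a < k.N := by
    have := Int.emod_lt_of_pos ((l : ℤ) * m) (show (0 : ℤ) < k.N by exact_mod_cast hN)
    omega
  have hpow : enc k.N m r ^ l % k.N ^ 2 = 1 + a * k.N := by
    refine eq_of_cast_eq (Nat.mod_lt _ (by positivity)) ?_ ?_
    · have := k.one_lt_N
      nlinarith
    · rw [ZMod.natCast_mod, Nat.cast_pow, cast_enc hN, mul_pow, ← onePlus_natMul, ← pow_mul]
      have hu : (r : ZMod (k.N ^ 2)) ^ (k.N * l) = 1 := by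
        have hc : r.Coprime (k.N ^ 2) := hr.pow_right 2
        have h := ZMod.pow_totient (ZMod.unitOfCoprime r hc)
        rw [totient_N_sq, totient_N, ← hl] at h
        have h' := congrArg Units.val h
        push_cast at h'
        simpa using h'
      rw [hu, mul_one]
      have h := onePlus_emod_mul k.N ((l : ℤ) * m) 1
      simp only [mul_one] at h
      rw [← h, ← haN]
      simp [onePlus]
  have hdiv : (enc k.N m r ^ l % k.N ^ 2 - 1) / k.N = a := by
    rw [hpow, Nat.add_sub_cancel_left, Nat.mul_div_cancel _ hN]
  have hcop : l.Coprime k.N := k.coprime.symm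
  have hcast : ((a : ℕ) : ZMod k.N) = (l : ZMod k.N) * (m : ZMod k.N) := by
    have h : ((a : ℤ) : ZMod k.N) = (((l : ℤ) * m : ℤ) : ZMod k.N) := by
      rw [haN, ZMod.intCast_mod]
    push_cast at h
    exact h
  rw [dec, ← hl, hdiv, hcast, mul_right_comm, ZMod.coe_mul_inv_eq_one l hcop, one_mul,
    ZMod.val_intCast, Int.emod_bmod]
  have h1 := neg_abs_le m
  have h2 := le_abs_self m
  exact Int.bmod_eq_of_le_mul_two (by linarith) (by linarith)

/-! #### Distributions of encryption randomness -/

theorem mem_unitReps {n r : ℕ} : r ∈ unitReps n ↔ r < n ∧ r.Coprime n := by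
  simp [unitReps]

theorem card_unitReps (n : ℕ) : (unitReps n).card = n.totient := by
  rw [unitReps, Nat.totient_eq_card_coprime]
  simp only [Nat.coprime_comm]

theorem coprime_mod {n a : ℕ} (h : a.Coprime n) : (a % n).Coprime n := by
  unfold Nat.Coprime at *
  rw [← Nat.gcd_rec] at *
  rwa [Nat.gcd_comm]

/-- Multiplication by a unit permutes the units. Modulo `N` this rerandomizes ciphertexts; modulo `N
^ 2` it absorbs the factor `1 + m N`. -/
theorem uniform_unitReps_mul {n a : ℕ} (hn : 1 < n) (ha : a.Coprime n) :
    (PMF.uniformOfFinset (unitReps n) (unitReps_nonempty hn)).map (fun r => a * r % n) =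
      PMF.uniformOfFinset (unitReps n) (unitReps_nonempty hn) := by
  refine uniformOfFinset_map_of_injOn _ _ _ (fun r hr => ?_) (fun r hr r' hr' h => ?_) le_rfl
  · rw [mem_unitReps] at *
    exact ⟨Nat.mod_lt _ (by omega), coprime_mod (Nat.Coprime.mul_left ha hr.2)⟩
  · rw [Finset.mem_coe, mem_unitReps] at hr hr'
    have h' : r ≡ r' [MOD n] := Nat.ModEq.cancel_left_of_coprime ha.symm h
    exact Nat.ModEq.eq_of_lt_of_lt h' hr.1 hr'.1

theorem encCoins_map_mul {m n : ℕ} (k : PaillierKey) {ρ : Matrix (Fin m) (Fin n) ℕ}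
    (hρ : ∀ i j, (ρ i j).Coprime k.N) :
    (encCoins m n k).map (fun r => Matrix.of fun i j => ρ i j * r i j % k.N) =
      encCoins m n k := by
  rw [encCoins, uniformMat_eq_sampleMat,
    sampleMat_map (fun _ _ => _) fun i j r => ρ i j * r % k.N]
  simp only [uniform_unitReps_mul k.one_lt_N (hρ _ _)]

theorem mem_support_encCoins {m n : ℕ} {k : PaillierKey} {r : Matrix (Fin m) (Fin n) ℕ}
    (h : r ∈ (encCoins m n k).support) (i : Fin m) (j : Fin n) : (r i j).Coprime k.N :=
  (mem_unitReps.1 (mem_support_uniformMat h i j)).2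

/-- `N`-th powers of units modulo `N ^ 2` and of units modulo `N` have the same distribution. -/
theorem uniform_unitReps_sq_map_pow (k : PaillierKey) :
    (PMF.uniformOfFinset (unitReps (k.N ^ 2))
      (unitReps_nonempty (Nat.one_lt_pow two_ne_zero k.one_lt_N))).map
        (fun r => r ^ k.N % k.N ^ 2) =
    (PMF.uniformOfFinset (unitReps k.N) (unitReps_nonempty k.one_lt_N)).map
        (fun r => r ^ k.N % k.N ^ 2) := by
  have hN : 0 < k.N := Nat.zero_lt_of_lt k.one_lt_N
  have h : (PMF.uniformOfFinset (unitReps (k.N ^ 2))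
      (unitReps_nonempty (Nat.one_lt_pow two_ne_zero k.one_lt_N))).map (fun r => r % k.N) =
      PMF.uniformOfFinset (unitReps k.N) (unitReps_nonempty k.one_lt_N) := by
    -- The fibre over a unit `a` modulo `N` consists of the `N` numbers `a + N j`, `j < N`, all of
    -- them units modulo `N ^ 2`.
    refine uniformOfFinset_map _ _ _ (fun r hr => ?_) k.N fun a ha => ?_
    · rw [mem_unitReps] at *
      exact ⟨Nat.mod_lt _ hN, coprime_mod (Nat.Coprime.coprime_dvd_right ⟨k.N, sq _⟩ hr.2)⟩
    · rw [mem_unitReps] at ha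
      have : (unitReps (k.N ^ 2)).filter (fun r => r % k.N = a) =
          (Finset.range k.N).image fun j => a + k.N * j := by
        ext r
        simp only [Finset.mem_filter, mem_unitReps, Finset.mem_image, Finset.mem_range]
        constructor
        · rintro ⟨⟨h1, -⟩, rfl⟩
          exact ⟨r / k.N, Nat.div_lt_of_lt_mul (by rwa [← sq]), Nat.mod_add_div r k.N⟩
        · rintro ⟨j, hj, rfl⟩
          refine ⟨⟨by nlinarith, Nat.Coprime.pow_right 2 (by simpa using ha.2)⟩, ?_⟩
          rw [Nat.add_mul_mod_self_left, Nat.mod_eq_of_lt ha.1]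
      rw [this, Finset.card_image_of_injective, Finset.card_range]
      intro i j hij
      exact Nat.eq_of_mul_eq_mul_left hN (Nat.add_left_cancel hij)
  rw [← h, PMF.map_comp]
  congr 1
  funext r
  show r ^ k.N % k.N ^ 2 = (r % k.N) ^ k.N % k.N ^ 2
  refine eq_of_cast_eq (Nat.mod_lt _ (by positivity)) (Nat.mod_lt _ (by positivity)) ?_
  rw [ZMod.natCast_mod, ZMod.natCast_mod, Nat.cast_pow, Nat.cast_pow, cast_mod_pow]

/-- A product of a plaintext and a mask of the randomness term: `(1 + m N) y mod N ^ 2`. -/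
def blind (N : ℕ) (m : ℤ) (y : ℕ) : ℕ := ((1 + (m % N).toNat * N) * y) % N ^ 2

theorem enc_eq_blind {N : ℕ} (hN : 0 < N) (m : ℤ) (r : ℕ) :
    enc N m r = blind N m (r ^ N % N ^ 2) := by
  have h := enc_eq hN m r
  rw [← toNat_emod hN, ← sq] at h
  exact_mod_cast h

/-- `1 + m N` is prime to `N ^ 2`, so blinding permutes the units. This is the perfect hiding at the
centre of the argument for `A`. -/
theorem uniform_unitReps_blind (k : PaillierKey) (m : ℤ) :
    (PMF.uniformOfFinset (unitReps (k.N ^ 2))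
      (unitReps_nonempty (Nat.one_lt_pow two_ne_zero k.one_lt_N))).map (blind k.N m) =
    PMF.uniformOfFinset (unitReps (k.N ^ 2))
      (unitReps_nonempty (Nat.one_lt_pow two_ne_zero k.one_lt_N)) := by
  refine uniform_unitReps_mul (Nat.one_lt_pow two_ne_zero k.one_lt_N) (Nat.Coprime.pow_right 2 ?_)
  simp

/-! #### Approximate sampling of units -/

/-- Residues modulo `n` of uniform bit strings, twice as long as `n`. -/
noncomputable def approxUnit (n : ℕ) : PMF ℕ :=
  (PMF.uniformOfFintype (Fin (2 ^ bits ((n : ℤ) * n)))).map fun r : Fin _ => (r : ℕ) % n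

theorem uniformOfFintype_fin_map_val (n : ℕ) [NeZero n] :
    (PMF.uniformOfFintype (Fin n)).map (fun r : Fin n => (r : ℕ)) =
      PMF.uniformOfFinset (Finset.range n) ⟨0, by simp [Nat.pos_of_neZero n]⟩ := by
  rw [PMF.uniformOfFintype]
  refine uniformOfFinset_map _ _ _ (fun r _ => by simp) 1 fun b hb => ?_
  rw [Finset.card_eq_one]
  refine ⟨⟨b, by simpa using hb⟩, ?_⟩
  ext x
  simp [Fin.ext_iff]

/-- Below `n ⌊t / n⌋` all residues are equally frequent, and fewer than `n` of the `t` numbers lie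
beyond. -/
theorem close_uniform_range_mod {n t : ℕ} (hn : 0 < n) (hnt : n ≤ t) :
    Close (n / t) ((PMF.uniformOfFinset (Finset.range t) ⟨0, by simp; omega⟩).map (· % n))
      (PMF.uniformOfFinset (Finset.range n) ⟨0, by simpa⟩) := by
  have hq : 0 < n * (t / n) := Nat.mul_pos hn (Nat.div_pos hnt hn)
  have h1 : (PMF.uniformOfFinset (Finset.range (n * (t / n))) ⟨0, by simpa using hq⟩).map (· % n) =
      PMF.uniformOfFinset (Finset.range n) ⟨0, by simpa⟩ := by
    refine uniformOfFinset_map _ _ _ (fun r _ => by simpa using Nat.mod_lt r hn) (t / n)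
      fun a ha => ?_
    rw [Finset.mem_range] at ha
    have : (Finset.range (n * (t / n))).filter (fun r => r % n = a) =
        (Finset.range (t / n)).image fun j => a + n * j := by
      ext r
      simp only [Finset.mem_filter, Finset.mem_image, Finset.mem_range]
      constructor
      · rintro ⟨h1, rfl⟩
        exact ⟨r / n, Nat.div_lt_of_lt_mul h1, Nat.mod_add_div r n⟩
      · rintro ⟨j, hj, rfl⟩
        refine ⟨by nlinarith, ?_⟩
        rw [Nat.add_mul_mod_self_left, Nat.mod_eq_of_lt ha]
    rw [this, Finset.card_image_of_injective, Finset.card_range]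
    intro i j hij
    exact Nat.eq_of_mul_eq_mul_left hn (Nat.add_left_cancel hij)
  rw [← h1]
  refine Close.map (Close.symm ?_) _
  have h2 := close_uniformOfFinset_subset (S := Finset.range (n * (t / n))) (T := Finset.range t)
    ⟨0, by simpa using hq⟩ ⟨0, by simp; omega⟩
    (Finset.range_subset_range.2 (Nat.mul_div_le t n)) (d := n) (by
      simp only [Finset.card_range]
      have := Nat.div_add_mod t n
      have := Nat.mod_lt t hn
      omega)
  simpa using h2

/-- A string of length `bits (n * n)` has more than `n ^ 2` possible values, so its residue is
within `1 / n` of uniform; at most `d` residues fail to be units. -/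
theorem close_approxUnit {n d : ℕ} (hn : 1 < n) (hd : n ≤ n.totient + d) :
    Close (1 / n + d / n) (approxUnit n)
      (PMF.uniformOfFinset (unitReps n) (unitReps_nonempty hn)) := by
  have hlt : n * n < 2 ^ bits ((n : ℤ) * n) := by
    have := Nat.lt_size_self (n * n)
    simpa [bits, Int.natAbs_mul] using this
  have hsub := close_uniformOfFinset_subset (S := unitReps n) (T := Finset.range n)
    (unitReps_nonempty hn) ⟨0, by simp; omega⟩ (Finset.filter_subset _ _) (d := d)
    (by rwa [Finset.card_range, card_unitReps])
  rw [Finset.card_range] at hsub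
  refine Close.trans ?_ hsub.symm
  have h := close_uniform_range_mod (n := n) (t := 2 ^ bits ((n : ℤ) * n)) (by omega) (by nlinarith)
  rw [← uniformOfFintype_fin_map_val, PMF.map_comp] at h
  refine Close.mono h ?_
  have hn0 : (0 : ℝ≥0) < n := by exact_mod_cast (by omega : 0 < n)
  rw [div_le_div_iff₀ (by positivity) hn0, one_mul]
  exact_mod_cast hlt.le

/-- Bound for the error of the approximate sampling of units. -/
theorem close_approxUnit_N (k : PaillierKey) {κ : ℕ} (hp : κ ≤ k.p.size) (hq : κ ≤ k.q.size) :
    Close (6 / 2 ^ κ) (approxUnit k.N)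
      (PMF.uniformOfFinset (unitReps k.N) (unitReps_nonempty k.one_lt_N)) ∧
    Close (6 / 2 ^ κ) (approxUnit (k.N ^ 2))
      (PMF.uniformOfFinset (unitReps (k.N ^ 2))
        (unitReps_nonempty (Nat.one_lt_pow two_ne_zero k.one_lt_N))) := by
  -- A number with at least `κ` digits is at least `2 ^ (κ - 1)`; for `κ = 0` positivity is enough.
  have big : ∀ {p : ℕ}, p.Prime → κ ≤ p.size → 2 ^ κ ≤ 2 * p := by
    intro p hpp h
    rcases κ with _ | κ
    · have := hpp.pos
      simp
      omega
    · have := Nat.lt_size.1 (show κ < p.size from h)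
      rw [pow_succ]
      omega
  have hp' := big k.prime_p hp
  have hq' := big k.prime_q hq
  -- Exactly `p + q - 1` residues modulo `N` are not units. Dividing by `N` gives at most `1 / p + 1
  -- / q ≤ 4 / 2 ^ κ`, and the error of reduction adds `2 / 2 ^ κ`.
  have hd : k.N ≤ k.N.totient + (k.p + k.q) := by
    rw [totient_N, PaillierKey.N]
    obtain ⟨a, ha⟩ := Nat.exists_eq_succ_of_ne_zero k.prime_p.ne_zero
    obtain ⟨b, hb⟩ := Nat.exists_eq_succ_of_ne_zero k.prime_q.ne_zero
    simp only [ha, hb, Nat.succ_eq_add_one, Nat.add_sub_cancel]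
    nlinarith
  have hN1 := k.one_lt_N
  have e1 : (2 : ℝ≥0) ^ κ ≤ 2 * k.p := by exact_mod_cast hp'
  have e2 : (2 : ℝ≥0) ^ κ ≤ 2 * k.q := by exact_mod_cast hq'
  have p0 : (0 : ℝ≥0) < k.p := by exact_mod_cast k.prime_p.pos
  have q0 : (0 : ℝ≥0) < k.q := by exact_mod_cast k.prime_q.pos
  have q1 : (1 : ℝ≥0) ≤ k.q := by exact_mod_cast k.prime_q.one_lt.le
  have hNc : (k.N : ℝ≥0) = k.p * k.q := by simp [PaillierKey.N]
  have b1 : (1 : ℝ≥0) / k.N ≤ 2 / 2 ^ κ := by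
    rw [div_le_div_iff₀ (by rw [hNc]; positivity) (by positivity), hNc, one_mul]
    calc (2 : ℝ≥0) ^ κ ≤ 2 * k.p := e1
      _ = 2 * (k.p * 1) := by ring
      _ ≤ _ := by gcongr
  have b2 : ((k.p + k.q : ℕ) : ℝ≥0) / k.N ≤ 4 / 2 ^ κ := by
    rw [div_le_div_iff₀ (by rw [hNc]; positivity) (by positivity), hNc]
    push_cast
    calc ((k.p : ℝ≥0) + k.q) * 2 ^ κ = k.p * 2 ^ κ + k.q * 2 ^ κ := by ring
      _ ≤ k.p * (2 * k.q) + k.q * (2 * k.p) := by gcongr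
      _ = _ := by ring
  have hsum : (2 : ℝ≥0) / 2 ^ κ + 4 / 2 ^ κ = 6 / 2 ^ κ := by
    rw [← add_div]
    norm_num
  constructor
  · refine (close_approxUnit hN1 hd).mono ?_
    rw [← hsum]
    gcongr
  -- Modulo `N ^ 2` both the modulus and the bound for the non-units grow by the factor `N`, so
  -- their ratio is unchanged.
  · refine (close_approxUnit (d := k.N * (k.p + k.q))
      (Nat.one_lt_pow two_ne_zero hN1) (by rw [totient_N_sq, sq]; nlinarith)).mono ?_
    rw [← hsum]
    have hN0 : (0 : ℝ≥0) < k.N := by rw [hNc]; positivity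
    refine add_le_add ?_ ?_
    · refine le_trans ?_ b1
      gcongr
      exact_mod_cast Nat.le_self_pow two_ne_zero _
    · refine le_trans (le_of_eq ?_) b2
      push_cast
      rw [sq, mul_div_mul_left _ _ hN0.ne']

/-! #### Masks -/

/-- A mask hides a value that is small compared to its range. -/
theorem close_mask_shift (s : ℕ) (v : ℤ) {d : ℕ} (hd : |v| ≤ d) :
    Close (d / 2 ^ s)
      ((PMF.uniformOfFinset (Finset.Ico (0 : ℤ) (2 ^ s)) ⟨0, by simp⟩).map fun ε => v - ε)
      ((PMF.uniformOfFinset (Finset.Ico (0 : ℤ) (2 ^ s)) ⟨0, by simp⟩).map fun ε => -ε) := by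
  have hpos : (0 : ℤ) < 2 ^ s := by positivity
  -- Both distributions are uniform on intervals of `2 ^ s` integers, displaced by `v`; at most
  -- `|v|` points of the one lie outside the other.
  have hS : (PMF.uniformOfFinset (Finset.Ico (0 : ℤ) (2 ^ s)) ⟨0, by simp⟩).map (fun ε => v - ε) =
      PMF.uniformOfFinset (Finset.Ioc (v - 2 ^ s) v) ⟨v, by simp⟩ := by
    refine uniformOfFinset_map_of_injOn _ _ _ (fun a ha => ?_) (fun a _ a' _ h => ?_) ?_
    · simp only [Finset.mem_Ico, Finset.mem_Ioc] at *
      constructor <;> linarith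
    · simpa using h
    · simp
  have hT : (PMF.uniformOfFinset (Finset.Ico (0 : ℤ) (2 ^ s)) ⟨0, by simp⟩).map (fun ε => -ε) =
      PMF.uniformOfFinset (Finset.Ioc (-2 ^ s : ℤ) 0) ⟨0, by simp⟩ := by
    refine uniformOfFinset_map_of_injOn _ _ _ (fun a ha => ?_) (fun a _ a' _ h => ?_) ?_
    · simp only [Finset.mem_Ico, Finset.mem_Ioc] at *
      constructor <;> linarith
    · simpa using h
    · simp
  rw [hS, hT]
  have h := close_uniformOfFinset (S := Finset.Ioc (v - 2 ^ s) v) (T := Finset.Ioc (-2 ^ s : ℤ) 0)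
    ⟨v, by simp⟩ ⟨0, by simp⟩ (by simp) (d := d) (by
      have hle : Finset.Ioc (v - 2 ^ s) v \ Finset.Ioc (-2 ^ s : ℤ) 0 ⊆
          if 0 ≤ v then Finset.Ioc 0 v else Finset.Ioc (v - 2 ^ s) (-2 ^ s) := by
        intro x hx
        simp only [Finset.mem_sdiff, Finset.mem_Ioc] at hx
        split_ifs <;> simp only [Finset.mem_Ioc] <;> omega
      refine (Finset.card_le_card hle).trans ?_
      have h1 := abs_le.1 hd
      split_ifs <;> simp only [Int.card_Ioc] <;> omega)
  have hc : (Finset.Ioc (v - 2 ^ s) v).card = 2 ^ s := by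
    have : v - (v - 2 ^ s) = ((2 ^ s : ℕ) : ℤ) := by push_cast; ring
    rw [Int.card_Ioc, this, Int.toNat_natCast]
  rw [hc] at h
  exact_mod_cast h

end Paillier

/-! ### Relocation of programs -/

section Relocation

/-- Unfolding `Prog.run` on `coins` shows the sample coerced to `ℕ` inside the monad; here the two
maps are merged into one. -/
theorem run_coins (d a : ℕ) (s : Store) :
    (Prog.coins d a).run s = (PMF.uniformOfFintype (Fin (2 ^ (s a).toNat))).map
      fun r : Fin _ => (Function.update s d ((r : ℕ) : ℤ), 1 + (s a).toNat) := by
  have h : ∀ (p : PMF (Fin (2 ^ (s a).toNat))) (f : ℕ → Store × ℕ),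
      PMF.map f (do let r ← p; pure (r : ℕ)) = p.map fun r : Fin _ => f r :=
    fun p f => PMF.map_comp (fun r : Fin _ => (r : ℕ)) p f
  exact h _ _

/-- All registers used by a program are smaller than this number. -/
def Prog.regs : Prog → ℕ
  | .skip => 0
  | .const d _ => d + 1
  | .bin _ d a b => max (d + 1) (max (a + 1) (b + 1))
  | .size d a => max (d + 1) (a + 1)
  | .coins d a => max (d + 1) (a + 1)
  | .seq P Q => max P.regs Q.regs
  | .ite a P Q => max (a + 1) (max P.regs Q.regs)
  | .loop a P => max (a + 1) P.regs

/-- The same program on the registers `k, k + 1, …`. -/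
def Prog.shift (k : ℕ) : Prog → Prog
  | .skip => .skip
  | .const d c => .const (k + d) c
  | .bin o d a b => .bin o (k + d) (k + a) (k + b)
  | .size d a => .size (k + d) (k + a)
  | .coins d a => .coins (k + d) (k + a)
  | .seq P Q => .seq (P.shift k) (Q.shift k)
  | .ite a P Q => .ite (k + a) (P.shift k) (Q.shift k)
  | .loop a P => .loop (k + a) (P.shift k)

/-- `s` with the registers `k, …, k + R - 1` replaced by the first `R` registers of `t`. -/
def merge (k R : ℕ) (s t : Store) : Store :=
  fun r => if k ≤ r ∧ r < k + R then t (r - k) else s r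

theorem merge_add {k R i : ℕ} (s t : Store) (h : i < R) : merge k R s t (k + i) = t i := by
  simp [merge, h]

theorem merge_of_lt {k R r : ℕ} (s t : Store) (h : r < k) : merge k R s t r = s r := by
  simp [merge, Nat.not_le.2 h]

theorem merge_merge (k R : ℕ) (s t t' : Store) :
    merge k R (merge k R s t) t' = merge k R s t' := by
  funext r
  by_cases h : k ≤ r ∧ r < k + R <;> simp [merge, h]

theorem merge_eq_self {k R : ℕ} {s t : Store} (h : ∀ i < R, s (k + i) = t i) :
    merge k R s t = s := by
  funext r
  by_cases hr : k ≤ r ∧ r < k + R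
  · have := h (r - k) (by omega)
    rw [show k + (r - k) = r by omega] at this
    simp [merge, hr, this]
  · simp [merge, hr]

theorem merge_update {k R d : ℕ} {s t : Store} (h : ∀ i < R, s (k + i) = t i) (hd : d < R)
    (v : ℤ) : merge k R s (Function.update t d v) = Function.update s (k + d) v := by
  funext r
  by_cases hr : k ≤ r ∧ r < k + R
  · have := h (r - k) (by omega)
    rw [show k + (r - k) = r by omega] at this
    by_cases hrd : r = k + d
    · subst hrd
      simp [merge, hd]
    · have : r - k ≠ d := by omega
      simp_all [merge]
  · have : r ≠ k + d := by omega
    simp [merge, hr, this]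

theorem rounds_shift {k R : ℕ} {step step' : Store → PMF (Store × ℕ)}
    (hstep : ∀ s t : Store, (∀ i < R, s (k + i) = t i) →
      step' s = (step t).map fun x => (merge k R s x.1, x.2)) :
    ∀ (n : ℕ) (s t : Store), (∀ i < R, s (k + i) = t i) →
      rounds step' n s = (rounds step n t).map fun x => (merge k R s x.1, x.2)
  | 0, s, t, h => by simp [rounds, PMF.pure_map, merge_eq_self h]
  | n + 1, s, t, h => by
    rw [rounds, rounds, hstep s t h, PMF.bind_map, PMF.map_bind]
    congr 1
    funext x
    rw [Function.comp_apply,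
      rounds_shift hstep n _ x.1 fun i hi => merge_add s x.1 hi, PMF.map_comp, PMF.map_comp]
    congr 1
    funext y
    simp [merge_merge]

/-- A relocated program acts on its registers like the original one and on no others. -/
theorem run_shift {k R : ℕ} : ∀ (P : Prog), P.regs ≤ R → ∀ {s t : Store},
    (∀ i < R, s (k + i) = t i) →
      (P.shift k).run s = (P.run t).map fun x => (merge k R s x.1, x.2) := by
  intro P
  induction P with
  | skip =>
    intro _ s t h
    simp [Prog.shift, Prog.run, PMF.pure_map, merge_eq_self h]
  | const d c =>
    intro hP s t h
    simp only [Prog.regs] at hP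
    simp [Prog.shift, Prog.run, PMF.pure_map, merge_update h (show d < R by omega)]
  | bin o d a b =>
    intro hP s t h
    simp only [Prog.regs] at hP
    simp [Prog.shift, Prog.run, PMF.pure_map, merge_update h (show d < R by omega),
      h a (by omega), h b (by omega)]
  | size d a =>
    intro hP s t h
    simp only [Prog.regs] at hP
    simp [Prog.shift, Prog.run, PMF.pure_map, merge_update h (show d < R by omega),
      h a (by omega)]
  | coins d a =>
    intro hP s t h
    simp only [Prog.regs] at hP
    rw [Prog.shift, run_coins, run_coins, PMF.map_comp, h a (show a < R by omega)]
    congr 1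
    funext r
    simp [merge_update h (show d < R by omega)]
  | seq P Q ihP ihQ =>
    intro hP s t h
    simp only [Prog.regs] at hP
    simp only [Prog.shift, Prog.run]
    rw [ihP (by omega) h, PMF.bind_map, PMF.map_bind]
    congr 1
    funext x
    rw [Function.comp_apply, ihQ (by omega) fun i hi => merge_add s x.1 hi, PMF.map_comp,
      PMF.map_comp]
    congr 1
    funext y
    simp [merge_merge]
  | ite a P Q ihP ihQ =>
    intro hP s t h
    simp only [Prog.regs] at hP
    simp only [Prog.shift, Prog.run, h a (show a < R by omega)]
    split_ifs
    · rw [ihP (by omega) h, PMF.map_comp, PMF.map_comp]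
      rfl
    · rw [ihQ (by omega) h, PMF.map_comp, PMF.map_comp]
      rfl
  | loop a P ih =>
    intro hP s t h
    simp only [Prog.regs] at hP
    simp only [Prog.shift, Prog.run, h a (show a < R by omega)]
    exact rounds_shift (fun s t h => ih (by omega) h) _ s t h

end Relocation

/-! ### Sizes and costs -/

section Cost

theorem bits_le_iff {x : ℤ} {n : ℕ} : bits x ≤ n ↔ x.natAbs < 2 ^ n := Nat.size_le

theorem natAbs_lt_two_pow_bits (x : ℤ) : x.natAbs < 2 ^ bits x := bits_le_iff.1 le_rfl

theorem bits_mono {x y : ℤ} (h : x.natAbs ≤ y.natAbs) : bits x ≤ bits y := Nat.size_le_size h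

@[simp] theorem bits_zero : bits 0 = 0 := by simp [bits]

@[simp] theorem bits_one : bits 1 = 1 := by simp [bits]

theorem bits_natCast_le (n : ℕ) : bits n ≤ n := by
  rw [bits_le_iff, Int.natAbs_natCast]
  exact Nat.lt_two_pow_self

theorem bits_mul_le (x y : ℤ) : bits (x * y) ≤ bits x + bits y := by
  rw [bits_le_iff, Int.natAbs_mul, pow_add]
  exact Nat.mul_lt_mul'' (natAbs_lt_two_pow_bits x) (natAbs_lt_two_pow_bits y)

theorem bits_add_le (x y : ℤ) : bits (x + y) ≤ max (bits x) (bits y) + 1 := by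
  rw [bits_le_iff, pow_succ]
  have hx : 2 ^ bits x ≤ 2 ^ max (bits x) (bits y) := Nat.pow_le_pow_right (by omega) (by omega)
  have hy : 2 ^ bits y ≤ 2 ^ max (bits x) (bits y) := Nat.pow_le_pow_right (by omega) (by omega)
  have := natAbs_lt_two_pow_bits x
  have := natAbs_lt_two_pow_bits y
  have := Int.natAbs_add_le x y
  omega

theorem bits_neg (x : ℤ) : bits (-x) = bits x := by simp [bits]

theorem bits_sub_le (x y : ℤ) : bits (x - y) ≤ max (bits x) (bits y) + 1 := by
  rw [sub_eq_add_neg, ← bits_neg y]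
  exact bits_add_le _ _

theorem bits_ediv_le (x y : ℤ) : bits (x / y) ≤ bits x := by
  apply bits_mono
  have := Int.abs_ediv_le_abs x y
  rw [Int.abs_eq_natAbs, Int.abs_eq_natAbs] at this
  exact_mod_cast this

theorem bits_emod_le (x y : ℤ) : bits (x % y) ≤ max (bits x) (bits y) := by
  by_cases hy : y = 0
  · simp [hy]
  · refine le_trans (bits_mono ?_) (le_max_right _ _)
    have h1 := Int.emod_nonneg x hy
    have h2 := Int.emod_lt_abs x hy
    rw [Int.abs_eq_natAbs] at h2
    omega

/-- The charge for an operation also bounds the length of its result. Hence a register never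
outgrows the total cost, and time bounds yield size bounds. -/
theorem BinOp.bits_eval_le (o : BinOp) (x y : ℤ) :
    bits (o.eval x y) ≤ (1 + bits x) * (1 + bits y) := by
  have h : max (bits x) (bits y) + 1 ≤ (1 + bits x) * (1 + bits y) := by
    rcases le_total (bits x) (bits y) with h | h <;> simp only [h, max_eq_left, max_eq_right] <;>
      nlinarith
  cases o
  · exact (bits_add_le x y).trans h
  · exact (bits_sub_le x y).trans h
  · exact (bits_mul_le x y).trans (by nlinarith)
  · exact (bits_ediv_le x y).trans (by nlinarith)
  · exact (bits_emod_le x y).trans (by omega)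

theorem bits_update_le {s : Store} {d : ℕ} {v : ℤ} {c : ℕ} (h : bits v ≤ c) (i : ℕ) :
    bits (Function.update s d v i) ≤ max (bits (s i)) c := by
  by_cases hi : i = d
  · subst hi
    simp [h]
  · simp [hi]

theorem bits_rounds {step : Store → PMF (Store × ℕ)}
    (hstep : ∀ s, ∀ x ∈ (step s).support, ∀ i, bits (x.1 i) ≤ max (bits (s i)) x.2) :
    ∀ (n : ℕ) (s : Store), ∀ x ∈ (rounds step n s).support, ∀ i,
      bits (x.1 i) ≤ max (bits (s i)) x.2
  | 0, s, x, hx, i => by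
    simp only [rounds, PMF.support_pure, Set.mem_singleton_iff] at hx
    simp [hx]
  | n + 1, s, x, hx, i => by
    simp only [rounds, PMF.mem_support_bind_iff, PMF.mem_support_map_iff] at hx
    obtain ⟨y, hy, w, hw, rfl⟩ := hx
    have h1 := hstep s y hy i
    have h2 := bits_rounds hstep n y.1 w hw i
    simp only
    omega

/-- The contents of a register do not become longer than the cost of the run. -/
theorem bits_run_le (P : Prog) : ∀ s, ∀ x ∈ (P.run s).support, ∀ i,
    bits (x.1 i) ≤ max (bits (s i)) x.2 := by
  induction P with
  | skip =>
    intro s x hx i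
    simp only [Prog.run, PMF.support_pure, Set.mem_singleton_iff] at hx
    simp [hx]
  | const d c =>
    intro s x hx i
    simp only [Prog.run, PMF.support_pure, Set.mem_singleton_iff] at hx
    subst hx
    exact bits_update_le (by omega) i
  | bin o d a b =>
    intro s x hx i
    simp only [Prog.run, PMF.support_pure, Set.mem_singleton_iff] at hx
    subst hx
    exact bits_update_le (o.bits_eval_le _ _) i
  | size d a =>
    intro s x hx i
    simp only [Prog.run, PMF.support_pure, Set.mem_singleton_iff] at hx
    subst hx
    exact bits_update_le ((bits_natCast_le _).trans (by omega)) i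
  | coins d a =>
    intro s x hx i
    rw [run_coins, PMF.mem_support_map_iff] at hx
    obtain ⟨r, -, rfl⟩ := hx
    refine bits_update_le (le_trans (bits_le_iff.2 ?_) (Nat.le_add_left _ 1)) i
    rw [Int.natAbs_natCast]
    exact r.2
  | seq P Q ihP ihQ =>
    intro s x hx i
    simp only [Prog.run, PMF.mem_support_bind_iff, PMF.mem_support_map_iff] at hx
    obtain ⟨y, hy, w, hw, rfl⟩ := hx
    have h1 := ihP s y hy i
    have h2 := ihQ y.1 w hw i
    simp only
    omega
  | ite a P Q ihP ihQ =>
    intro s x hx i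
    simp only [Prog.run] at hx
    split_ifs at hx <;> rw [PMF.mem_support_map_iff] at hx <;> obtain ⟨y, hy, rfl⟩ := hx
    · have := ihP s y hy i
      simp only
      omega
    · have := ihQ s y hy i
      simp only
      omega
  | loop a P ih =>
    intro s x hx i
    exact bits_rounds ih _ s x hx i

theorem eval_mono (p : Polynomial ℕ) {a b : ℕ} (h : a ≤ b) : p.eval a ≤ p.eval b := by
  simp only [Polynomial.eval_eq_sum_range]
  gcongr

/-- On stores with a number `κ ≤ B` in register `0` and at most `B` bits in each register the
cost is bounded by a polynomial in `B`. -/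
def Prog.Poly (P : Prog) : Prop :=
  ∃ p : Polynomial ℕ, ∀ (B κ : ℕ) (s : Store), s 0 = κ → κ ≤ B → (∀ i, bits (s i) ≤ B) →
    ∀ x ∈ (P.run s).support, x.2 ≤ p.eval B

/-- Register `0` is left alone. -/
def Prog.Keeps (P : Prog) : Prop := ∀ s, ∀ x ∈ (P.run s).support, x.1 0 = s 0

/-- After `P` no register has more than `B + p(B)` bits, and this is the size at which the bound for
`Q` is evaluated. That bound needs `κ` to be still in register `0`. -/
theorem Prog.Poly.seq {P Q : Prog} (hP : P.Poly) (hk : P.Keeps) (hQ : Q.Poly) :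
    (Prog.seq P Q).Poly := by
  obtain ⟨p, hp⟩ := hP
  obtain ⟨q, hq⟩ := hQ
  refine ⟨p + q.comp (Polynomial.X + p), fun B κ s h0 hκ hB x hx => ?_⟩
  simp only [Prog.run, PMF.mem_support_bind_iff, PMF.mem_support_map_iff] at hx
  obtain ⟨y, hy, w, hw, rfl⟩ := hx
  have h1 := hp B κ s h0 hκ hB y hy
  have h2 := hq (B + p.eval B) κ y.1 ((hk s y hy).trans h0) (by omega) (fun i => by
    have := bits_run_le P s y hy i
    have := hB i
    omega) w hw
  simp only [Polynomial.eval_add, Polynomial.eval_comp, Polynomial.eval_X]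
  omega

theorem bits_load_le (κ : ℕ) (l : List ℤ) (i : ℕ) :
    bits (load ((κ : ℤ) :: l) i) ≤ κ + (l.map fun v => 1 + bits v).sum := by
  rcases i with _ | i
  · simp only [load, List.getD_cons_zero]
    exact (bits_natCast_le κ).trans (by omega)
  · simp only [load, List.getD_cons_succ]
    by_cases hi : i < l.length
    · rw [List.getD_eq_getElem _ _ hi]
      have : 1 + bits l[i] ≤ (l.map fun v => 1 + bits v).sum :=
        List.single_le_sum (by simp) _ (List.mem_map.2 ⟨l[i], List.getElem_mem hi, rfl⟩)
      omega
    · rw [List.getD_eq_default _ _ (by omega)]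
      simp

theorem Prog.Poly.polyTime {P : Prog} (h : P.Poly) : P.PolyTime := by
  obtain ⟨p, hp⟩ := h
  exact ⟨p, fun κ l x hx => hp _ κ _ rfl (by omega) (bits_load_le κ l) x hx⟩

/-- The input length is at most `n (1 + B)`. As the number of inputs of a subroutine is fixed, `B`
alone measures the cost of a call. -/
theorem Prog.PolyTime.cost_le {P : Prog} (h : P.PolyTime) (n : ℕ) :
    ∃ p : Polynomial ℕ, ∀ (B κ : ℕ) (l : List ℤ), κ ≤ B → l.length = n → (∀ v ∈ l, bits v ≤ B) →
      ∀ x ∈ (P.run (load ((κ : ℤ) :: l))).support, x.2 ≤ p.eval B := by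
  obtain ⟨p, hp⟩ := h
  refine ⟨p.comp (Polynomial.X + Polynomial.C n * (1 + Polynomial.X)), fun B κ l hκ hl hB x hx => ?_⟩
  refine (hp κ l x hx).trans ?_
  simp only [Polynomial.eval_comp, Polynomial.eval_add, Polynomial.eval_X, Polynomial.eval_mul,
    Polynomial.eval_C, Polynomial.eval_one]
  refine eval_mono p (Nat.add_le_add hκ ?_)
  rw [← hl]
  have := List.sum_le_card_nsmul (l.map fun v => 1 + bits v) (1 + B) (by
    intro y hy
    obtain ⟨v, hv, rfl⟩ := List.mem_map.1 hy
    have := hB v hv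
    omega)
  simpa using this

end Cost

/-! ### Calls of subroutines -/

section Call

/-- Fill the registers from `k` on with copies of other registers (`some r`) or zeros (`none`). -/
def fill : ℕ → List (Option ℕ) → Prog
  | _, [] => .skip
  | k, none :: l => .seq (.const k 0) (fill (k + 1) l)
  | k, some r :: l => .seq (.seq (.const k 0) (.bin .add k r k)) (fill (k + 1) l)

/-- The contents of an optional register. -/
def Store.read (s : Store) : Option ℕ → ℤ
  | none => 0
  | some r => s r

/-- The sources lie outside the block that is written, so no copy destroys a value that is still to
be read. -/
theorem run_fill : ∀ (l : List (Option ℕ)) (k : ℕ) (s : Store),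
    (∀ r, some r ∈ l → r < k ∨ k + l.length ≤ r) →
    ∃ c, (fill k l).run s = PMF.pure (merge k l.length s (load (l.map s.read)), c) ∧
      ∀ B, (∀ i, bits (s i) ≤ B) → c ≤ l.length * (2 + B) + 1
  | [], k, s, _ => by
    refine ⟨1, ?_, fun B _ => by simp⟩
    rw [fill, Prog.run, merge_eq_self]
    intro i hi
    simp at hi
  | o :: l, k, s, h => by
    obtain ⟨c₀, h₀, hc₀⟩ : ∃ c₀, (fill k (o :: l)).run s =
        ((fill (k + 1) l).run (Function.update s k (s.read o))).map (fun y => (y.1, c₀ + y.2)) ∧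
        ∀ B, (∀ i, bits (s i) ≤ B) → c₀ ≤ 2 + B := by
      cases o with
      | none =>
        refine ⟨1, ?_, fun B _ => by omega⟩
        simp [fill, Prog.run, Store.read, bits_zero]
      | some r =>
        have hr : r ≠ k := by
          have := h r (by simp)
          simp only [List.length_cons] at this
          omega
        refine ⟨2 + bits (s r), ?_, fun B hB => by have := hB r; omega⟩
        simp only [fill, Prog.run, Store.read, bits_zero, PMF.pure_bind, PMF.pure_map,
          Function.update_self, BinOp.eval, Function.update_of_ne hr, Function.update_idem, add_zero]
        congr 1
        funext y
        simp
        omega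
    obtain ⟨c, hc, hcB⟩ := run_fill l (k + 1) (Function.update s k (s.read o)) (by
      intro r hr
      have := h r (by simp [hr])
      simp only [List.length_cons] at this
      omega)
    refine ⟨c₀ + c, ?_, fun B hB => ?_⟩
    · rw [h₀, hc, PMF.pure_map]
      congr 2
      have hread : ∀ o' ∈ l, Store.read (Function.update s k (s.read o)) o' = s.read o' := by
        intro o' ho'
        cases o' with
        | none => rfl
        | some r =>
          have := h r (by simp [ho'])
          simp only [List.length_cons] at this
          have hr : r ≠ k := by omega
          exact Function.update_of_ne hr _ _
      rw [List.map_congr_left hread]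
      funext r
      simp only [merge, load, List.length_cons, List.map_cons]
      by_cases h1 : k + 1 ≤ r ∧ r < k + 1 + l.length
      · rw [if_pos h1, if_pos (by omega), show r - k = (r - (k + 1)) + 1 by omega,
          List.getD_cons_succ]
      · rw [if_neg h1]
        by_cases h2 : r = k
        · subst h2
          simp
        · rw [if_neg (by omega), Function.update_of_ne h2]
    · have h1 := hc₀ B hB
      have h2 := hcB B fun i => (bits_update_le (c := B) (by
        cases o with
        | none => simp [Store.read]
        | some r => exact hB r) i).trans (by have := hB i; omega)
      simp only [List.length_cons]
      have h3 : (l.length + 1) * (2 + B) = l.length * (2 + B) + (2 + B) := by ring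
      omega

/-- Run a program on copies of the registers in `src`, in the registers from `k` on. -/
def call (k : ℕ) (src : List ℕ) (e : ℕ) (P : Prog) : Prog :=
  .seq (fill k (src.map some ++ List.replicate (P.regs + e) none)) (P.shift k)

/-- The number of registers used by a call. -/
def callLen (src : List ℕ) (e : ℕ) (P : Prog) : ℕ := src.length + (P.regs + e)

/-- Copies followed by zeros reproduce the initial store of `P` on a block containing all its
registers, so the relocated run is a fresh run. The `e` additional zeros allow for returned
registers that `P` never touches. -/
theorem run_call {k : ℕ} {src : List ℕ} (e : ℕ) (P : Prog) (s : Store) (h : ∀ r ∈ src, r < k) :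
    ∃ c, (call k src e P).run s = (P.run (load (src.map s))).map
        (fun x => (merge k (callLen src e P) s x.1, c + x.2)) ∧
      ∀ B, (∀ i, bits (s i) ≤ B) → c ≤ callLen src e P * (2 + B) + 1 := by
  obtain ⟨c, hc, hB⟩ := run_fill (src.map some ++ List.replicate (P.regs + e) none) k s (by
    intro r hr
    left
    refine h r ?_
    simpa using hr)
  have hlen : (src.map some ++ List.replicate (P.regs + e) (none : Option ℕ)).length =
      callLen src e P := by
    simp [callLen]
  have hload : load ((src.map some ++ List.replicate (P.regs + e) none).map s.read) =
      load (src.map s) := by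
    funext i
    simp only [load, List.map_append, List.map_map, List.map_replicate]
    have : s.read ∘ some = s := by
      funext r
      rfl
    rw [this]
    by_cases hi : i < src.length
    · rw [List.getD_append _ _ _ _ (by simpa using hi)]
    · rw [List.getD_append_right _ _ _ _ (by simpa using hi),
        List.getD_eq_default (List.map s src) _ (by simpa using hi)]
      simp [Store.read, List.getD_eq_getElem?_getD, List.getElem?_replicate]
      split_ifs <;> rfl
  rw [hlen] at hc hB
  refine ⟨c, ?_, hB⟩
  simp only [call, Prog.run]
  rw [hc, PMF.pure_bind, hload,
    run_shift P (R := callLen src e P) (by simp only [callLen]; omega) fun i hi => merge_add s _ hi,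
    PMF.map_comp]
  congr 1
  funext x
  simp [merge_merge]

theorem keeps_call {k : ℕ} {src : List ℕ} (e : ℕ) (P : Prog) (hk : 0 < k)
    (h : ∀ r ∈ src, r < k) : (call k src e P).Keeps := by
  intro s x hx
  obtain ⟨c, hc, -⟩ := run_call e P s h
  rw [hc, PMF.mem_support_map_iff] at hx
  obtain ⟨y, -, rfl⟩ := hx
  exact merge_of_lt _ _ hk

theorem poly_call {k : ℕ} {src : List ℕ} (e : ℕ) {P : Prog} (hP : P.PolyTime)
    (h : ∀ r ∈ 0 :: src, r < k) : (call k (0 :: src) e P).Poly := by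
  obtain ⟨p, hp⟩ := hP.cost_le src.length
  refine ⟨Polynomial.C (callLen (0 :: src) e P) * (2 + Polynomial.X) + 1 + p,
    fun B κ s h0 hκ hB x hx => ?_⟩
  obtain ⟨c, hc, hcB⟩ := run_call e P s h
  rw [hc, PMF.mem_support_map_iff] at hx
  obtain ⟨y, hy, rfl⟩ := hx
  rw [List.map_cons, h0] at hy
  have h1 := hp B κ (src.map s) hκ (by simp) (by
    intro v hv
    obtain ⟨r, -, rfl⟩ := List.mem_map.1 hv
    exact hB r) y hy
  have h2 := hcB B hB
  simp only [Polynomial.eval_add, Polynomial.eval_mul, Polynomial.eval_C, Polynomial.eval_X,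
    Polynomial.eval_one, Polynomial.eval_ofNat]
  omega

/-- Move the registers `k, …, k + m - 1` to the front. -/
def moveDown (k m : ℕ) : Prog := fill 0 ((List.range m).map fun i => some (k + i))

theorem run_moveDown {k m : ℕ} (h : m ≤ k) (s : Store) :
    ∃ c, (moveDown k m).run s = PMF.pure (merge 0 m s (fun i => s (k + i)), c) ∧
      ∀ B, (∀ i, bits (s i) ≤ B) → c ≤ m * (2 + B) + 1 := by
  obtain ⟨c, hc, hB⟩ := run_fill ((List.range m).map fun i => some (k + i)) 0 s (by
    intro r hr
    right
    simp only [List.mem_map, Option.some.injEq] at hr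
    obtain ⟨i, -, rfl⟩ := hr
    simp
    omega)
  simp only [List.length_map, List.length_range] at hc hB
  refine ⟨c, ?_, hB⟩
  rw [moveDown, hc]
  congr 2
  funext r
  by_cases hr : r < m
  · simp [merge, load, hr, Store.read]
  · simp [merge, hr]

theorem poly_moveDown {k m : ℕ} (h : m ≤ k) : (moveDown k m).Poly := by
  refine ⟨Polynomial.C m * (2 + Polynomial.X) + 1, fun B κ s _ _ hB x hx => ?_⟩
  obtain ⟨c, hc, hcB⟩ := run_moveDown h s
  rw [hc, PMF.support_pure, Set.mem_singleton_iff] at hx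
  subst hx
  simpa using hcB B hB

/-- Run an algorithm on selected registers. -/
def Alg.select (A : Alg) (idx : List ℕ) : Alg where
  code := .seq (call (idx.sum + 1 + A.outLen) (0 :: idx) A.outLen A.code)
    (moveDown (idx.sum + 1 + A.outLen) A.outLen)
  outLen := A.outLen

/-- The sum of the indices is a crude bound for each of them; the summand `A.outLen` keeps the block
clear of the destination of `moveDown`. -/
theorem lt_select {A : Alg} {idx : List ℕ} : ∀ r ∈ 0 :: idx, r < idx.sum + 1 + A.outLen := by
  intro r hr
  rcases List.mem_cons.1 hr with rfl | hr
  · omega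
  · have := List.single_le_sum (l := idx) (by simp) r hr
    omega

theorem Alg.select_polyTime {A : Alg} (hA : A.code.PolyTime) (idx : List ℕ) :
    (A.select idx).code.PolyTime :=
  ((poly_call _ hA lt_select).seq (keeps_call _ _ (by omega) lt_select)
    (poly_moveDown (by omega))).polyTime

theorem Alg.select_output (A : Alg) (idx : List ℕ) (κ : ℕ) (l : List ℤ) :
    (A.select idx).output κ l = A.output κ (idx.map (load ((κ : ℤ) :: l))) := by
  obtain ⟨c, hc, -⟩ := run_call A.outLen A.code (load ((κ : ℤ) :: l))
    (lt_select (A := A) (idx := idx))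
  simp only [Alg.output, Alg.select, Prog.run, hc, PMF.bind_map, PMF.map_bind]
  rw [List.map_cons, show load ((κ : ℤ) :: l) 0 = κ from rfl, PMF.map]
  congr 1
  funext x
  obtain ⟨c', hc', -⟩ := run_moveDown (k := idx.sum + 1 + A.outLen) (m := A.outLen) (by omega)
    (merge (idx.sum + 1 + A.outLen) (callLen (0 :: idx) A.outLen A.code) (load ((κ : ℤ) :: l)) x.1)
  simp only [Function.comp_apply, hc', PMF.pure_map]
  congr 1
  refine List.map_congr_left fun i hi => ?_
  rw [List.mem_range] at hi
  simp only [merge, callLen]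
  simp [hi]
  omega

/-- Run `A₁` on the first `n` inputs, then `A₂` on these inputs and the output of `A₁`. -/
def Alg.comp (n : ℕ) (A₁ A₂ : Alg) : Alg where
  code :=
    let e := A₁.outLen + A₂.outLen
    let k := n + 1 + callLen (List.range (n + 1)) e A₁.code
    .seq (call (n + 1) (List.range (n + 1)) e A₁.code)
      (.seq (call k (List.range (n + 1) ++ (List.range A₁.outLen).map (n + 1 + ·)) A₂.outLen A₂.code)
        (moveDown k A₂.outLen))
  outLen := A₂.outLen

/-- The first block is padded by both output lengths: by that of `A₁` so that it contains everything
`A₁` returns, by that of `A₂` so that the second block starts beyond the final destination. -/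
theorem lt_comp (n : ℕ) (A₁ A₂ : Alg) :
    ∀ r ∈ List.range (n + 1) ++ (List.range A₁.outLen).map (n + 1 + ·),
      r < n + 1 + callLen (List.range (n + 1)) (A₁.outLen + A₂.outLen) A₁.code := by
  intro r hr
  simp only [List.mem_append, List.mem_range, List.mem_map] at hr
  simp only [callLen]
  rcases hr with hr | ⟨i, hi, rfl⟩ <;> omega

theorem Alg.comp_polyTime (n : ℕ) {A₁ A₂ : Alg} (h₁ : A₁.code.PolyTime) (h₂ : A₂.code.PolyTime) :
    (Alg.comp n A₁ A₂).code.PolyTime := by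
  refine Prog.Poly.polyTime (Prog.Poly.seq ?_ ?_ (Prog.Poly.seq ?_ ?_ ?_))
  · rw [List.range_succ_eq_map]
    exact poly_call _ h₁ (by simp)
  · exact keeps_call _ _ (by omega) (by simp)
  · have h := lt_comp n A₁ A₂
    rw [List.range_succ_eq_map] at h ⊢
    exact poly_call _ h₂ h
  · exact keeps_call _ _ (by omega) (lt_comp n A₁ A₂)
  · exact poly_moveDown (by simp only [callLen]; omega)

theorem range_map_load (κ : ℕ) {l : List ℤ} {n : ℕ} (h : n ≤ l.length) :
    (List.range (n + 1)).map (load ((κ : ℤ) :: l)) = (κ : ℤ) :: l.take n := by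
  apply List.ext_getElem
  · simp [h]
  · intro i h1 h2
    simp only [List.length_map, List.length_range] at h1
    rcases i with _ | i
    · simp [load]
    · simp [load, List.getElem?_eq_getElem (show i < l.length by omega)]

theorem Alg.comp_output (n : ℕ) (A₁ A₂ : Alg) (κ : ℕ) {l : List ℤ} (hl : n ≤ l.length) :
    (Alg.comp n A₁ A₂).output κ l =
      (A₁.output κ (l.take n)).bind fun y => A₂.output κ (l.take n ++ y) := by
  obtain ⟨c, hc, -⟩ := run_call (A₁.outLen + A₂.outLen) A₁.code (load ((κ : ℤ) :: l))
    (k := n + 1) (src := List.range (n + 1)) (by simp)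
  simp only [Alg.output, Alg.comp, Prog.run, hc, PMF.bind_map, PMF.map_bind, PMF.map_comp]
  rw [range_map_load κ hl]
  congr 1
  funext x
  set e := A₁.outLen + A₂.outLen with he
  set k := n + 1 + callLen (List.range (n + 1)) e A₁.code with hk
  set s := merge (n + 1) (callLen (List.range (n + 1)) e A₁.code) (load ((κ : ℤ) :: l)) x.1 with hs
  obtain ⟨c₂, hc₂, -⟩ := run_call A₂.outLen A₂.code s (lt_comp n A₁ A₂)
  rw [← he, ← hk] at hc₂
  simp only [Function.comp_apply]
  rw [← hs, hc₂, PMF.bind_map, PMF.map_bind]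
  have hsrc : (List.range (n + 1) ++ (List.range A₁.outLen).map (n + 1 + ·)).map s =
      (κ : ℤ) :: (l.take n ++ (List.range A₁.outLen).map x.1) := by
    rw [List.map_append, ← List.cons_append, ← range_map_load κ hl, List.map_map]
    congr 1
    · refine List.map_congr_left fun i hi => merge_of_lt _ _ (by simpa using hi)
    · refine List.map_congr_left fun i hi => merge_add _ _ ?_
      rw [List.mem_range] at hi
      simp only [callLen]
      omega
  rw [hsrc, PMF.map]
  congr 1
  funext y
  obtain ⟨c₃, hc₃, -⟩ := run_moveDown (k := k) (m := A₂.outLen) (by simp only [hk, callLen]; omega)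
    (merge k (callLen (List.range (n + 1) ++ (List.range A₁.outLen).map (n + 1 + ·))
      A₂.outLen A₂.code) s y.1)
  simp only [Function.comp_apply, hc₃, PMF.pure_map]
  congr 1
  refine List.map_congr_left fun i hi => ?_
  rw [List.mem_range] at hi
  simp only [merge, callLen]
  simp [hi]
  omega

end Call

/-! ### Polynomial-time sampling relative to a context -/

/-- Known quantities: a security parameter and a list of integers of a fixed length. -/
structure Ctx (Γ : Type) where
  κ : Γ → ℕ
  vars : Γ → List ℤ
  len : ℕ
  length_vars : ∀ γ, (vars γ).length = len

/-- Encodings by lists of integers of a fixed length. -/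
class Enc (Δ : Type) where
  toList : Δ → List ℤ
  len : ℕ
  length_toList : ∀ δ, (toList δ).length = len

open Enc (toList)

instance : Enc ℤ := ⟨fun x => [x], 1, fun _ => rfl⟩

instance : Enc ℕ := ⟨fun x => [(x : ℤ)], 1, fun _ => rfl⟩

instance {Δ Δ' : Type} [Enc Δ] [Enc Δ'] : Enc (Δ × Δ') :=
  ⟨fun x => toList x.1 ++ toList x.2, Enc.len Δ + Enc.len Δ', fun x => by
    simp [Enc.length_toList]⟩

instance {Δ : Type} [Enc Δ] {n : ℕ} : Enc (Fin n → Δ) :=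
  ⟨fun v => (List.finRange n).flatMap fun i => toList (v i), n * Enc.len Δ, fun v => by
    simp [List.length_flatMap, Enc.length_toList]⟩

instance {Δ : Type} [Enc Δ] {m n : ℕ} : Enc (Matrix (Fin m) (Fin n) Δ) :=
  inferInstanceAs (Enc (Fin m → Fin n → Δ))

theorem toList_int (x : ℤ) : toList x = [x] := rfl

theorem toList_fin {Δ : Type} [Enc Δ] {n : ℕ} (v : Fin n → Δ) :
    toList v = (List.finRange n).flatMap fun i => toList (v i) := rfl

theorem toList_mat {m n : ℕ} (M : Matrix (Fin m) (Fin n) ℤ) : toList M = flat M := by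
  show ((List.finRange m).flatMap fun i => (List.finRange n).flatMap fun j => [M i j]) = _
  simp only [flat, List.map_eq_flatMap]

theorem toList_matNat {m n : ℕ} (M : Matrix (Fin m) (Fin n) ℕ) : toList M = flatNat M := by
  show ((List.finRange m).flatMap fun i => (List.finRange n).flatMap fun j => [(M i j : ℤ)]) = _
  simp only [flatNat, flat, List.map_eq_flatMap, Matrix.map_apply]

theorem toList_cons {Δ : Type} [Enc Δ] {n : ℕ} (a : Δ) (v : Fin n → Δ) :
    toList (Fin.cons a v : Fin (n + 1) → Δ) = toList a ++ toList v := by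
  simp [toList_fin, List.finRange_succ, List.flatMap_map]

section PPT

variable {Γ Δ Δ' : Type} [Enc Δ] [Enc Δ']

/-- The context extended by a new quantity. -/
def Ctx.ext (C : Ctx Γ) (Δ : Type) [Enc Δ] : Ctx (Γ × Δ) where
  κ p := C.κ p.1
  vars p := C.vars p.1 ++ toList p.2
  len := C.len + Enc.len Δ
  length_vars p := by simp [C.length_vars, Enc.length_toList]

/-- The distributions can be sampled in polynomial time, given the known quantities. -/
def PPT (C : Ctx Γ) (F : Γ → PMF (List ℤ)) : Prop :=
  ∃ A : Alg, A.code.PolyTime ∧ ∀ γ, A.output (C.κ γ) (C.vars γ) = F γ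

/-- The list can be computed in polynomial time. -/
def DetList (C : Ctx Γ) (L : Γ → List ℤ) : Prop := PPT C fun γ => PMF.pure (L γ)

/-- The integer can be computed in polynomial time. -/
def PolyFun (C : Ctx Γ) (f : Γ → ℤ) : Prop := DetList C fun γ => [f γ]

variable {C : Ctx Γ}

theorem PPT.congr {F G : Γ → PMF (List ℤ)} (h : PPT C F) (hFG : ∀ γ, F γ = G γ) : PPT C G := by
  rwa [← funext hFG]

theorem DetList.congr {L L' : Γ → List ℤ} (h : DetList C L) (hL : ∀ γ, L γ = L' γ) :
    DetList C L' := by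
  rwa [← funext hL]

theorem PolyFun.congr {f g : Γ → ℤ} (h : PolyFun C f) (hf : ∀ γ, f γ = g γ) : PolyFun C g := by
  rwa [← funext hf]

/-- The sample is appended to the variables of the context, where the second program finds it.
Together with `DetList.call` this lets programs be written as monadic expressions. -/
theorem PPT.bind {F : Γ → PMF Δ} {G : Γ → Δ → PMF (List ℤ)}
    (hF : PPT C fun γ => (F γ).map toList) (hG : PPT (C.ext Δ) fun p => G p.1 p.2) :
    PPT C fun γ => (F γ).bind (G γ) := by
  obtain ⟨A, hA, hA'⟩ := hF
  obtain ⟨B, hB, hB'⟩ := hG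
  refine ⟨Alg.comp C.len A B, Alg.comp_polyTime _ hA hB, fun γ => ?_⟩
  rw [Alg.comp_output _ _ _ _ (C.length_vars γ).ge, List.take_of_length_le (C.length_vars γ).le,
    hA', PMF.bind_map]
  congr 1
  funext δ
  exact hB' (γ, δ)

theorem PPT.select {A : Alg} (hA : A.code.PolyTime) (idx : List ℕ) :
    PPT C fun γ => A.output (C.κ γ) (idx.map (load ((C.κ γ : ℤ) :: C.vars γ))) :=
  ⟨A.select idx, Alg.select_polyTime hA idx, fun _ => Alg.select_output _ _ _ _⟩

theorem range'_map_load (κ : ℕ) (l l' : List ℤ) :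
    (List.range' (l.length + 1) l'.length).map (load ((κ : ℤ) :: (l ++ l'))) = l' := by
  apply List.ext_getElem
  · simp
  · intro i h1 h2
    have h3 : i < l'.length := h2
    have h4 : l.length + 1 + i = (l.length + i) + 1 := by omega
    simp [load, h4, h3]

theorem PPT.weaken {F : Γ → PMF (List ℤ)} (h : PPT C F) :
    PPT (C.ext Δ) fun p => F p.1 := by
  obtain ⟨A, hA, hA'⟩ := h
  refine (PPT.select (C := C.ext Δ) hA (List.range' 1 C.len)).congr fun p => ?_
  rw [← hA']
  have h1 := range'_map_load (C.κ p.1) [] (C.vars p.1)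
  have h2 : (List.range' 1 C.len).map (load (((C.ext Δ).κ p : ℤ) :: (C.ext Δ).vars p)) =
      C.vars p.1 := by
    apply List.ext_getElem
    · simp [C.length_vars]
    · intro i h1 h2
      have h4 : 1 + i = i + 1 := by omega
      simp [load, Ctx.ext, h4, List.getElem?_append_left h2, h2]
  rw [h2]
  rfl

theorem DetList.weaken {L : Γ → List ℤ} (h : DetList C L) : DetList (C.ext Δ) fun p => L p.1 :=
  PPT.weaken h

theorem PolyFun.weaken {f : Γ → ℤ} (h : PolyFun C f) : PolyFun (C.ext Δ) fun p => f p.1 :=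
  PPT.weaken h

/-- The algorithm that returns the contents of the given registers. -/
def Alg.proj (idx : List ℕ) : Alg where
  code := .seq (fill (idx.sum + 1 + idx.length) (idx.map some))
    (moveDown (idx.sum + 1 + idx.length) idx.length)
  outLen := idx.length

theorem proj_src (idx : List ℕ) (r : ℕ) (hr : some r ∈ idx.map some) :
    r < idx.sum + 1 + idx.length ∨ idx.sum + 1 + idx.length + (idx.map some).length ≤ r := by
  left
  have := List.single_le_sum (l := idx) (by simp) r (by simpa using hr)
  omega

theorem Alg.proj_polyTime (idx : List ℕ) : (Alg.proj idx).code.PolyTime := by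
  refine Prog.Poly.polyTime (Prog.Poly.seq ?_ ?_ (poly_moveDown (by omega)))
  · refine ⟨Polynomial.C idx.length * (2 + Polynomial.X) + 1, fun B κ s _ _ hB x hx => ?_⟩
    obtain ⟨c, hc, hcB⟩ := run_fill (idx.map some) _ s (proj_src idx)
    rw [hc, PMF.support_pure, Set.mem_singleton_iff] at hx
    subst hx
    simpa using hcB B hB
  · intro s x hx
    obtain ⟨c, hc, hcB⟩ := run_fill (idx.map some) _ s (proj_src idx)
    rw [hc, PMF.support_pure, Set.mem_singleton_iff] at hx
    subst hx
    exact merge_of_lt _ _ (by omega)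

theorem Alg.proj_output (idx : List ℕ) (κ : ℕ) (l : List ℤ) :
    (Alg.proj idx).output κ l = PMF.pure (idx.map (load ((κ : ℤ) :: l))) := by
  obtain ⟨c, hc, -⟩ := run_fill (idx.map some) _ (load ((κ : ℤ) :: l)) (proj_src idx)
  simp only [Alg.output, Alg.proj, Prog.run, hc, PMF.pure_bind]
  obtain ⟨c', hc', -⟩ := run_moveDown (k := idx.sum + 1 + idx.length) (m := idx.length) (by omega)
    (merge (idx.sum + 1 + idx.length) (idx.map some).length (load ((κ : ℤ) :: l))
      (load ((idx.map some).map (Store.read (load ((κ : ℤ) :: l))))))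
  rw [hc', PMF.pure_map, PMF.pure_map]
  congr 1
  apply List.ext_getElem
  · simp
  · intro i h1 h2
    have hi : i < idx.length := by simpa using h2
    simp [merge, hi]
    simp [load, hi, Store.read]

theorem DetList.vars : DetList C C.vars := by
  refine ⟨Alg.proj (List.range' 1 C.len), Alg.proj_polyTime _, fun γ => ?_⟩
  rw [Alg.proj_output]
  have h := range'_map_load (C.κ γ) [] (C.vars γ)
  rw [C.length_vars] at h
  exact congrArg _ h

theorem length_output {A : Alg} {κ : ℕ} {l y : List ℤ} (h : y ∈ (A.output κ l).support) :
    y.length = A.outLen := by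
  rw [Alg.output, PMF.mem_support_map_iff] at h
  obtain ⟨x, -, rfl⟩ := h
  simp

/-- A polynomial-time algorithm may be called on a computed list. -/
theorem DetList.call {L : Γ → List ℤ} (hL : DetList C L) {A : Alg} (hA : A.code.PolyTime) :
    PPT C fun γ => A.output (C.κ γ) (L γ) := by
  obtain ⟨B, hB, hB'⟩ := hL
  refine ⟨Alg.comp C.len B (A.select (List.range' (C.len + 1) B.outLen)),
    Alg.comp_polyTime _ hB (Alg.select_polyTime hA _), fun γ => ?_⟩
  have hlen : (L γ).length = B.outLen := length_output (by rw [hB' γ]; simp)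
  rw [Alg.comp_output _ _ _ _ (C.length_vars γ).ge, List.take_of_length_le (C.length_vars γ).le,
    hB', PMF.pure_bind, Alg.select_output, ← hlen, ← C.length_vars γ, range'_map_load]

theorem DetList.nil : DetList C fun _ => [] :=
  ⟨Alg.proj [], Alg.proj_polyTime _, fun _ => by rw [Alg.proj_output]; rfl⟩

/-- An algorithm returns a fixed number of registers. Therefore every entry of a computed list sits
at a position that is known in advance. -/
theorem DetList.exists_length {L : Γ → List ℤ} (hL : DetList C L) : ∃ m, ∀ γ, (L γ).length = m := by
  obtain ⟨A, -, hA⟩ := hL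
  exact ⟨A.outLen, fun γ => length_output (by rw [hA γ]; simp)⟩

/-- The context extended by a computed list. -/
theorem PPT.letList {L : Γ → List ℤ} (hL : DetList C L) {m : ℕ} (hm : ∀ γ, (L γ).length = m)
    {F : Γ → PMF (List ℤ)}
    (hF : PPT ⟨C.κ, fun γ => C.vars γ ++ L γ, C.len + m,
      fun γ => by simp [C.length_vars, hm]⟩ F) : PPT C F := by
  obtain ⟨A, hA, hA'⟩ := hL
  obtain ⟨B, hB, hB'⟩ := hF
  refine ⟨Alg.comp C.len A B, Alg.comp_polyTime _ hA hB, fun γ => ?_⟩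
  rw [Alg.comp_output _ _ _ _ (C.length_vars γ).ge, List.take_of_length_le (C.length_vars γ).le,
    hA', PMF.pure_bind]
  exact hB' γ

theorem DetList.append {L L' : Γ → List ℤ} (hL : DetList C L) (hL' : DetList C L') :
    DetList C fun γ => L γ ++ L' γ := by
  obtain ⟨m, hm⟩ := hL.exists_length
  obtain ⟨m', hm'⟩ := hL'.exists_length
  refine PPT.letList hL hm (PPT.letList (L := L') (m := m') ?_ hm' ?_)
  · obtain ⟨A, hA, hA'⟩ := hL'
    refine (PPT.select hA (List.range' 1 C.len)).congr fun γ => ?_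
    refine Eq.trans ?_ (hA' γ)
    congr 1
    apply List.ext_getElem
    · simp [C.length_vars]
    · intro i h1 h2
      have h4 : 1 + i = i + 1 := by omega
      simp [load, h4, List.getElem?_append_left h2, h2]
  · refine ⟨Alg.proj (List.range' (C.len + 1) (m + m')), Alg.proj_polyTime _, fun γ => ?_⟩
    rw [Alg.proj_output]
    have h := range'_map_load (C.κ γ) (C.vars γ) (L γ ++ L' γ)
    rw [List.length_append, hm, hm', C.length_vars, ← List.append_assoc] at h
    exact congrArg _ h

theorem DetList.cons {f : Γ → ℤ} {L : Γ → List ℤ} (hf : PolyFun C f) (hL : DetList C L) :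
    DetList C fun γ => f γ :: L γ :=
  DetList.append hf hL

theorem DetList.flatMap {ι : Type} (l : List ι) {L : ι → Γ → List ℤ} (h : ∀ i, DetList C (L i)) :
    DetList C fun γ => l.flatMap fun i => L i γ := by
  induction l with
  | nil => exact DetList.nil
  | cons i l ih => exact (h i).append ih

theorem DetList.map {ι : Type} (l : List ι) {f : ι → Γ → ℤ} (h : ∀ i, PolyFun C (f i)) :
    DetList C fun γ => l.map fun i => f i γ := by
  induction l with
  | nil => exact DetList.nil
  | cons i l ih => exact DetList.cons (h i) ih

theorem DetList.flat {m n : ℕ} {M : Γ → Matrix (Fin m) (Fin n) ℤ}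
    (h : ∀ i j, PolyFun C fun γ => M γ i j) : DetList C fun γ => flat (M γ) :=
  DetList.flatMap _ fun i => DetList.map _ fun j => h i j

theorem DetList.flatNat {m n : ℕ} {M : Γ → Matrix (Fin m) (Fin n) ℕ}
    (h : ∀ i j, PolyFun C fun γ => (M γ i j : ℤ)) : DetList C fun γ => flatNat (M γ) :=
  DetList.flat fun i j => h i j

/-- Parts of a computed list. -/
theorem DetList.proj {L : Γ → List ℤ} (h : DetList C L) (idx : List ℕ) :
    DetList C fun γ => idx.map (load ((C.κ γ : ℤ) :: L γ)) :=
  (h.call (Alg.proj_polyTime idx)).congr fun _ => Alg.proj_output _ _ _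

theorem DetList.getD {L : Γ → List ℤ} (h : DetList C L) (i : ℕ) :
    PolyFun C fun γ => (L γ).getD i 0 :=
  (h.proj [i + 1]).congr fun γ => by simp [load]

/-- With a constant length of the first part the cut is at a fixed register. This is how a simulator
parses its input. -/
theorem DetList.right {L L' : Γ → List ℤ} {m : ℕ} (h : DetList C fun γ => L γ ++ L' γ)
    (hm : ∀ γ, (L γ).length = m) : DetList C L' := by
  obtain ⟨k, hk⟩ := h.exists_length
  refine (h.proj (List.range' (m + 1) (k - m))).congr fun γ => ?_
  have hk' := hk γ
  rw [List.length_append, hm] at hk'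
  have := range'_map_load (C.κ γ) (L γ) (L' γ)
  rwa [hm, show (L' γ).length = k - m by omega] at this

theorem DetList.left {L L' : Γ → List ℤ} {m : ℕ} (h : DetList C fun γ => L γ ++ L' γ)
    (hm : ∀ γ, (L γ).length = m) : DetList C L := by
  refine (h.proj (List.range' 1 m)).congr fun γ => ?_
  apply List.ext_getElem
  · simp [hm]
  · intro i h1 h2
    have h4 : 1 + i = i + 1 := by omega
    simp [load, h4, List.getElem?_append_left h2, h2]

theorem DetList.head {f : Γ → ℤ} {L : Γ → List ℤ} (h : DetList C fun γ => f γ :: L γ) :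
    PolyFun C f :=
  DetList.left (L := fun γ => [f γ]) (m := 1) h fun _ => rfl

theorem DetList.tail {f : Γ → ℤ} {L : Γ → List ℤ} (h : DetList C fun γ => f γ :: L γ) :
    DetList C L :=
  DetList.right (L := fun γ => [f γ]) (m := 1) h fun _ => rfl

theorem DetList.of_flatMap {ι : Type} {l : List ι} {L : ι → Γ → List ℤ} {m : ℕ}
    (hm : ∀ i γ, (L i γ).length = m) (h : DetList C fun γ => l.flatMap fun i => L i γ) {i : ι}
    (hi : i ∈ l) : DetList C (L i) := by
  induction l with
  | nil => simp at hi
  | cons j l ih =>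
    rcases List.mem_cons.1 hi with rfl | hi
    · exact DetList.left (L := L i) h (hm i)
    · exact ih (DetList.right (L := L j) h (hm j)) hi

theorem DetList.apply {n : ℕ} {v : Γ → Fin n → Δ} (h : DetList C fun γ => toList (v γ))
    (i : Fin n) : DetList C fun γ => toList (v γ i) :=
  DetList.of_flatMap (L := fun i γ => toList (v γ i)) (fun _ _ => Enc.length_toList _) h
    (List.mem_finRange i)

theorem DetList.flat_apply {m n : ℕ} {M : Γ → Matrix (Fin m) (Fin n) ℤ}
    (h : DetList C fun γ => MatMulSource.flat (M γ)) (i : Fin m) (j : Fin n) :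
    PolyFun C fun γ => M γ i j := by
  simp only [← toList_mat] at h
  exact DetList.apply (v := fun γ => M γ i) (DetList.apply (Δ := Fin n → ℤ) h i) j

theorem DetList.flatNat_apply {m n : ℕ} {M : Γ → Matrix (Fin m) (Fin n) ℕ}
    (h : DetList C fun γ => MatMulSource.flatNat (M γ)) (i : Fin m) (j : Fin n) :
    PolyFun C fun γ => (M γ i j : ℤ) :=
  DetList.flat_apply (M := fun γ => (M γ).map fun v => (v : ℤ)) h i j

/-- The quantity that was added last is known. -/
theorem DetList.last : DetList (C.ext Δ) fun p => toList p.2 :=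
  DetList.right (C := C.ext Δ) (L := fun p => C.vars p.1) DetList.vars fun p => C.length_vars p.1

theorem PPT.pure {f : Γ → Δ} (h : DetList C fun γ => toList (f γ)) :
    PPT C fun γ => (PMF.pure (f γ)).map toList :=
  PPT.congr h fun γ => by rw [PMF.pure_map]

theorem PPT.mapEnc {F : Γ → PMF Δ} {g : Γ → Δ → Δ'}
    (hF : PPT C fun γ => (F γ).map toList) (hg : DetList (C.ext Δ) fun p => toList (g p.1 p.2)) :
    PPT C fun γ => ((F γ).map (g γ)).map toList := by
  refine (PPT.bind hF (G := fun γ δ => PMF.pure (toList (g γ δ))) hg).congr fun γ => ?_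
  rw [PMF.map_comp]
  rfl

theorem PPT.sampleVec {F : Γ → PMF Δ} (hF : PPT C fun γ => (F γ).map toList) (n : ℕ) :
    PPT C fun γ => (sampleVec n fun _ => F γ).map toList := by
  -- The context grows with each entry already drawn, so it has to vary in the induction. The number
  -- of entries is constant and may enter the program text.
  induction n generalizing Γ with
  | zero => exact PPT.pure (f := fun _ => (Fin.elim0 : Fin 0 → Δ)) DetList.nil
  | succ n ih =>
    have h : PPT C fun γ => (F γ).bind fun a => (MatMulSource.sampleVec n fun _ => F γ).bind
        fun v => PMF.pure (toList (Fin.cons a v : Fin (n + 1) → Δ)) := by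
      refine PPT.bind hF (PPT.bind (ih (F := fun p : Γ × Δ => F p.1) hF.weaken) ?_)
      exact (DetList.append (DetList.weaken DetList.last) DetList.last).congr fun p =>
        (toList_cons _ _).symm
    refine h.congr fun γ => ?_
    rw [MatMulSource.sampleVec, PMF.map_bind]
    congr 1
    funext a
    rw [PMF.map_comp]
    rfl

theorem PPT.sampleMat {F : Γ → PMF Δ} (hF : PPT C fun γ => (F γ).map toList) (m n : ℕ) :
    PPT C fun γ => (sampleMat m n fun _ _ => F γ).map toList := by
  refine (PPT.sampleVec (PPT.sampleVec hF n) m).congr fun γ => ?_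
  rw [MatMulSource.sampleMat, PMF.map_comp]
  rfl

end PPT

/-! ### Deterministic programs with one loop -/

section LoopPrograms

/-- Programs without coins and loops. -/
def Prog.Basic : Prog → Prop
  | .skip | .const _ _ | .bin _ _ _ _ | .size _ _ => True
  | .coins _ _ | .loop _ _ => False
  | .seq P Q | .ite _ P Q => P.Basic ∧ Q.Basic

/-- The effect of a basic program. -/
def Prog.exec : Prog → Store → Store
  | .const d c, s => Function.update s d c
  | .bin o d a b, s => Function.update s d (o.eval (s a) (s b))
  | .size d a, s => Function.update s d (bits (s a) : ℤ)
  | .seq P Q, s => Q.exec (P.exec s)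
  | .ite a P Q, s => if 0 < s a then P.exec s else Q.exec s
  | _, s => s

theorem run_basic (P : Prog) : P.Basic → ∃ p : Polynomial ℕ, ∀ s, ∃ c,
    P.run s = PMF.pure (P.exec s, c) ∧ ∀ B, (∀ i, bits (s i) ≤ B) → c ≤ p.eval B := by
  induction P with
  | skip => exact fun _ => ⟨1, fun s => ⟨1, by simp [Prog.run, Prog.exec], by simp⟩⟩
  | const d c =>
    exact fun _ => ⟨Polynomial.C (1 + bits c),
      fun s => ⟨1 + bits c, by simp [Prog.run, Prog.exec], by simp⟩⟩
  | bin o d a b =>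
    refine fun _ => ⟨(1 + Polynomial.X) * (1 + Polynomial.X), fun s => ⟨_, rfl, fun B hB => ?_⟩⟩
    simp only [Polynomial.eval_mul, Polynomial.eval_add, Polynomial.eval_one, Polynomial.eval_X]
    exact Nat.mul_le_mul (by have := hB a; omega) (by have := hB b; omega)
  | size d a =>
    refine fun _ => ⟨1 + Polynomial.X, fun s => ⟨_, rfl, fun B hB => ?_⟩⟩
    simpa using hB a
  | coins d a => exact fun h => h.elim
  | loop a P _ => exact fun h => h.elim
  | seq P Q ihP ihQ =>
    rintro ⟨hP, hQ⟩
    obtain ⟨p, hp⟩ := ihP hP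
    obtain ⟨q, hq⟩ := ihQ hQ
    refine ⟨p + q.comp (Polynomial.X + p), fun s => ?_⟩
    obtain ⟨c, hc, hcB⟩ := hp s
    obtain ⟨c', hc', hcB'⟩ := hq (P.exec s)
    refine ⟨c + c', by simp [Prog.run, Prog.exec, hc, hc', PMF.pure_map], fun B hB => ?_⟩
    simp only [Polynomial.eval_add, Polynomial.eval_comp, Polynomial.eval_X]
    refine Nat.add_le_add (hcB B hB) (hcB' _ fun i => ?_)
    have h1 := bits_run_le P s (P.exec s, c) (by simp [hc]) i
    have h2 := hcB B hB
    have h3 := hB i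
    simp only at h1
    omega
  | ite a P Q ihP ihQ =>
    rintro ⟨hP, hQ⟩
    obtain ⟨p, hp⟩ := ihP hP
    obtain ⟨q, hq⟩ := ihQ hQ
    refine ⟨p + q + (1 + Polynomial.X), fun s => ?_⟩
    obtain ⟨c, hc, hcB⟩ := hp s
    obtain ⟨c', hc', hcB'⟩ := hq s
    simp only [Polynomial.eval_add, Polynomial.eval_one, Polynomial.eval_X]
    by_cases h : 0 < s a
    · refine ⟨c + (1 + bits (s a)), by simp [Prog.run, Prog.exec, hc, h, PMF.pure_map],
        fun B hB => ?_⟩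
      have h1 := hcB B hB
      have h2 := hB a
      omega
    · refine ⟨c' + (1 + bits (s a)), by simp [Prog.run, Prog.exec, hc', h, PMF.pure_map],
        fun B hB => ?_⟩
      have h1 := hcB' B hB
      have h2 := hB a
      omega

theorem Prog.Basic.poly {P : Prog} (h : P.Basic) : P.Poly := by
  obtain ⟨p, hp⟩ := run_basic P h
  refine ⟨p, fun B κ s _ _ hB x hx => ?_⟩
  obtain ⟨c, hc, hcB⟩ := hp s
  rw [hc, PMF.support_pure, Set.mem_singleton_iff] at hx
  subst hx
  exact hcB B hB

/-- The invariant is indexed by the rounds still to come and must bound all registers uniformly: a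
size estimate per round alone would allow exponential growth, for instance by repeated squaring. -/
theorem rounds_basic {P : Prog} (h : P.Basic) : ∃ p : Polynomial ℕ,
    ∀ (Inv : ℕ → Store → Prop) (B : ℕ), (∀ j s, Inv j s → ∀ i, bits (s i) ≤ B) →
      (∀ j s, Inv (j + 1) s → Inv j (P.exec s)) → ∀ n s, Inv n s →
        ∃ t c, rounds P.run n s = PMF.pure (t, c) ∧ Inv 0 t ∧ c ≤ n * (p.eval B + 1) + 1 := by
  obtain ⟨p, hp⟩ := run_basic P h
  refine ⟨p, fun Inv B hB hstep n => ?_⟩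
  induction n with
  | zero => exact fun s hs => ⟨s, 1, by simp [rounds], hs, by simp⟩
  | succ n ih =>
    intro s hs
    obtain ⟨c, hc, hcB⟩ := hp s
    obtain ⟨t, c', ht, hI, hc'⟩ := ih (P.exec s) (hstep n s hs)
    refine ⟨t, c + c' + 1, by simp [rounds, hc, ht, PMF.pure_map], hI, ?_⟩
    have := hcB B (hB _ s hs)
    have e : (n + 1) * (p.eval B + 1) = n * (p.eval B + 1) + (p.eval B + 1) := by ring
    omega

/-- A loop with an initialization and a conclusion. -/
def loopProg (init : Prog) (a : ℕ) (body fin : Prog) : Prog :=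
  .seq init (.seq (.loop a body) fin)

theorem run_loopProg {init body fin : Prog} (a : ℕ) (hi : init.Basic) (hb : body.Basic)
    (hf : fin.Basic) (q : Polynomial ℕ) : ∃ p : Polynomial ℕ,
    ∀ (B : ℕ) (s : Store) (Inv : ℕ → Store → Prop), (∀ i, bits (s i) ≤ B) →
      (init.exec s a).toNat ≤ q.eval B → (∀ j s, Inv j s → ∀ i, bits (s i) ≤ q.eval B) →
      (∀ j s, Inv (j + 1) s → Inv j (body.exec s)) → Inv (init.exec s a).toNat (init.exec s) →
        ∃ t c, (loopProg init a body fin).run s = PMF.pure (fin.exec t, c) ∧ Inv 0 t ∧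
          c ≤ p.eval B := by
  obtain ⟨p₁, h₁⟩ := run_basic init hi
  obtain ⟨p₂, h₂⟩ := rounds_basic hb
  obtain ⟨p₃, h₃⟩ := run_basic fin hf
  refine ⟨p₁ + (q * (p₂.comp q + 1) + 1 + p₃.comp q), fun B s Inv hB hn hIB hstep hI => ?_⟩
  obtain ⟨c₁, hc₁, hB₁⟩ := h₁ s
  obtain ⟨t, c₂, hc₂, hI₂, hB₂⟩ := h₂ Inv (q.eval B) hIB hstep _ _ hI
  obtain ⟨c₃, hc₃, hB₃⟩ := h₃ t
  refine ⟨t, c₁ + (c₂ + c₃), by simp [loopProg, Prog.run, hc₁, hc₂, hc₃, PMF.pure_map], hI₂, ?_⟩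
  simp only [Polynomial.eval_add, Polynomial.eval_mul, Polynomial.eval_comp, Polynomial.eval_one]
  refine Nat.add_le_add (hB₁ B hB) (Nat.add_le_add (hB₂.trans ?_) (hB₃ _ (hIB 0 t hI₂)))
  gcongr

/-- If every store admits an invariant for the loop, the program is polynomial, and its result
satisfies the invariant. -/
theorem loopProg_spec {init body fin : Prog} {a : ℕ} (hi : init.Basic) (hb : body.Basic)
    (hf : fin.Basic) (q : Polynomial ℕ) (R : Store → Store → Prop)
    (h : ∀ (B κ : ℕ) (s : Store), s 0 = κ → κ ≤ B → (∀ i, bits (s i) ≤ B) →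
      ∃ Inv : ℕ → Store → Prop, (init.exec s a).toNat ≤ q.eval B ∧
        (∀ j s, Inv j s → ∀ i, bits (s i) ≤ q.eval B) ∧
        (∀ j s, Inv (j + 1) s → Inv j (body.exec s)) ∧ Inv (init.exec s a).toNat (init.exec s) ∧
        ∀ t, Inv 0 t → R s t) :
    (loopProg init a body fin).PolyTime ∧ ∀ (κ : ℕ) (l : List ℤ), ∃ t c,
      (loopProg init a body fin).run (load ((κ : ℤ) :: l)) = PMF.pure (fin.exec t, c) ∧
        R (load ((κ : ℤ) :: l)) t := by
  obtain ⟨p, hp⟩ := run_loopProg a hi hb hf q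
  constructor
  · refine Prog.Poly.polyTime ⟨p, fun B κ s h0 hκ hB x hx => ?_⟩
    obtain ⟨Inv, h1, h2, h3, h4, -⟩ := h B κ s h0 hκ hB
    obtain ⟨t, c, hc, -, hcB⟩ := hp B s Inv hB h1 h2 h3 h4
    rw [hc, PMF.support_pure, Set.mem_singleton_iff] at hx
    subst hx
    exact hcB
  · intro κ l
    obtain ⟨Inv, h1, h2, h3, h4, h5⟩ := h _ κ _ rfl (by omega) (bits_load_le κ l)
    obtain ⟨t, c, hc, hI, -⟩ := hp _ _ Inv (bits_load_le κ l) h1 h2 h3 h4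
    exact ⟨t, c, hc, h5 t hI⟩

theorem bits_update {s : Store} {d : ℕ} {v : ℤ} {K : ℕ} (hs : ∀ i, bits (s i) ≤ K)
    (hv : bits v ≤ K) (i : ℕ) : bits (Function.update s d v i) ≤ K :=
  (bits_update_le hv i).trans (by have := hs i; omega)

theorem bits_le_of_lt {x M : ℤ} (h0 : 0 ≤ x) (h : x < M) : bits x ≤ bits M :=
  bits_mono (by omega)

/-! #### Powers with the security parameter as exponent -/

/-- The `κ`-th power of the input. -/
def powKappa : Alg where
  code := loopProg (.const 2 1) 0 (.bin .mul 2 2 1) (.seq (.const 0 0) (.bin .add 0 2 0))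
  outLen := 1

theorem powKappa_spec : powKappa.code.PolyTime ∧
    ∀ (κ : ℕ) (x : ℤ), powKappa.output κ [x] = PMF.pure [x ^ κ] := by
  have h := loopProg_spec (init := .const 2 1) (a := 0) (body := .bin .mul 2 2 1)
    (fin := .seq (.const 0 0) (.bin .add 0 2 0)) (by trivial) (by trivial) (by constructor <;> trivial)
    (1 + Polynomial.X + Polynomial.X * Polynomial.X) (fun s t => t 2 = s 1 ^ (s 0).toNat) ?_
  · refine ⟨h.1, fun κ x => ?_⟩
    obtain ⟨t, c, hc, hR⟩ := h.2 κ [x]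
    rw [Alg.output, powKappa, hc, PMF.pure_map]
    simp only [load, List.getD_cons_zero, List.getD_cons_succ, Int.toNat_natCast] at hR
    simp [Prog.exec, BinOp.eval, hR]
  · intro B κ s h0 hκ hB
    simp only [Polynomial.eval_add, Polynomial.eval_mul, Polynomial.eval_one, Polynomial.eval_X]
    have hBB : B ≤ B * B := Nat.le_mul_self B
    -- Each of the `κ - j` rounds done so far has lengthened the power by at most `B` bits, and `κ ≤
    -- B`.
    refine ⟨fun j t => j ≤ κ ∧ t 1 = s 1 ∧ t 2 = s 1 ^ (κ - j) ∧ bits (t 2) ≤ 1 + (κ - j) * B ∧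
      ∀ i, bits (t i) ≤ 1 + B + B * B, ?_, fun j t ht => ht.2.2.2.2, ?_, ?_, ?_⟩
    · simp [Prog.exec, h0]
      omega
    · rintro j t ⟨h1, h2, h3, h4, h5⟩
      have e : κ - j = (κ - (j + 1)) + 1 := by omega
      have hb : bits (t 2 * t 1) ≤ 1 + (κ - j) * B := by
        have := bits_mul_le (t 2) (t 1)
        have hB1 := hB 1
        rw [← h2] at hB1
        rw [e, Nat.add_mul]
        omega
      have hle : (κ - j) * B ≤ B * B := Nat.mul_le_mul_right _ (by omega)
      refine ⟨by omega, by simpa [Prog.exec, Function.update_apply] using h2, ?_, ?_, ?_⟩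
      · simp [Prog.exec, BinOp.eval, h2, h3, e, pow_succ]
      · simpa [Prog.exec, BinOp.eval] using hb
      · exact bits_update h5 (hb.trans (by omega))
    · simp only [Prog.exec]
      have e : (Function.update s 2 1 : Store) 0 = κ := by simp [h0]
      rw [e, Int.toNat_natCast]
      refine ⟨le_rfl, by simp, by simp, by simp, bits_update
        (fun i => (hB i).trans (by omega)) (by simp; omega)⟩
    · rintro t ⟨-, -, h3, -⟩
      simp [h3, h0]

/-! #### Modular powers -/

/-- The initialization of the computation of modular powers. -/
def powModInit : Prog :=
  .seq (.const 4 2) (.seq (.const 6 0) (.seq (.const 0 1)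
    (.ite 3 (.seq (.bin .mod 0 0 3) (.seq (.bin .mod 1 1 3) (.ite 2 (.size 6 2) .skip))) .skip)))

/-- A round of the computation of modular powers. -/
def powModBody : Prog :=
  .seq (.bin .mod 5 2 4) (.seq (.ite 5 (.seq (.bin .mul 0 0 1) (.bin .mod 0 0 3)) .skip)
    (.seq (.bin .mul 1 1 1) (.seq (.bin .mod 1 1 3) (.bin .div 2 2 4))))

/-- The power `x ^ e` modulo `M` for inputs `x`, `e`, `M`. -/
def powMod : Alg where
  code := loopProg powModInit 6 powModBody .skip
  outLen := 1

theorem powModInit_exec (s : Store) : powModInit.exec s =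
    if 0 < s 3 then
      let t := Function.update (Function.update (Function.update (Function.update s 4 2) 6 0)
        0 (1 % s 3)) 1 (s 1 % s 3)
      if 0 < s 2 then Function.update t 6 (bits (s 2) : ℤ) else t
    else Function.update (Function.update (Function.update s 4 2) 6 0) 0 1 := by
  by_cases h3 : 0 < s 3 <;> by_cases h2 : 0 < s 2 <;>
    simp [powModInit, Prog.exec, BinOp.eval, Function.update_of_ne, h3, h2]

theorem powModBody_exec (s : Store) : powModBody.exec s =
    let t := Function.update s 5 (s 2 % s 4)
    let t' := if 0 < s 2 % s 4 then Function.update t 0 (s 0 * s 1 % s 3) else t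
    Function.update (Function.update t' 1 (s 1 * s 1 % s 3)) 2 (s 2 / s 4) := by
  by_cases h : 0 < s 2 % s 4 <;>
    simp [powModBody, Prog.exec, BinOp.eval, Function.update_of_ne, h]

/-- Square and multiply: `a x ^ e = (a x ^ (e mod 2)) (x ^ 2) ^ ⌊e / 2⌋`, and the exponent loses a
binary digit. -/
theorem powMod_step {M x a e j : ℕ} (he : e < 2 ^ (j + 1)) (w : ℕ)
    (h : a * x ^ e % M = w) :
    e / 2 < 2 ^ j ∧ (if 0 < e % 2 then a * x % M else a) * (x * x % M) ^ (e / 2) % M = w := by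
  refine ⟨by rw [pow_succ] at he; omega, ?_⟩
  have h2 := Nat.div_add_mod e 2
  have hx : (x * x % M) ^ (e / 2) ≡ (x * x) ^ (e / 2) [MOD M] := (Nat.mod_modEq _ _).pow _
  rw [← h]
  change _ ≡ _ [MOD M]
  split_ifs with h0
  · have e1 : e % 2 = 1 := by omega
    calc a * x % M * (x * x % M) ^ (e / 2) ≡ a * x * (x * x) ^ (e / 2) [MOD M] :=
          (Nat.mod_modEq _ _).mul hx
      _ = a * x ^ e := by
          conv_rhs => rw [← h2, e1]
          rw [← sq, ← pow_mul, pow_succ]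
          ring
  · have e1 : e % 2 = 0 := by omega
    calc a * (x * x % M) ^ (e / 2) ≡ a * (x * x) ^ (e / 2) [MOD M] := hx.mul_left _
      _ = a * x ^ e := by
          conv_rhs => rw [← h2, e1]
          rw [← sq, ← pow_mul, add_zero]

theorem powMod_spec : powMod.code.PolyTime ∧
    ∀ (κ x e M : ℕ), 0 < M → powMod.output κ [(x : ℤ), e, M] = PMF.pure [((x ^ e % M : ℕ) : ℤ)] := by
  have h := loopProg_spec (init := powModInit) (a := 6) (body := powModBody)
    (fin := .skip) (by simp [powModInit, Prog.Basic]) (by simp [powModBody, Prog.Basic])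
    (by simp [Prog.Basic]) (2 + Polynomial.X)
    (fun s t => ∀ x e M : ℕ, 0 < M → s 1 = x → s 2 = e → s 3 = M → t 0 = ((x ^ e % M : ℕ) : ℤ)) ?_
  · refine ⟨h.1, fun κ x e M hM => ?_⟩
    obtain ⟨t, c, hc, hR⟩ := h.2 κ [(x : ℤ), e, M]
    rw [Alg.output, powMod, hc, PMF.pure_map]
    simp [Prog.exec, hR x e M hM rfl rfl rfl]
  · intro B κ s h0 hκ hB
    simp only [Polynomial.eval_add, Polynomial.eval_X, Polynomial.eval_ofNat]
    have hB' : ∀ i, bits (s i) ≤ 2 + B := fun i => (hB i).trans (by omega)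
    have b2 : bits 2 ≤ 2 + B := by
      rw [bits_le_iff]
      calc 2 < 2 ^ 2 := by norm_num
        _ ≤ _ := Nat.pow_le_pow_right (by omega) (by omega)
    have b1 : bits 1 ≤ 2 + B := by rw [bits_one]; omega
    have b0 : bits 0 ≤ 2 + B := by rw [bits_zero]; omega
    -- The cost must be polynomial on every input. For a modulus that is not positive the number of
    -- rounds stays `0`.
    by_cases h3 : 0 < s 3
    swap
    · refine ⟨fun j t => j = 0 ∧ ∀ i, bits (t i) ≤ 2 + B, ?_, fun j t ht => ht.2,
        fun j t ht => by omega, ?_, ?_⟩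
      · simp [powModInit_exec, h3]
      · refine ⟨by simp [powModInit_exec, h3], ?_⟩
        rw [powModInit_exec, if_neg h3]
        exact bits_update (bits_update (bits_update hB' b2) b0) b1
      · intro t _ x e M hM _ _ hs
        omega
    obtain ⟨M, hM⟩ := Int.eq_ofNat_of_zero_le h3.le
    have hMpos : 0 < M := by omega
    have hMne : (M : ℤ) ≠ 0 := by omega
    have bM : ∀ x : ℤ, bits (x % M) ≤ 2 + B := fun x =>
      (bits_le_of_lt (Int.emod_nonneg _ hMne) (Int.emod_lt_of_pos _ (by omega))).trans
        (by rw [← hM]; exact hB' 3)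
    have ht : ∀ i, bits (Function.update (Function.update (Function.update (Function.update s 4 2)
        6 0) 0 (1 % s 3)) 1 (s 1 % s 3) i) ≤ 2 + B := by
      rw [hM]
      exact bits_update (bits_update (bits_update (bits_update hB' b2) b0) (bM _)) (bM _)
    by_cases h2 : 0 < s 2
    swap
    · refine ⟨fun j t => j = 0 ∧ (∀ i, bits (t i) ≤ 2 + B) ∧ t 0 = 1 % M, ?_,
        fun j t ht => ht.2.1, fun j t ht => by omega, ?_, ?_⟩
      · simp [powModInit_exec, h3, h2]
      · refine ⟨by simp [powModInit_exec, h3, h2], ?_, by simp [powModInit_exec, hMpos, h2, hM]⟩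
        simp only [powModInit_exec, h3, h2, if_true, if_false]
        exact ht
      · rintro t ⟨-, -, ht⟩ x e M' hM' _ he hs
        have : e = 0 := by omega
        have hMM : M = M' := by omega
        subst this hMM
        rw [ht]
        simp
    obtain ⟨e, he⟩ := Int.eq_ofNat_of_zero_le h2.le
    have hepos : 0 < e := by omega
    -- The value `a x ^ e'` modulo `M` is preserved, and `j` bounds the number of digits left in the
    -- exponent; after the last round `e' = 0` and the accumulator is the result.
    refine ⟨fun j t => (∀ i, bits (t i) ≤ 2 + B) ∧ t 3 = M ∧ t 4 = 2 ∧
      ∃ a x e' : ℕ, t 0 = a ∧ t 1 = x ∧ t 2 = e' ∧ a < M ∧ e' < 2 ^ j ∧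
        a * x ^ e' % M = (s 1 % M).toNat ^ e % M, ?_, fun j t ht => ht.1, ?_, ?_, ?_⟩
    · have := hB' 2
      simp [powModInit_exec, h3, h2]
      omega
    · rintro j t ⟨hb, t3, t4, a, x, e', t0, t1, t2, ha, he', hinv⟩
      obtain ⟨s1, s2⟩ := powMod_step he' _ hinv
      have be : bits ((e' : ℤ) / 2) ≤ 2 + B :=
        (bits_ediv_le _ _).trans ((congrArg bits t2).symm.le.trans (hb 2))
      have bm : bits ((e' : ℤ) % 2) ≤ 2 + B := by
        refine (bits_mono (y := 1) ?_).trans b1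
        omega
      have hiff : (0 : ℤ) < (e' : ℤ) % 2 ↔ 0 < e' % 2 := by omega
      refine ⟨?_, ?_, ?_, if 0 < e' % 2 then a * x % M else a, x * x % M, e' / 2, ?_, ?_, ?_, ?_,
        s1, s2⟩
      · simp only [powModBody_exec, t0, t1, t2, t3, t4]
        split_ifs
        · exact bits_update (bits_update (bits_update (bits_update hb bm) (bM _)) (bM _)) be
        · exact bits_update (bits_update (bits_update hb bm) (bM _)) be
      · simp only [powModBody_exec]
        split_ifs <;> simp [t3]
      · simp only [powModBody_exec]
        split_ifs <;> simp [t4]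
      · simp only [powModBody_exec, t0, t1, t2, t3, t4, hiff]
        split_ifs <;> simp [t0]
      · simp [powModBody_exec, t1, t3]
      · simp [powModBody_exec, t2, t4]
      · split_ifs
        · exact Nat.mod_lt _ hMpos
        · exact ha
    · refine ⟨?_, by simp [powModInit_exec, hMpos, h2, hM], by simp [powModInit_exec, h3, h2],
        1 % M, (s 1 % M).toNat, e, by simp [powModInit_exec, hMpos, h2, hM], ?_,
        by simp [powModInit_exec, h3, hepos, he], Nat.mod_lt _ hMpos, ?_, by
          rw [Nat.mod_mul_mod, one_mul]⟩
      · simp only [powModInit_exec, h3, h2, if_true]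
        exact bits_update ht ((bits_natCast_le _).trans (hB' 2))
      · rw [toNat_emod hMpos]
        simp [powModInit_exec, hMpos, h2, hM]
      · have := natAbs_lt_two_pow_bits (s 2)
        rw [he] at this
        simpa [powModInit_exec, h3, hepos, he] using this
    · rintro t ⟨-, -, -, a, x, e', t0, -, -, ha, he', hinv⟩ x' e'' M' hM' h1 he'' hs
      have hMM : M = M' := by omega
      have hee : e = e'' := by omega
      subst hMM hee
      have : e' = 0 := by simpa using he'
      subst this
      rw [t0]
      rw [pow_zero, mul_one, Nat.mod_eq_of_lt ha, h1] at hinv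
      have hx : ((x' : ℤ) % M).toNat = x' % M := by omega
      rw [hx] at hinv
      rw [hinv, ← Nat.pow_mod]

/-! #### Greatest common divisors -/

/-- The initialization of the Euclidean algorithm. -/
def gcdInit : Prog :=
  .seq (.const 3 0) (.seq (.const 5 0)
    (.ite 2 (.seq (.bin .mod 1 1 2) (.seq (.size 3 2) (.bin .add 3 3 3))) .skip))

/-- A round of the Euclidean algorithm. -/
def gcdBody : Prog :=
  .ite 1 (.seq (.bin .mod 4 2 1) (.seq (.bin .add 2 1 5) (.bin .add 1 4 5))) .skip

/-- The greatest common divisor of two numbers. -/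
def gcdAlg : Alg where
  code := loopProg gcdInit 3 gcdBody (.seq (.const 0 0) (.bin .add 0 2 0))
  outLen := 1

theorem gcdInit_exec (s : Store) : gcdInit.exec s =
    let t := Function.update (Function.update s 3 0) 5 0
    if 0 < s 2 then Function.update (Function.update t 1 (s 1 % s 2)) 3
      ((bits (s 2) : ℤ) + bits (s 2))
    else t := by
  by_cases h2 : 0 < s 2 <;>
    simp [gcdInit, Prog.exec, BinOp.eval, Function.update_of_ne, h2]

theorem gcdBody_exec (s : Store) : gcdBody.exec s =
    if 0 < s 1 then Function.update (Function.update (Function.update s 4 (s 2 % s 1))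
      2 (s 1 + s 5)) 1 (s 2 % s 1 + s 5) else s := by
  by_cases h1 : 0 < s 1 <;>
    simp [gcdBody, Prog.exec, BinOp.eval, Function.update_of_ne, h1]

/-- For `x ≤ y` the remainder `y mod x` is at most `y / 2`, so a round of the Euclidean algorithm at
least halves the product of the two numbers. -/
theorem euclid_step {x y j : ℕ} (hx : 0 < x) (hxy : x ≤ y) (h : x * y < 2 ^ (j + 1)) :
    y % x * x < 2 ^ j := by
  have h1 : 2 * (y % x) ≤ y := by
    have h2 := Nat.mod_lt y hx
    have h3 := Nat.div_add_mod y x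
    have h4 : 1 ≤ y / x := Nat.div_pos hxy hx
    nlinarith
  rw [pow_succ] at h
  nlinarith

theorem gcdAlg_spec : gcdAlg.code.PolyTime ∧
    ∀ (κ : ℕ) (x : ℤ) (n : ℕ), 0 < n →
      gcdAlg.output κ [x, (n : ℤ)] = PMF.pure [((x.natAbs.gcd n : ℕ) : ℤ)] := by
  have h := loopProg_spec (init := gcdInit) (a := 3) (body := gcdBody)
    (fin := .seq (.const 0 0) (.bin .add 0 2 0)) (by simp [gcdInit, Prog.Basic])
    (by simp [gcdBody, Prog.Basic]) (by simp [Prog.Basic]) (2 + 2 * Polynomial.X)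
    (fun s t => 0 < s 2 → t 2 = ((Int.gcd (s 1) (s 2) : ℕ) : ℤ)) ?_
  · refine ⟨h.1, fun κ x n hn => ?_⟩
    obtain ⟨t, c, hc, hR⟩ := h.2 κ [x, (n : ℤ)]
    rw [Alg.output, gcdAlg, hc, PMF.pure_map]
    have := hR (by simpa [load] using hn)
    simp [Prog.exec, BinOp.eval, this, load, Int.gcd]
  · intro B κ s h0 hκ hB
    simp only [Polynomial.eval_add, Polynomial.eval_mul, Polynomial.eval_X, Polynomial.eval_ofNat]
    have hB' : ∀ i, bits (s i) ≤ 2 + 2 * B := fun i => (hB i).trans (by omega)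
    have b0 : bits 0 ≤ 2 + 2 * B := by rw [bits_zero]; omega
    have ht := bits_update (d := 5) (bits_update (d := 3) hB' b0) b0
    by_cases h2 : 0 < s 2
    swap
    · refine ⟨fun j t => j = 0 ∧ ∀ i, bits (t i) ≤ 2 + 2 * B, ?_, fun j t ht => ht.2,
        fun j t ht => by omega, ?_, fun t _ h => absurd h h2⟩
      · simp [gcdInit_exec, h2]
      · refine ⟨by simp [gcdInit_exec, h2], ?_⟩
        simp only [gcdInit_exec, h2, if_false]
        exact ht
    obtain ⟨n, hn⟩ := Int.eq_ofNat_of_zero_le h2.le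
    have hnpos : 0 < n := by omega
    -- The product starts below `2 ^ (2 * bits n)`, whence `2 * bits n` rounds; at `j = 0` it
    -- vanishes, which forces `x = 0`. Register `5` stays zero so that addition can serve as
    -- copying.
    refine ⟨fun j t => (∀ i, bits (t i) ≤ 2 + 2 * B) ∧ t 5 = 0 ∧ ∃ x y : ℕ, t 1 = x ∧ t 2 = y ∧
      x ≤ y ∧ x * y < 2 ^ j ∧ x.gcd y = Int.gcd (s 1) (s 2), ?_, fun j t ht => ht.1, ?_, ?_, ?_⟩
    · have := hB 2
      simp [gcdInit_exec, h2]
      omega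
    · rintro j t ⟨hb, t5, x, y, t1, t2, hxy, hlt, hg⟩
      by_cases hx : 0 < x
      · have hx' : 0 < t 1 := by omega
        have bm : bits ((y : ℤ) % x) ≤ 2 + 2 * B :=
          (bits_emod_le _ _).trans (by rw [← t1, ← t2]; exact max_le (hb 2) (hb 1))
        have bx : bits (x : ℤ) ≤ 2 + 2 * B := by rw [← t1]; exact hb 1
        refine ⟨?_, by simp [gcdBody_exec, hx', t5], y % x, x, by
          simp [gcdBody_exec, hx, t5, t1, t2], by simp [gcdBody_exec, hx, t5, t1],
          (Nat.mod_lt _ hx).le, euclid_step hx hxy hlt, by rw [← hg, ← Nat.gcd_rec]⟩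
        rw [gcdBody_exec, if_pos hx', t1, t2, t5, add_zero, add_zero]
        exact bits_update (bits_update (bits_update hb bm) bx) bm
      · have hx' : ¬ 0 < t 1 := by omega
        have : x = 0 := by omega
        subst this
        simp only [gcdBody_exec, hx', if_false]
        exact ⟨hb, t5, 0, y, t1, t2, hxy, by simp, hg⟩
    · have hlt : (s 1 % n).toNat < n := by
        have := Int.emod_lt_of_pos (s 1) (show (0 : ℤ) < n by omega)
        omega
      refine ⟨?_, by simp [gcdInit_exec, h2], (s 1 % n).toNat, n, ?_, ?_, hlt.le, ?_, ?_⟩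
      · simp only [gcdInit_exec, h2, if_true]
        refine bits_update (bits_update ht ?_) ?_
        · exact (bits_emod_le _ _).trans (max_le (hB' 1) (hB' 2))
        · have h := bits_natCast_le (bits (s 2) + bits (s 2))
          push_cast at h
          have := hB 2
          omega
      · rw [toNat_emod hnpos]
        simp [gcdInit_exec, hnpos, hn]
      · simp [gcdInit_exec, hnpos, hn]
      · have h := natAbs_lt_two_pow_bits (s 2)
        rw [hn, Int.natAbs_natCast] at h
        have e : (gcdInit.exec s 3).toNat = bits (n : ℤ) + bits (n : ℤ) := by
          simp [gcdInit_exec, hnpos, hn]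
          omega
        rw [e, pow_add]
        exact Nat.mul_lt_mul'' (hlt.trans h) h
      · rw [hn, ← Int.gcd_natCast_natCast, toNat_emod hnpos]
        simp [Int.gcd_emod]
    · rintro t ⟨-, -, x, y, t1, t2, hxy, hlt, hg⟩ -
      have : x = 0 := by
        by_contra hx
        have : 0 < x * y := Nat.mul_pos (by omega) (by omega)
        omega
      subst this
      rw [t2, ← hg]
      simp

end LoopPrograms

/-! ### Polynomial-time arithmetic -/

section Arithmetic

variable {Γ : Type} {C : Ctx Γ} {f g h : Γ → ℤ}

theorem DetList.singleton (hf : PolyFun C f) : DetList C fun γ => [f γ] := hf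

theorem DetList.pair (hf : PolyFun C f) (hg : PolyFun C g) : DetList C fun γ => [f γ, g γ] :=
  DetList.cons hf (DetList.singleton hg)

theorem DetList.triple (hf : PolyFun C f) (hg : PolyFun C g) (hh : PolyFun C h) :
    DetList C fun γ => [f γ, g γ, h γ] :=
  DetList.cons hf (DetList.pair hg hh)

theorem PolyFun.bin (o : BinOp) (hf : PolyFun C f) (hg : PolyFun C g) :
    PolyFun C fun γ => o.eval (f γ) (g γ) := by
  refine ((DetList.pair hf hg).call (A := ⟨.bin o 0 1 2, 1⟩)
    (Prog.Basic.poly (P := .bin o 0 1 2) trivial).polyTime).congr fun γ => ?_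
  simp [Alg.output, Prog.run, PMF.pure_map, load]

theorem PolyFun.add (hf : PolyFun C f) (hg : PolyFun C g) : PolyFun C fun γ => f γ + g γ :=
  hf.bin .add hg

theorem PolyFun.sub (hf : PolyFun C f) (hg : PolyFun C g) : PolyFun C fun γ => f γ - g γ :=
  hf.bin .sub hg

theorem PolyFun.mul (hf : PolyFun C f) (hg : PolyFun C g) : PolyFun C fun γ => f γ * g γ :=
  hf.bin .mul hg

theorem PolyFun.div (hf : PolyFun C f) (hg : PolyFun C g) : PolyFun C fun γ => f γ / g γ :=
  hf.bin .div hg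

theorem PolyFun.mod (hf : PolyFun C f) (hg : PolyFun C g) : PolyFun C fun γ => f γ % g γ :=
  hf.bin .mod hg

theorem PolyFun.const (c : ℤ) : PolyFun C fun _ => c := by
  refine (DetList.nil.call (A := ⟨.const 0 c, 1⟩)
    (Prog.Basic.poly (P := .const 0 c) trivial).polyTime).congr fun γ => ?_
  simp [Alg.output, Prog.run, PMF.pure_map]

theorem PolyFun.neg (hf : PolyFun C f) : PolyFun C fun γ => -f γ :=
  ((PolyFun.const 0).sub hf).congr fun γ => by simp

theorem PolyFun.sum {ι : Type} (s : Finset ι) {f : ι → Γ → ℤ} (hf : ∀ i, PolyFun C (f i)) :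
    PolyFun C fun γ => ∑ i ∈ s, f i γ := by
  classical
  induction s using Finset.induction_on with
  | empty => exact PolyFun.const 0
  | insert i s hi ih =>
    refine ((hf i).add ih).congr fun γ => ?_
    rw [Finset.sum_insert hi]

theorem PolyFun.ite (hf : PolyFun C f) (hg : PolyFun C g) (hh : PolyFun C h) :
    PolyFun C fun γ => if 0 < f γ then g γ else h γ := by
  refine ((DetList.triple hf hg hh).call (A := ⟨.ite 1 (.seq (.const 0 0) (.bin .add 0 2 0))
    (.seq (.const 0 0) (.bin .add 0 3 0)), 1⟩)
    (Prog.Basic.poly (P := .ite 1 (.seq (.const 0 0) (.bin .add 0 2 0))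
      (.seq (.const 0 0) (.bin .add 0 3 0))) (by simp [Prog.Basic])).polyTime).congr fun γ => ?_
  by_cases h0 : 0 < f γ <;> simp [Alg.output, Prog.run, PMF.pure_map, load, BinOp.eval, h0]

theorem PolyFun.powKappa (hf : PolyFun C f) : PolyFun C fun γ => f γ ^ C.κ γ :=
  ((DetList.singleton hf).call powKappa_spec.1).congr fun _ => powKappa_spec.2 _ _

theorem PolyFun.powMod {x e M : Γ → ℕ} (hx : PolyFun C fun γ => (x γ : ℤ))
    (he : PolyFun C fun γ => (e γ : ℤ)) (hM : PolyFun C fun γ => (M γ : ℤ))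
    (h0 : ∀ γ, 0 < M γ) : PolyFun C fun γ => ((x γ ^ e γ % M γ : ℕ) : ℤ) :=
  ((DetList.triple hx he hM).call powMod_spec.1).congr fun γ => powMod_spec.2 _ _ _ _ (h0 γ)

theorem PolyFun.gcd {n : Γ → ℕ} (hf : PolyFun C f) (hn : PolyFun C fun γ => (n γ : ℤ))
    (h0 : ∀ γ, 0 < n γ) : PolyFun C fun γ => (((f γ).natAbs.gcd (n γ) : ℕ) : ℤ) :=
  ((DetList.pair hf hn).call gcdAlg_spec.1).congr fun γ => gcdAlg_spec.2 _ _ _ (h0 γ)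

theorem PolyFun.natAbs (hf : PolyFun C f) : PolyFun C fun γ => ((f γ).natAbs : ℤ) :=
  (hf.ite hf hf.neg).congr fun γ => by split_ifs <;> omega

/-! #### Sampling -/

/-- The algorithm that returns as many random bits as the input has. -/
def coinsAlg : Alg := ⟨.seq (.size 1 1) (.coins 0 1), 1⟩

theorem coinsAlg_polyTime : coinsAlg.code.PolyTime := by
  refine Prog.Poly.polyTime ⟨2 + 2 * Polynomial.X, fun B κ s _ _ hB x hx => ?_⟩
  rw [coinsAlg, Prog.run, PMF.mem_support_bind_iff] at hx
  obtain ⟨y, hy, hx⟩ := hx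
  rw [Prog.run, PMF.support_pure, Set.mem_singleton_iff] at hy
  subst hy
  rw [PMF.mem_support_map_iff] at hx
  obtain ⟨w, hw, rfl⟩ := hx
  rw [run_coins, PMF.mem_support_map_iff] at hw
  obtain ⟨r, -, rfl⟩ := hw
  have := hB 1
  simp
  omega

theorem coinsAlg_output (κ : ℕ) (x : ℤ) : coinsAlg.output κ [x] =
    ((PMF.uniformOfFintype (Fin (2 ^ bits x))).map fun r : Fin _ => (r : ℕ)).map toList := by
  have h : (Prog.seq (.size 1 1) (.coins 0 1)).run (load [(κ : ℤ), x]) =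
      (PMF.pure (Function.update (load [(κ : ℤ), x]) 1 (bits x : ℤ), 1 + bits x)).bind fun y =>
        ((Prog.coins 0 1).run y.1).map fun w => (w.1, y.2 + w.2) := rfl
  rw [Alg.output, coinsAlg, h, PMF.pure_bind, run_coins]
  simp only [PMF.map_comp, Function.update_self, Int.toNat_natCast]
  rfl

theorem PPT.coins (hf : PolyFun C f) : PPT C fun γ =>
    ((PMF.uniformOfFintype (Fin (2 ^ bits (f γ)))).map fun r : Fin _ => (r : ℕ)).map toList :=
  ((DetList.singleton hf).call coinsAlg_polyTime).congr fun _ => coinsAlg_output _ _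

theorem PPT.approxUnit {n : Γ → ℕ} (hn : PolyFun C fun γ => (n γ : ℤ)) :
    PPT C fun γ => (approxUnit (n γ)).map toList := by
  have h := PPT.mapEnc (g := fun γ (r : ℕ) => r % n γ) (PPT.coins (hn.mul hn)) (by
    have hr : PolyFun (C.ext ℕ) fun p => (p.2 : ℤ) := DetList.last
    exact (hr.mod hn.weaken).congr fun p => by push_cast; rfl)
  refine h.congr fun γ => ?_
  rw [PMF.map_comp (fun r : Fin _ => (r : ℕ))]
  rfl

/-- Programs know the range `2 ^ s` rather than `s`, and `coinsAlg` tosses as many coins as its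
argument has digits. With `2 ^ s - 1` as argument, masks are sampled exactly. -/
theorem bits_two_pow_sub_one (s : ℕ) : bits ((2 : ℤ) ^ s - 1) = s := by
  have h : ((2 : ℤ) ^ s - 1).natAbs = 2 ^ s - 1 := by
    have h1 : (1 : ℤ) ≤ 2 ^ s := one_le_pow₀ (by norm_num)
    have h2 : ((2 ^ s : ℕ) : ℤ) = 2 ^ s := by push_cast; rfl
    omega
  apply le_antisymm
  · rw [bits_le_iff, h]
    have : 0 < 2 ^ s := by positivity
    omega
  · by_contra hlt
    have h1 := bits_le_iff.1 (show bits ((2 : ℤ) ^ s - 1) ≤ s - 1 by omega)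
    rw [h] at h1
    obtain ⟨t, rfl⟩ := Nat.exists_eq_add_of_lt (show 0 < s by omega)
    simp only [Nat.zero_add, Nat.add_sub_cancel] at h1
    rw [pow_succ] at h1
    have : 0 < 2 ^ t := by positivity
    omega

/-- A single entry of a mask. -/
noncomputable def maskEntry (s : ℕ) : PMF ℤ :=
  PMF.uniformOfFinset (Finset.Ico (0 : ℤ) (2 ^ s)) ⟨0, by simp⟩

theorem maskEntry_eq (s : ℕ) :
    maskEntry s = (PMF.uniformOfFintype (Fin (2 ^ s))).map fun r : Fin _ => ((r : ℕ) : ℤ) := by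
  rw [maskEntry, PMF.uniformOfFintype]
  symm
  refine uniformOfFinset_map _ _ _ (fun r _ => ?_) 1 fun b hb => ?_
  · rw [Finset.mem_Ico]
    exact ⟨by positivity, by exact_mod_cast r.2⟩
  · rw [Finset.mem_Ico] at hb
    obtain ⟨c, rfl⟩ := Int.eq_ofNat_of_zero_le hb.1
    rw [Finset.card_eq_one]
    refine ⟨⟨c, by exact_mod_cast hb.2⟩, ?_⟩
    ext x
    simp [Fin.ext_iff]

theorem PPT.maskEntry {s : Γ → ℕ} (hs : PolyFun C fun γ => 2 ^ s γ) :
    PPT C fun γ => (maskEntry (s γ)).map toList := by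
  refine (PPT.coins (hs.sub (PolyFun.const 1))).congr fun γ => ?_
  rw [bits_two_pow_sub_one, maskEntry_eq, PMF.map_comp, PMF.map_comp]
  rfl

theorem maskCoins_eq (m n s : ℕ) : maskCoins m n s = sampleMat m n fun _ _ => maskEntry s :=
  uniformMat_eq_sampleMat m n _ _

theorem PPT.maskCoins {s : Γ → ℕ} (hs : PolyFun C fun γ => 2 ^ s γ) (m n : ℕ) :
    PPT C fun γ => (maskCoins m n (s γ)).map toList := by
  simp only [maskCoins_eq]
  exact PPT.sampleMat (PPT.maskEntry hs) m n

/-- Approximate encryption randomness for a matrix. -/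
noncomputable def approxCoins (m n N : ℕ) : PMF (Matrix (Fin m) (Fin n) ℕ) :=
  sampleMat m n fun _ _ => approxUnit N

theorem PPT.approxCoins {N : Γ → ℕ} (hN : PolyFun C fun γ => (N γ : ℤ)) (m n : ℕ) :
    PPT C fun γ => (approxCoins m n (N γ)).map toList :=
  PPT.sampleMat (PPT.approxUnit hN) m n

theorem close_approxCoins (k : PaillierKey) {κ : ℕ} (hp : κ ≤ k.p.size) (hq : κ ≤ k.q.size)
    (m n : ℕ) : Close (m * (n * (6 / 2 ^ κ))) (approxCoins m n k.N) (encCoins m n k) := by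
  rw [encCoins, uniformMat_eq_sampleMat]
  exact Close.sampleMat fun _ _ => (close_approxUnit_N k hp hq).1

/-! #### Encryption and input conversion -/

theorem PolyFun.blind {N y : Γ → ℕ} (hN : PolyFun C fun γ => (N γ : ℤ)) (hf : PolyFun C f)
    (hy : PolyFun C fun γ => (y γ : ℤ)) (h0 : ∀ γ, 0 < N γ) :
    PolyFun C fun γ => (blind (N γ) (f γ) (y γ) : ℤ) :=
  ((((PolyFun.const 1).add ((hf.mod hN).mul hN)).mul hy).mod (hN.mul hN)).congr fun γ => by
    rw [MatMulSource.blind]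
    push_cast
    rw [← sq, toNat_emod (h0 γ)]

theorem PolyFun.powSelf {N r : Γ → ℕ} (hN : PolyFun C fun γ => (N γ : ℤ))
    (hr : PolyFun C fun γ => (r γ : ℤ)) (h0 : ∀ γ, 0 < N γ) :
    PolyFun C fun γ => ((r γ ^ N γ % N γ ^ 2 : ℕ) : ℤ) :=
  PolyFun.powMod (M := fun γ => N γ ^ 2) hr hN ((hN.mul hN).congr fun γ => by push_cast; ring)
    fun γ => by have := h0 γ; positivity

theorem PolyFun.enc {N r : Γ → ℕ} (hN : PolyFun C fun γ => (N γ : ℤ)) (hf : PolyFun C f)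
    (hr : PolyFun C fun γ => (r γ : ℤ)) (h0 : ∀ γ, 0 < N γ) :
    PolyFun C fun γ => (enc (N γ) (f γ) (r γ) : ℤ) :=
  (PolyFun.blind hN hf (PolyFun.powSelf hN hr h0) h0).congr fun γ => by
    rw [enc_eq_blind (h0 γ)]

theorem PolyFun.clamp {b : Γ → ℕ} (hb : PolyFun C fun γ => 2 ^ b γ) (hf : PolyFun C f) :
    PolyFun C fun γ => clamp (b γ) (f γ) :=
  ((hb.sub hf).ite ((hb.add hf).ite hf (PolyFun.const 0)) (PolyFun.const 0)).congr fun γ => by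
    rw [MatMulSource.clamp, ← ite_and]
    congr 1
    rw [abs_lt, eq_iff_iff]
    constructor <;> rintro ⟨h1, h2⟩ <;> constructor <;> linarith

/-- The gcd with `N > 0` is at least `1`, so coprimality is the sign test `0 < 2 - gcd`. -/
theorem PolyFun.toUnit {N : Γ → ℕ} (hN : PolyFun C fun γ => (N γ : ℤ)) (hf : PolyFun C f)
    (h0 : ∀ γ, 0 < N γ) : PolyFun C fun γ => (toUnit (N γ) (f γ) : ℤ) :=
  (((PolyFun.const 2).sub (hf.gcd hN h0)).ite (hf.natAbs.mod hN) (PolyFun.const 1)).congr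
    fun γ => by
      have hpos : 0 < (f γ).natAbs.gcd (N γ) := Nat.gcd_pos_of_pos_right _ (h0 γ)
      have hiff : (0 : ℤ) < 2 - (((f γ).natAbs.gcd (N γ) : ℕ) : ℤ) ↔ (f γ).natAbs.Coprime (N γ) := by
        rw [Nat.Coprime]
        omega
      simp only [hiff, MatMulSource.toUnit]
      split_ifs <;> simp

theorem PolyFun.mulApply {m d n : ℕ} {X : Γ → Matrix (Fin m) (Fin d) ℤ}
    {Y : Γ → Matrix (Fin d) (Fin n) ℤ} (hX : ∀ i j, PolyFun C fun γ => X γ i j)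
    (hY : ∀ i j, PolyFun C fun γ => Y γ i j) (i : Fin m) (j : Fin n) :
    PolyFun C fun γ => (X γ * Y γ) i j :=
  (PolyFun.sum Finset.univ fun k => (hX i k).mul (hY k j)).congr fun γ => by
    rw [Matrix.mul_apply]

theorem DetList.encMat {m n : ℕ} {N : Γ → ℕ} {M : Γ → Matrix (Fin m) (Fin n) ℤ}
    {r : Γ → Matrix (Fin m) (Fin n) ℕ} (hN : PolyFun C fun γ => (N γ : ℤ))
    (hM : ∀ i j, PolyFun C fun γ => M γ i j) (hr : ∀ i j, PolyFun C fun γ => (r γ i j : ℤ))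
    (h0 : ∀ γ, 0 < N γ) : DetList C fun γ => MatMulSource.flatNat (encMat (N γ) (M γ) (r γ)) :=
  DetList.flatNat fun i j => PolyFun.enc hN (hM i j) (hr i j) h0

end Arithmetic

/-! ### Statistical simulation -/

section Negl

theorem negligible_two_pow : Negligible fun κ => 1 / 2 ^ κ := by
  intro n
  have h := tendsto_pow_const_mul_const_pow_of_abs_lt_one n (r := (1 / 2 : ℝ))
    (by rw [abs_of_pos] <;> norm_num)
  refine h.congr fun κ => ?_
  simp

/-- The statistical error of `a` approximate units and masks of values below `d 2 ^ (2 b)`. -/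
noncomputable def statErr (a d b s κ : ℕ) : ℝ≥0 := a * (6 / 2 ^ κ) + d * (2 ^ (2 * b) / 2 ^ s)

theorem negligible_statErr (a d : ℕ) {b s : ℕ → ℕ}
    (h : Negligible fun κ => 2 ^ (2 * b κ) / 2 ^ s κ) :
    Negligible fun κ => (statErr a d (b κ) (s κ) κ : ℝ) := by
  have h1 : Negligible fun κ => (a * 6 : ℝ) * (1 / 2 ^ κ) := negligible_two_pow.const_mul _
  have h2 : Negligible fun κ => (d : ℝ) * (2 ^ (2 * b κ) / 2 ^ s κ) := h.const_mul _
  refine (h1.add h2).congr fun κ => ?_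
  simp only [Pi.add_apply, statErr]
  push_cast
  ring

end Negl

section Glue

variable {K I : Type}

/-- A simulator that produces views from a distribution close to that of the real views. -/
theorem advantage_le_of_close {Θ : Type} {gen : ℕ → PMF K} {known : ℕ → Party → K → List ℤ}
    {parse : ℕ → K → List ℤ → I} {input : ℕ → Party → I → List ℤ}
    {protocol : ℕ → I → PMF Execution} {functionality : ℕ → I → PMF (Party → List ℤ)}
    {c : Party} {adv sim : Alg} {κ : ℕ} {z : ℤ} (Q : PMF Θ) (o : I → Θ → Party → List ℤ)
    (hfun : ∀ x, functionality κ x = Q.map (o x)) (simView : I → Θ → PMF (List ℤ))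
    (hsim : ∀ x θ, sim.output κ (z :: (input κ c x ++ o x θ c)) =
      (simView x θ).bind fun v => adv.output κ (z :: v))
    {ε : ℝ≥0} (hclose : ∀ k ∈ (gen κ).support, ∀ l, Close ε
      ((protocol κ (parse κ k l)).map fun e => (e.view c, e.out .A, e.out .B))
      (Q.bind fun θ => (simView (parse κ k l) θ).map
        fun v => (v, o (parse κ k l) θ .A, o (parse κ k l) θ .B)))
    (choose : Alg) (guess : Prog) :
    advantage (realExperiment gen known parse protocol c adv choose guess κ z)
      (idealExperiment gen known parse input functionality c sim choose guess κ z) ≤ ε := by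
  refine advantage_bind_le _ fun k hk => advantage_bind_le _ fun l _ => Close.advantage_le ?_
  -- Adversary and environment together are one randomized function of the view and the two outputs.
  have h := (hclose k hk l).bind_left fun x : List ℤ × List ℤ × List ℤ =>
    (adv.output κ (z :: x.1)).bind fun a =>
      guess.decision κ (z :: (known κ c k ++ l ++ a ++ x.2.1 ++ x.2.2))
  rw [PMF.bind_map, PMF.bind_bind] at h
  refine cast (congrArg _ ?_) h
  rw [hfun, PMF.bind_map]
  refine bind_congr_support fun θ _ => ?_
  rw [Function.comp_apply, hsim, PMF.bind_map, PMF.bind_bind]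
  rfl

end Glue

/-! ### Statistically close views: the forward propagation, and the backward propagation for `B`. -/

section Layer

variable {bs dA dB out : ℕ}

theorem length_flat {m n : ℕ} (M : Matrix (Fin m) (Fin n) ℤ) : (flat M).length = m * n := by
  rw [← toList_mat, Enc.length_toList]
  exact congrArg _ (Nat.mul_one n)

theorem length_flatNat {m n : ℕ} (M : Matrix (Fin m) (Fin n) ℕ) : (flatNat M).length = m * n :=
  length_flat _

theorem length_partyData {bs d out : ℕ} (x : PartyData bs d out) :
    x.toList.length = bs * d + d * out + d * out := by
  simp [PartyData.toList, length_flat, length_flatNat, add_assoc]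

/-- An encryption of a matrix with small entries. -/
def IsEnc {m n : ℕ} (b : ℕ) (k : PaillierKey) (E : Matrix (Fin m) (Fin n) ℕ)
    (V : Matrix (Fin m) (Fin n) ℤ) (ρ : Matrix (Fin m) (Fin n) ℕ) : Prop :=
  E = encMat k.N V ρ ∧ (∀ i j, |V i j| < 2 ^ b) ∧ ∀ i j, (ρ i j).Coprime k.N

theorem abs_clamp_lt (b : ℕ) (v : ℤ) : |clamp b v| < 2 ^ b := by
  unfold clamp
  split_ifs with h
  · exact h
  · simp

theorem toUnit_coprime (N : ℕ) (v : ℤ) : (toUnit N v).Coprime N := by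
  unfold toUnit
  split_ifs with h
  · exact coprime_mod h
  · simp

theorem abs_mul_apply_le {m d n b : ℕ} {X : Matrix (Fin m) (Fin d) ℤ}
    {V : Matrix (Fin d) (Fin n) ℤ} (hX : ∀ i j, |X i j| < 2 ^ b) (hV : ∀ i j, |V i j| < 2 ^ b)
    (i : Fin m) (j : Fin n) : |(X * V) i j| ≤ ((d * 2 ^ (2 * b) : ℕ) : ℤ) := by
  rw [Matrix.mul_apply]
  refine (Finset.abs_sum_le_sum_abs _ _).trans ?_
  calc ∑ k, |X i k * V k j| ≤ ∑ _k : Fin d, (2 : ℤ) ^ (2 * b) := by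
        refine Finset.sum_le_sum fun k _ => ?_
        rw [abs_mul, two_mul, pow_add]
        exact mul_le_mul (hX i k).le (hV k j).le (abs_nonneg _) (by positivity)
    _ = _ := by simp

theorem decMat_encMat {m n : ℕ} (k : PaillierKey) {M : Matrix (Fin m) (Fin n) ℤ}
    {r : Matrix (Fin m) (Fin n) ℕ} (hr : ∀ i j, (r i j).Coprime k.N)
    (hM : ∀ i j, 2 * |M i j| < k.N) : decMat k (encMat k.N M r) = M := by
  ext i j
  exact dec_enc k _ (hr i j) (hM i j)

theorem IsEnc.decMat {m n b : ℕ} {k : PaillierKey} {E : Matrix (Fin m) (Fin n) ℕ}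
    {V : Matrix (Fin m) (Fin n) ℤ} {ρ : Matrix (Fin m) (Fin n) ℕ} (h : IsEnc b k E V ρ)
    (hN : 2 * 2 ^ (2 * b) < k.N) : decMat k E = V := by
  rw [h.1]
  refine decMat_encMat k h.2.2 fun i j => ?_
  have h1 : (2 : ℤ) ^ b ≤ 2 ^ (2 * b) := pow_le_pow_right₀ (by norm_num) (by omega)
  have h2 : (2 * 2 ^ (2 * b) : ℤ) < k.N := by exact_mod_cast hN
  have := h.2.1 i j
  linarith

theorem mem_mask {m n s : ℕ} {φ : Matrix (Fin m) (Fin n) ℤ}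
    (h : φ ∈ (maskCoins m n s).support) (i : Fin m) (j : Fin n) : 0 ≤ φ i j ∧ φ i j < 2 ^ s := by
  simpa using mem_support_uniformMat h i j

/-- The conversion message of a masked product decrypts to the masked product. -/
theorem decMat_he2ss {m d n b s : ℕ} {k : PaillierKey} {X : Matrix (Fin m) (Fin d) ℤ}
    {E : Matrix (Fin d) (Fin n) ℕ} {V : Matrix (Fin d) (Fin n) ℤ} {ρ : Matrix (Fin d) (Fin n) ℕ}
    {φ : Matrix (Fin m) (Fin n) ℤ} {r : Matrix (Fin m) (Fin n) ℕ}
    (hX : ∀ i j, |X i j| < 2 ^ b) (hE : IsEnc b k E V ρ) (hφ : φ ∈ (maskCoins m n s).support)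
    (hr : r ∈ (encCoins m n k).support) (hN : 2 * (d * 2 ^ (2 * b) + 2 ^ s) < k.N) :
    decMat k (he2ss k.N (hMatMul k.N X E) φ r) = X * V - φ := by
  rw [hE.1, he2ss_hMatMul (Nat.zero_lt_of_lt k.one_lt_N)]
  refine decMat_encMat k (fun i j => ?_) fun i j => ?_
  · exact coprime_mod (Nat.Coprime.mul_left (prodCoins_coprime X hE.2.2 i j)
      (mem_support_encCoins hr i j))
  -- No wraparound: `|X V - φ| ≤ d 2 ^ (2 b) + 2 ^ s`, which is less than `N / 2`.
  · have h1 := abs_mul_apply_le hX hE.2.1 i j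
    have h2 := mem_mask hφ i j
    have h3 : ((2 * (d * 2 ^ (2 * b) + 2 ^ s) : ℕ) : ℤ) < k.N := by exact_mod_cast hN
    push_cast at h1 h3
    rw [Matrix.sub_apply]
    have h4 := abs_sub ((X * V) i j) (φ i j)
    rw [abs_of_nonneg h2.1] at h4
    linarith

/-- The distribution of a conversion message. -/
theorem encCoins_bind_he2ss {β : Type} {m d n b : ℕ} {k : PaillierKey}
    {X : Matrix (Fin m) (Fin d) ℤ} {E : Matrix (Fin d) (Fin n) ℕ} {V : Matrix (Fin d) (Fin n) ℤ}
    {ρ : Matrix (Fin d) (Fin n) ℕ} (hE : IsEnc b k E V ρ) (φ : Matrix (Fin m) (Fin n) ℤ)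
    (F : Matrix (Fin m) (Fin n) ℕ → β) :
    (encCoins m n k).map (fun r => F (he2ss k.N (hMatMul k.N X E) φ r)) =
      (encCoins m n k).map fun r => F (encMat k.N (X * V - φ) r) := by
  rw [hE.1]
  simp only [he2ss_hMatMul (Nat.zero_lt_of_lt k.one_lt_N)]
  -- Multiplication by the randomness of the homomorphic product, a unit, leaves fresh randomness
  -- uniform; so the message keeps no trace of `X` and `ρ` beyond its plaintext.
  conv_rhs => rw [← encCoins_map_mul k (prodCoins_coprime X hE.2.2), PMF.map_comp]
  rfl

theorem close_maskCoins_sub {m n s D : ℕ} {V : Matrix (Fin m) (Fin n) ℤ}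
    (hV : ∀ i j, |V i j| ≤ (D : ℤ)) :
    Close (m * (n * (D / 2 ^ s))) ((maskCoins m n s).map fun φ => V - φ)
      ((maskCoins m n s).map fun φ => -φ) := by
  rw [maskCoins_eq]
  have h1 := sampleMat_map (fun (_ : Fin m) (_ : Fin n) => maskEntry s) fun i j x => V i j - x
  have h2 := sampleMat_map (fun (_ : Fin m) (_ : Fin n) => maskEntry s) fun _ _ x => -x
  have e1 : (fun φ : Matrix (Fin m) (Fin n) ℤ => V - φ) =
      fun φ => Matrix.of fun i j => V i j - φ i j := rfl
  have e2 : (fun φ : Matrix (Fin m) (Fin n) ℤ => -φ) = fun φ => Matrix.of fun i j => -φ i j := rfl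
  rw [e1, e2, h1, h2]
  exact Close.sampleMat fun i j => close_mask_shift s (V i j) (hV i j)

/-- The inputs of a layer are small and properly encrypted. -/
structure LayerInput.Valid (b : ℕ) (x : LayerInput bs dA dB out)
    (VA : Matrix (Fin dA) (Fin out) ℤ) (ρA : Matrix (Fin dA) (Fin out) ℕ)
    (VB : Matrix (Fin dB) (Fin out) ℤ) (ρB : Matrix (Fin dB) (Fin out) ℕ) : Prop where
  XA : ∀ i j, |x.a.X i j| < 2 ^ b
  XB : ∀ i j, |x.b.X i j| < 2 ^ b
  dZ : ∀ i j, |x.dZ i j| < 2 ^ b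
  encA : IsEnc b x.keyB x.a.encV VA ρA
  encB : IsEnc b x.keyA x.b.encV VB ρB

/-- `clamp` and `toUnit` repair every inadmissible value, so no assumption on the choices of the
environment is needed. -/
theorem parseInput_valid (b : ℕ) (k : PaillierKey × PaillierKey) (l : List ℤ) :
    ∃ VA ρA VB ρB, (parseInput bs dA dB out b k l).Valid b VA ρA VB ρB :=
  ⟨_, _, _, _, fun _ _ => abs_clamp_lt _ _, fun _ _ => abs_clamp_lt _ _,
    fun _ _ => abs_clamp_lt _ _,
    ⟨rfl, fun _ _ => abs_clamp_lt _ _, fun _ _ => toUnit_coprime _ _⟩,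
    ⟨rfl, fun _ _ => abs_clamp_lt _ _, fun _ _ => toUnit_coprime _ _⟩⟩

/-- A modulus is large enough, and its prime factors are long. -/
structure GoodKey (bs dA dB b s κ : ℕ) (k : PaillierKey) : Prop where
  size_p : κ ≤ k.p.size
  size_q : κ ≤ k.q.size
  fit : 2 * ((bs + dA + dB + 1) * 2 ^ (2 * b) + 2 ^ s) < k.N

theorem GoodKey.fit_of_le {b s κ : ℕ} {k : PaillierKey} (h : GoodKey bs dA dB b s κ k) {d : ℕ}
    (hd : d ≤ bs + dA + dB + 1) : 2 * (d * 2 ^ (2 * b) + 2 ^ s) < k.N := by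
  refine lt_of_le_of_lt ?_ h.fit
  gcongr

theorem GoodKey.fit_one {b s κ : ℕ} {k : PaillierKey} (h : GoodKey bs dA dB b s κ k) :
    2 * 2 ^ (2 * b) < k.N := by
  have h1 := h.fit_of_le (d := 1) (by omega)
  have h2 : 0 < 2 ^ s := by positivity
  rw [one_mul] at h1
  omega

/-- The output of the forward propagation. -/
def fwOutput (x : LayerInput bs dA dB out) : Matrix (Fin bs) (Fin out) ℤ :=
  x.a.X * (x.a.U + decMat x.keyB x.a.encV) + x.b.X * (x.b.U + decMat x.keyA x.b.encV)

/-- The outputs of the ideal functionality of the forward propagation. -/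
def fwIdeal (x : LayerInput bs dA dB out) : Party → List ℤ
  | .A => []
  | .B => flat (fwOutput x)

theorem matMulFwFunctionality_eq (x : LayerInput bs dA dB out) :
    matMulFwFunctionality x = (PMF.pure ()).map fun _ => fwIdeal x := by
  rw [PMF.pure_map, matMulFwFunctionality]
  congr 1

/-- The simulated view of `A` in the forward propagation. -/
noncomputable def fwSimA (s : ℕ) (x : LayerInput bs dA dB out) : PMF (List ℤ) :=
  (maskCoins bs out s).bind fun εA =>
  (approxCoins bs out x.keyB.N).bind fun rA =>
  (maskCoins bs out s).bind fun εB =>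
  (approxCoins bs out x.keyA.N).map fun r =>
    fwInput s .A x ++ flat εA ++ flatNat rA ++ flatNat (encMat x.keyA.N (-εB) r)

/-- By correctness `ε_B` cancels in the output of `B`, so within view and outputs it occurs only in
the plaintext `X_B V_B - ε_B` of the message to `A`, which is therefore close to `-ε_B`. The error
counts two matrices of approximate units and one mask. -/
theorem fwSimA_close {b s κ : ℕ} {x : LayerInput bs dA dB out} {VA ρA VB ρB}
    (hx : x.Valid b VA ρA VB ρB) (hA : GoodKey bs dA dB b s κ x.keyA)
    (hB : GoodKey bs dA dB b s κ x.keyB) :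
    Close (statErr (2 * (bs * out)) (bs * out * dB) b s κ)
      ((matMulFwProtocol s x).map fun e => (e.view .A, e.out .A, e.out .B))
      ((PMF.pure ()).bind fun _ => (fwSimA s x).map fun v => (v, fwIdeal x .A, fwIdeal x .B)) := by
  have hreal : (matMulFwProtocol s x).map (fun e => (e.view .A, e.out .A, e.out .B)) =
      (maskCoins bs out s).bind fun εA =>
      (encCoins bs out x.keyB).bind fun rA =>
      ((maskCoins bs out s).map fun ε => x.b.X * VB - ε).bind fun δ =>
      (encCoins bs out x.keyA).map fun r =>
        (fwInput s .A x ++ flat εA ++ flatNat rA ++ flatNat (encMat x.keyA.N δ r), [],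
          flat (fwOutput x)) := by
    simp only [matMulFwProtocol, PMF.map_bind, PMF.map_comp, PMF.bind_map]
    refine bind_congr_support fun εA hεA => bind_congr_support fun rA hrA =>
      bind_congr_support fun εB hεB => ?_
    rw [Function.comp_apply]
    rw [← encCoins_bind_he2ss hx.encB εB fun msg => (fwInput s .A x ++ flat εA ++ flatNat rA ++
      flatNat msg, ([] : List ℤ), flat (fwOutput x))]
    refine map_congr_support fun rB hrB => ?_
    simp only [Function.comp_apply]
    rw [decMat_he2ss hx.XB hx.encB hεB hrB (hA.fit_of_le (by omega)),
      decMat_he2ss hx.XA hx.encA hεA hrA (hB.fit_of_le (by omega)), fwOutput,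
      hx.encA.decMat hB.fit_one, hx.encB.decMat hA.fit_one]
    congr 3
    simp only [Matrix.mul_add]
    abel
  have hideal : ((PMF.pure ()).bind fun _ => (fwSimA s x).map
      fun v => (v, fwIdeal x .A, fwIdeal x .B)) =
      (maskCoins bs out s).bind fun εA =>
      (approxCoins bs out x.keyB.N).bind fun rA =>
      ((maskCoins bs out s).map fun ε => -ε).bind fun δ =>
      (approxCoins bs out x.keyA.N).map fun r =>
        (fwInput s .A x ++ flat εA ++ flatNat rA ++ flatNat (encMat x.keyA.N δ r), [],
          flat (fwOutput x)) := by
    simp only [fwIdeal, PMF.pure_bind, fwSimA, PMF.map_bind, PMF.map_comp,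
      PMF.bind_map]
    rfl
  rw [hreal, hideal]
  refine Close.mono (Close.bind_right _ fun εA _ =>
    (close_approxCoins x.keyB hB.size_p hB.size_q _ _).symm.bind fun rA _ =>
    (close_maskCoins_sub (abs_mul_apply_le hx.XB hx.encB.2.1)).bind fun δ _ =>
    (close_approxCoins x.keyA hA.size_p hA.size_q _ _).symm.map _) (le_of_eq ?_)
  rw [statErr]
  push_cast
  ring

/-- The simulated view of `B` in the forward propagation, given the output of `B`. -/
noncomputable def fwSimB (s : ℕ) (x : LayerInput bs dA dB out) : PMF (List ℤ) :=
  (maskCoins bs out s).bind fun εB =>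
  (approxCoins bs out x.keyA.N).bind fun rB =>
  (maskCoins bs out s).bind fun ε =>
  (approxCoins bs out x.keyB.N).map fun r =>
    fwInput s .B x ++ flat εB ++ flatNat rB ++ flatNat (encMat x.keyB.N (-ε) r) ++
      flat (fwOutput x - (x.b.X * x.b.U + εB + -ε))

/-- Given the output `Z`, the message `Z_A = Z - Z_B` is a function of the own mask of `B` and of
the plaintext `δ` that `B` decrypts. Hence only `δ = X_A V_A - ε_A` has to be replaced by `-ε`,
consistently in both messages. -/
theorem fwSimB_close {b s κ : ℕ} {x : LayerInput bs dA dB out} {VA ρA VB ρB}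
    (hx : x.Valid b VA ρA VB ρB) (hA : GoodKey bs dA dB b s κ x.keyA)
    (hB : GoodKey bs dA dB b s κ x.keyB) :
    Close (statErr (2 * (bs * out)) (bs * out * dA) b s κ)
      ((matMulFwProtocol s x).map fun e => (e.view .B, e.out .A, e.out .B))
      ((PMF.pure ()).bind fun _ => (fwSimB s x).map fun v => (v, fwIdeal x .A, fwIdeal x .B)) := by
  have hreal : (matMulFwProtocol s x).map (fun e => (e.view .B, e.out .A, e.out .B)) =
      (maskCoins bs out s).bind fun εB =>
      (encCoins bs out x.keyA).bind fun rB =>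
      ((maskCoins bs out s).map fun ε => x.a.X * VA - ε).bind fun δ =>
      (encCoins bs out x.keyB).map fun r =>
        (fwInput s .B x ++ flat εB ++ flatNat rB ++ flatNat (encMat x.keyB.N δ r) ++
          flat (fwOutput x - (x.b.X * x.b.U + εB + δ)), [], flat (fwOutput x)) := by
    simp only [matMulFwProtocol, PMF.map_bind, PMF.map_comp, PMF.bind_map]
    -- The samples are independent; those of `B` are drawn first, in the order of the simulator.
    have hswap : ∀ F : Matrix (Fin bs) (Fin out) ℤ → Matrix (Fin bs) (Fin out) ℕ →
        Matrix (Fin bs) (Fin out) ℤ → Matrix (Fin bs) (Fin out) ℕ → List ℤ × List ℤ × List ℤ,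
        ((maskCoins bs out s).bind fun εA => (encCoins bs out x.keyB).bind fun rA =>
          (maskCoins bs out s).bind fun εB => (encCoins bs out x.keyA).map fun rB =>
            F εA rA εB rB) =
        (maskCoins bs out s).bind fun εB => (encCoins bs out x.keyA).bind fun rB =>
          (maskCoins bs out s).bind fun εA => (encCoins bs out x.keyB).map fun rA =>
            F εA rA εB rB := by
      intro F
      refine Eq.trans (congrArg _ (funext fun εA => PMF.bind_comm _ _ _)) ?_
      refine (PMF.bind_comm _ _ _).trans (congrArg _ (funext fun εB => ?_))
      refine Eq.trans (congrArg _ (funext fun εA => ?_)) (PMF.bind_comm _ _ _)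
      exact PMF.bind_comm (encCoins bs out x.keyB) (encCoins bs out x.keyA) _
    refine (hswap _).trans ?_
    refine bind_congr_support fun εB hεB => bind_congr_support fun rB hrB =>
      bind_congr_support fun εA hεA => ?_
    rw [Function.comp_apply]
    rw [← encCoins_bind_he2ss hx.encA εA fun msg => (fwInput s .B x ++ flat εB ++ flatNat rB ++
      flatNat msg ++ flat (fwOutput x - (x.b.X * x.b.U + εB + (x.a.X * VA - εA))),
        ([] : List ℤ), flat (fwOutput x))]
    refine map_congr_support fun rA hrA => ?_
    simp only [Function.comp_apply]
    rw [decMat_he2ss hx.XB hx.encB hεB hrB (hA.fit_of_le (by omega)),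
      decMat_he2ss hx.XA hx.encA hεA hrA (hB.fit_of_le (by omega)), fwOutput,
      hx.encA.decMat hB.fit_one, hx.encB.decMat hA.fit_one]
    have h1 : x.a.X * x.a.U + εA + (x.b.X * VB - εB) =
        x.a.X * (x.a.U + VA) + x.b.X * (x.b.U + VB) -
          (x.b.X * x.b.U + εB + (x.a.X * VA - εA)) := by
      simp only [Matrix.mul_add]
      abel
    rw [h1, sub_add_cancel]
  have hideal : ((PMF.pure ()).bind fun _ => (fwSimB s x).map
      fun v => (v, fwIdeal x .A, fwIdeal x .B)) =
      (maskCoins bs out s).bind fun εB =>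
      (approxCoins bs out x.keyA.N).bind fun rB =>
      ((maskCoins bs out s).map fun ε => -ε).bind fun δ =>
      (approxCoins bs out x.keyB.N).map fun r =>
        (fwInput s .B x ++ flat εB ++ flatNat rB ++ flatNat (encMat x.keyB.N δ r) ++
          flat (fwOutput x - (x.b.X * x.b.U + εB + δ)), [], flat (fwOutput x)) := by
    simp only [fwIdeal, PMF.pure_bind, fwSimB, PMF.map_bind, PMF.map_comp,
      PMF.bind_map]
    rfl
  rw [hreal, hideal]
  refine Close.mono (Close.bind_right _ fun εB _ =>
    (close_approxCoins x.keyA hA.size_p hA.size_q _ _).symm.bind fun rB _ =>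
    (close_maskCoins_sub (abs_mul_apply_le hx.XA hx.encA.2.1)).bind fun δ _ =>
    (close_approxCoins x.keyB hB.size_p hB.size_q _ _).symm.map _) (le_of_eq ?_)
  rw [statErr]
  push_cast
  ring

/-- The outputs of the ideal functionality of the backward propagation. -/
def bwIdeal (x : LayerInput bs dA dB out) (φ : Matrix (Fin dA) (Fin out) ℤ) : Party → List ℤ
  | .A => flat φ
  | .B => flat (x.a.X.transpose * x.dZ - φ) ++ flat (x.b.X.transpose * x.dZ)

theorem matMulBwFunctionality_eq (s : ℕ) (x : LayerInput bs dA dB out) :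
    matMulBwFunctionality s x = (maskCoins dA out s).map (bwIdeal x) := by
  rw [matMulBwFunctionality]
  congr 1

/-- The backward propagation, with correct decryption and a fresh conversion message. -/
theorem matMulBwProtocol_eq {β : Type} {b s κ : ℕ} {x : LayerInput bs dA dB out} {VA ρA VB ρB}
    (hx : x.Valid b VA ρA VB ρB) (hB : GoodKey bs dA dB b s κ x.keyB)
    (F : (Party → List ℤ) → (Party → List ℤ) → β) :
    (matMulBwProtocol s x).map (fun e => F e.view e.out) =
      (encCoins bs out x.keyB).bind fun t =>
      (maskCoins dA out s).bind fun φ =>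
      (encCoins dA out x.keyB).bind fun r =>
      (encCoins dA out x.keyB).map fun u =>
        F (fun
          | .A => bwInput s .A x ++ flat φ ++ flatNat r ++ flatNat (encMat x.keyB.N x.dZ t) ++
            flatNat (encMat x.keyB.N (x.a.X.transpose * x.dZ - φ) u)
          | .B => bwInput s .B x ++ flatNat t ++ flatNat u ++ flatNat (he2ss x.keyB.N
            (hMatMul x.keyB.N x.a.X.transpose (encMat x.keyB.N x.dZ t)) φ r))
        (bwIdeal x φ) := by
  simp only [matMulBwProtocol, PMF.map_bind, PMF.map_comp]
  refine bind_congr_support fun t ht => bind_congr_support fun φ hφ =>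
    bind_congr_support fun r hr => map_congr_support fun u _ => ?_
  simp only [Function.comp_apply]
  rw [decMat_he2ss (b := b) (X := x.a.X.transpose) (V := x.dZ) (ρ := t) (fun i j => hx.XA j i)
    ⟨rfl, hx.dZ, mem_support_encCoins ht⟩ hφ hr (hB.fit_of_le (by omega))]
  congr 1

/-- The simulated view of `B` in the backward propagation. -/
noncomputable def bwSimB (s : ℕ) (x : LayerInput bs dA dB out) (φ : Matrix (Fin dA) (Fin out) ℤ) :
    PMF (List ℤ) :=
  (approxCoins bs out x.keyB.N).bind fun t =>
  (approxCoins dA out x.keyB.N).bind fun u =>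
  (approxCoins dA out x.keyB.N).map fun r =>
    bwInput s .B x ++ flatNat t ++ flatNat u ++
      flatNat (encMat x.keyB.N (x.a.X.transpose * x.dZ - φ) r)

/-- The message to `B` encrypts the share that `B` receives from the functionality. Nothing needs
masking, whence the `0` in `statErr`: only the sampling of units is approximate. -/
theorem bwSimB_close {b s κ : ℕ} {x : LayerInput bs dA dB out} {VA ρA VB ρB}
    (hx : x.Valid b VA ρA VB ρB) (hB : GoodKey bs dA dB b s κ x.keyB) :
    Close (statErr (bs * out + 2 * (dA * out)) 0 b s κ)
      ((matMulBwProtocol s x).map fun e => (e.view .B, e.out .A, e.out .B))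
      ((maskCoins dA out s).bind fun φ => (bwSimB s x φ).map
        fun v => (v, bwIdeal x φ .A, bwIdeal x φ .B)) := by
  have hreal : (matMulBwProtocol s x).map (fun e => (e.view .B, e.out .A, e.out .B)) =
      (maskCoins dA out s).bind fun φ =>
      (encCoins bs out x.keyB).bind fun t =>
      (encCoins dA out x.keyB).bind fun u =>
      (encCoins dA out x.keyB).map fun r =>
        (bwInput s .B x ++ flatNat t ++ flatNat u ++
          flatNat (encMat x.keyB.N (x.a.X.transpose * x.dZ - φ) r),
          bwIdeal x φ .A, bwIdeal x φ .B) := by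
    rw [matMulBwProtocol_eq hx hB fun v o => (v .B, o .A, o .B), PMF.bind_comm]
    congr 1
    funext φ
    refine bind_congr_support fun t ht => ?_
    simp only [PMF.map]
    rw [PMF.bind_comm]
    congr 1
    funext u
    exact encCoins_bind_he2ss (b := b) (X := x.a.X.transpose) (V := x.dZ) (ρ := t)
      ⟨rfl, hx.dZ, mem_support_encCoins ht⟩ φ
      fun msg => (bwInput s .B x ++ flatNat t ++ flatNat u ++ flatNat msg,
        bwIdeal x φ .A, bwIdeal x φ .B)
  rw [hreal]
  simp only [bwSimB, PMF.map_bind, PMF.map_comp]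
  refine Close.mono (Close.bind_right _ fun φ _ =>
    (close_approxCoins x.keyB hB.size_p hB.size_q _ _).symm.bind fun t _ =>
    (close_approxCoins x.keyB hB.size_p hB.size_q _ _).symm.bind fun u _ =>
    (close_approxCoins x.keyB hB.size_p hB.size_q _ _).symm.map _) (le_of_eq ?_)
  rw [statErr]
  push_cast
  ring

end Layer

/-! ### The simulators -/

section Simulators

variable {bs dA dB out : ℕ} {Γ : Type} {C : Ctx Γ}

/-- A sampled list may be passed on to a polynomial-time algorithm. -/
theorem PPT.bindCall {F : Γ → PMF (List ℤ)} (hF : PPT C F) {L : Γ → List ℤ} (hL : DetList C L)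
    {A : Alg} (hA : A.code.PolyTime) :
    PPT C fun γ => (F γ).bind fun v => A.output (C.κ γ) (L γ ++ v) := by
  obtain ⟨m, hm⟩ := hL.exists_length
  obtain ⟨B, hB, hB'⟩ := hF
  refine PPT.letList hL hm ⟨Alg.comp (C.len + m) (B.select (List.range' 1 C.len))
    (A.select (List.range' (C.len + 1) (m + B.outLen))),
    Alg.comp_polyTime _ (Alg.select_polyTime hB _) (Alg.select_polyTime hA _), fun γ => ?_⟩
  have hlen : (C.vars γ ++ L γ).length = C.len + m := by simp [C.length_vars, hm]
  dsimp only
  rw [Alg.comp_output _ _ _ _ hlen.ge, List.take_of_length_le hlen.le, Alg.select_output]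
  have h1 : (List.range' 1 C.len).map (load ((C.κ γ : ℤ) :: (C.vars γ ++ L γ))) = C.vars γ := by
    apply List.ext_getElem
    · simp [C.length_vars]
    · intro i h1 h2
      have h4 : 1 + i = i + 1 := by omega
      simp [load, h4, List.getElem?_append_left h2, h2]
  rw [h1, hB']
  refine bind_congr_support fun v hv => ?_
  have hv' : v.length = B.outLen := length_output (by rw [hB' γ]; exact hv)
  have h2 := range'_map_load (C.κ γ) (C.vars γ) (L γ ++ v)
  rw [List.length_append, hm, hv', C.length_vars, ← List.append_assoc] at h2
  rw [Alg.select_output, h2]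

theorem DetList.lastMat {m n : ℕ} (i : Fin m) (j : Fin n) :
    PolyFun (C.ext (Matrix (Fin m) (Fin n) ℤ)) fun p => p.2 i j :=
  DetList.flat_apply (M := fun p : Γ × Matrix (Fin m) (Fin n) ℤ => p.2)
    (DetList.last.congr fun _ => toList_mat _) i j

theorem DetList.lastMatNat {m n : ℕ} (i : Fin m) (j : Fin n) :
    PolyFun (C.ext (Matrix (Fin m) (Fin n) ℕ)) fun p => (p.2 i j : ℤ) :=
  DetList.flatNat_apply (M := fun p : Γ × Matrix (Fin m) (Fin n) ℕ => p.2)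
    (DetList.last.congr fun _ => toList_matNat _) i j

/-- The data of a party are known. -/
structure KnownInput {d : ℕ} (C : Ctx Γ) (r p q N : Γ → ℤ) (D : Γ → PartyData bs d out)
    (L : Γ → List ℤ) : Prop where
  range : PolyFun C r
  prime_p : PolyFun C p
  prime_q : PolyFun C q
  modulus : PolyFun C N
  X : ∀ i j, PolyFun C fun γ => (D γ).X i j
  U : ∀ i j, PolyFun C fun γ => (D γ).U i j
  input : DetList C fun γ => r γ :: ([p γ, q γ, N γ] ++ (D γ).toList)
  rest : DetList C L

theorem DetList.knownInput {d : ℕ} {z r p q N : Γ → ℤ} {D : Γ → PartyData bs d out}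
    {L : Γ → List ℤ}
    (h : DetList C fun γ => z γ :: ((r γ :: ([p γ, q γ, N γ] ++ (D γ).toList)) ++ L γ)) :
    KnownInput C r p q N D L := by
  have hl : ∀ γ, (r γ :: ([p γ, q γ, N γ] ++ (D γ).toList)).length =
      bs * d + d * out + d * out + 4 := fun γ => by simp [length_partyData]
  have hi := DetList.left h.tail hl
  have hD := hi.tail.tail.tail.tail
  have hD' := DetList.left (L := fun γ => MatMulSource.flat (D γ).X ++ MatMulSource.flat (D γ).U)
    (L' := fun γ => MatMulSource.flatNat (D γ).encV) hD
    (m := bs * d + d * out) fun γ => by simp [length_flat]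
  exact ⟨hi.head, hi.tail.head, hi.tail.tail.head, hi.tail.tail.tail.head,
    DetList.flat_apply (M := fun γ => (D γ).X) (DetList.left hD' fun γ => length_flat _),
    DetList.flat_apply (M := fun γ => (D γ).U) (DetList.right hD' fun γ => length_flat _),
    hi, DetList.right h.tail hl⟩

theorem PPT.fwSimA {s : Γ → ℕ} {x : Γ → LayerInput bs dA dB out} {z : Γ → ℤ} {L : Γ → List ℤ}
    (h : DetList C fun γ => z γ :: (fwInput (s γ) .A (x γ) ++ L γ)) :
    PPT C fun γ => fwSimA (s γ) (x γ) := by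
  have hx := h.knownInput
  have hNA : PolyFun C fun γ => ((x γ).keyA.N : ℤ) :=
    (hx.prime_p.mul hx.prime_q).congr fun γ => by simp [PaillierKey.N]
  have h0 : ∀ γ, 0 < (x γ).keyA.N := fun γ => Nat.zero_lt_of_lt (x γ).keyA.one_lt_N
  have hin : DetList C fun γ => fwInput (s γ) .A (x γ) := hx.input
  refine PPT.bind (PPT.maskCoins hx.range bs out) (PPT.bind (PPT.approxCoins hx.modulus.weaken bs out)
    (PPT.bind (PPT.maskCoins hx.range.weaken.weaken bs out)
    (PPT.bind (PPT.approxCoins hNA.weaken.weaken.weaken bs out) ?_)))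
  refine DetList.append (DetList.append (DetList.append hin.weaken.weaken.weaken.weaken ?_) ?_) ?_
  · exact DetList.weaken (DetList.weaken (DetList.weaken
      (DetList.flat fun i j => DetList.lastMat i j)))
  · exact DetList.weaken (DetList.weaken (DetList.flatNat fun i j => DetList.lastMatNat i j))
  · exact DetList.encMat hNA.weaken.weaken.weaken.weaken
      (fun i j => (DetList.lastMat i j).neg.weaken) (fun i j => DetList.lastMatNat i j)
      fun p => h0 p.1.1.1.1

theorem PPT.fwSimB {s : Γ → ℕ} {x : Γ → LayerInput bs dA dB out} {z : Γ → ℤ}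
    (h : DetList C fun γ => z γ :: (fwInput (s γ) .B (x γ) ++ fwIdeal (x γ) .B)) :
    PPT C fun γ => fwSimB (s γ) (x γ) := by
  have hx := h.knownInput
  have hNB : PolyFun C fun γ => ((x γ).keyB.N : ℤ) :=
    (hx.prime_p.mul hx.prime_q).congr fun γ => by simp [PaillierKey.N]
  have h0 : ∀ γ, 0 < (x γ).keyB.N := fun γ => Nat.zero_lt_of_lt (x γ).keyB.one_lt_N
  have hin : DetList C fun γ => fwInput (s γ) .B (x γ) := hx.input
  have hZ : ∀ i j, PolyFun C fun γ => fwOutput (x γ) i j := DetList.flat_apply hx.rest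
  have hXU : ∀ i j, PolyFun C fun γ => ((x γ).b.X * (x γ).b.U) i j := PolyFun.mulApply hx.X hx.U
  refine PPT.bind (PPT.maskCoins hx.range bs out) (PPT.bind (PPT.approxCoins hx.modulus.weaken bs out)
    (PPT.bind (PPT.maskCoins hx.range.weaken.weaken bs out)
    (PPT.bind (PPT.approxCoins hNB.weaken.weaken.weaken bs out) ?_)))
  refine DetList.append (DetList.append (DetList.append (DetList.append
    hin.weaken.weaken.weaken.weaken ?_) ?_) ?_) ?_
  · exact DetList.weaken (DetList.weaken (DetList.weaken
      (DetList.flat fun i j => DetList.lastMat i j)))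
  · exact DetList.weaken (DetList.weaken (DetList.flatNat fun i j => DetList.lastMatNat i j))
  · exact DetList.encMat hNB.weaken.weaken.weaken.weaken
      (fun i j => (DetList.lastMat i j).neg.weaken) (fun i j => DetList.lastMatNat i j)
      fun p => h0 p.1.1.1.1
  · exact DetList.flat fun i j => PolyFun.sub (hZ i j).weaken.weaken.weaken.weaken
      (PolyFun.add (PolyFun.add (hXU i j).weaken.weaken.weaken.weaken
        (DetList.lastMat i j).weaken.weaken.weaken) (DetList.lastMat i j).neg.weaken)

theorem PPT.bwSimB {s : Γ → ℕ} {x : Γ → LayerInput bs dA dB out}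
    {φ : Γ → Matrix (Fin dA) (Fin out) ℤ} {z : Γ → ℤ}
    (h : DetList C fun γ => z γ :: (bwInput (s γ) .B (x γ) ++ bwIdeal (x γ) (φ γ) .B)) :
    PPT C fun γ => bwSimB (s γ) (x γ) (φ γ) := by
  have hx := DetList.knownInput (L := fun γ => flat (x γ).dZ ++ bwIdeal (x γ) (φ γ) .B)
    (D := fun γ => (x γ).b) (h.congr fun γ => by simp only [bwInput, List.append_assoc]; rfl)
  have hNB : PolyFun C fun γ => ((x γ).keyB.N : ℤ) :=
    (hx.prime_p.mul hx.prime_q).congr fun γ => by simp [PaillierKey.N]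
  have h0 : ∀ γ, 0 < (x γ).keyB.N := fun γ => Nat.zero_lt_of_lt (x γ).keyB.one_lt_N
  have hin : DetList C fun γ => bwInput (s γ) .B (x γ) :=
    hx.input.append (DetList.left hx.rest fun γ => length_flat _)
  have hS : ∀ i j, PolyFun C fun γ => ((x γ).a.X.transpose * (x γ).dZ - φ γ) i j :=
    DetList.flat_apply (DetList.left (DetList.right hx.rest fun γ => length_flat _)
      fun γ => length_flat _)
  refine PPT.bind (PPT.approxCoins hNB bs out) (PPT.bind (PPT.approxCoins hNB.weaken dA out)
    (PPT.bind (PPT.approxCoins hNB.weaken.weaken dA out) ?_))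
  refine DetList.append (DetList.append (DetList.append hin.weaken.weaken.weaken ?_) ?_) ?_
  · exact DetList.weaken (DetList.weaken (DetList.flatNat fun i j => DetList.lastMatNat i j))
  · exact DetList.weaken (DetList.flatNat fun i j => DetList.lastMatNat i j)
  · exact DetList.encMat hNB.weaken.weaken.weaken (fun i j => (hS i j).weaken.weaken.weaken)
      (fun i j => DetList.lastMatNat i j) fun p => h0 p.1.1.1

/-- The simulated view of `A` in the backward propagation. -/
noncomputable def bwSimA (s : ℕ) (x : LayerInput bs dA dB out) (φ : Matrix (Fin dA) (Fin out) ℤ) :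
    PMF (List ℤ) :=
  (approxCoins dA out x.keyB.N).bind fun r =>
  (approxCoins bs out x.keyB.N).bind fun t =>
  (approxCoins dA out x.keyB.N).map fun u =>
    bwInput s .A x ++ flat φ ++ flatNat r ++ flatNat (encMat x.keyB.N 0 t) ++
      flatNat (encMat x.keyB.N 0 u)

theorem PPT.bwSimA {s : Γ → ℕ} {x : Γ → LayerInput bs dA dB out}
    {φ : Γ → Matrix (Fin dA) (Fin out) ℤ} {z : Γ → ℤ}
    (h : DetList C fun γ => z γ :: (bwInput (s γ) .A (x γ) ++ bwIdeal (x γ) (φ γ) .A)) :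
    PPT C fun γ => bwSimA (s γ) (x γ) (φ γ) := by
  have hx := DetList.knownInput (L := fun γ => bwIdeal (x γ) (φ γ) .A)
    (D := fun γ => (x γ).a) (h.congr fun γ => by simp only [bwInput, List.append_nil]; rfl)
  have h0 : ∀ γ, 0 < (x γ).keyB.N := fun γ => Nat.zero_lt_of_lt (x γ).keyB.one_lt_N
  have hin : DetList C fun γ => bwInput (s γ) .A (x γ) :=
    DetList.congr hx.input fun γ => (List.append_nil _).symm
  have hφ : DetList C fun γ => flat (φ γ) := hx.rest
  refine PPT.bind (PPT.approxCoins hx.modulus dA out) (PPT.bind (PPT.approxCoins hx.modulus.weaken bs out)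
    (PPT.bind (PPT.approxCoins hx.modulus.weaken.weaken dA out) ?_))
  refine DetList.append (DetList.append (DetList.append (DetList.append
    hin.weaken.weaken.weaken hφ.weaken.weaken.weaken) ?_) ?_) ?_
  · exact DetList.weaken (DetList.weaken (DetList.flatNat fun i j => DetList.lastMatNat i j))
  · exact DetList.encMat hx.modulus.weaken.weaken.weaken (fun i j => PolyFun.const 0)
      (fun i j => (DetList.lastMatNat i j).weaken) fun p => h0 p.1.1.1
  · exact DetList.encMat hx.modulus.weaken.weaken.weaken (fun i j => PolyFun.const 0)
      (fun i j => DetList.lastMatNat i j) fun p => h0 p.1.1.1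

/-- A polynomial-time sampler of views composed with an adversary is a simulator. -/
theorem exists_simulator {Θ : Type} {I : Type} {n : ℕ} (input : ℕ → Party → I → List ℤ)
    (o : I → Θ → Party → List ℤ) (c : Party)
    (hn : ∀ s x θ, (input s c x ++ o x θ c).length = n) (simView : ℕ → I → Θ → PMF (List ℤ))
    (hsim : ∀ (C : Ctx (ℕ × ℤ × ℕ × I × Θ)), (DetList C fun γ => γ.2.1 ::
      (input γ.2.2.1 c γ.2.2.2.1 ++ o γ.2.2.2.1 γ.2.2.2.2 c)) →
      PPT C fun γ => simView γ.2.2.1 γ.2.2.2.1 γ.2.2.2.2)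
    {adv : Alg} (hadv : adv.code.PolyTime) :
    ∃ sim : Alg, sim.code.PolyTime ∧ ∀ κ z s x θ,
      sim.output κ (z :: (input s c x ++ o x θ c)) =
        (simView s x θ).bind fun v => adv.output κ (z :: v) := by
  -- The index ranges over all parameters, so that one program serves them all, while the variables
  -- show only what a simulator is given: `z`, the input of `c` and its ideal output.
  let C : Ctx (ℕ × ℤ × ℕ × I × Θ) :=
    ⟨fun γ => γ.1, fun γ => γ.2.1 :: (input γ.2.2.1 c γ.2.2.2.1 ++ o γ.2.2.2.1 γ.2.2.2.2 c), n + 1,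
      fun γ => by rw [List.length_cons, hn]⟩
  have hv : DetList C fun γ => γ.2.1 :: (input γ.2.2.1 c γ.2.2.2.1 ++ o γ.2.2.2.1 γ.2.2.2.2 c) :=
    DetList.vars
  obtain ⟨sim, h1, h2⟩ := (hsim C hv).bindCall (DetList.singleton hv.head) hadv
  exact ⟨sim, h1, fun κ z s x θ => h2 (κ, z, s, x, θ)⟩

end Simulators

/-! ### Security with statistical error: the forward propagation, and the backward propagation
against `B`. -/

section Statistical

variable {bs dA dB out : ℕ} {gen : ℕ → PMF PaillierKey} {b s : ℕ → ℕ}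

theorem mem_support_keySetup {κ : ℕ} {k : PaillierKey × PaillierKey}
    (h : k ∈ (keySetup gen κ).support) : k.1 ∈ (gen κ).support ∧ k.2 ∈ (gen κ).support := by
  rw [keySetup, PMF.mem_support_bind_iff] at h
  obtain ⟨kA, hA, h⟩ := h
  rw [PMF.mem_support_map_iff] at h
  obtain ⟨kB, hB, rfl⟩ := h
  exact ⟨hA, hB⟩

theorem length_fwInput_A (s : ℕ) (x : LayerInput bs dA dB out) :
    (fwInput s .A x).length = bs * dA + dA * out + dA * out + 4 := by
  simp [fwInput, keysOf, length_partyData]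

theorem length_fwInput_B (s : ℕ) (x : LayerInput bs dA dB out) :
    (fwInput s .B x).length = bs * dB + dB * out + dB * out + 4 := by
  simp [fwInput, keysOf, length_partyData]

theorem matMulFw_secure
    (hgood : ∀ κ, ∀ k ∈ (gen κ).support, GoodKey bs dA dB (b κ) (s κ) κ k)
    (hmask : Negligible fun κ => 2 ^ (2 * b κ) / 2 ^ s κ) :
    SecurelyRealizes (keySetup gen) (fun κ => knownKeys (s κ))
      (fun κ => parseInput bs dA dB out (b κ)) (fun κ => fwInput (s κ))
      (fun κ => matMulFwProtocol (s κ)) (fun _ => matMulFwFunctionality) := by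
  intro c adv hadv
  cases c
  · obtain ⟨sim, h1, h2⟩ := exists_simulator (I := LayerInput bs dA dB out) fwInput
      (fun x (_ : Unit) => fwIdeal x) .A
      (fun s x _ => by rw [List.length_append, length_fwInput_A, fwIdeal, List.length_nil])
      (fun s x _ => fwSimA s x) (fun C hC => PPT.fwSimA hC) hadv
    refine ⟨sim, h1, fun choose guess _ _ q =>
      ⟨_, negligible_statErr (2 * (bs * out)) (bs * out * dB) hmask, fun κ z _ => ?_⟩⟩
    refine advantage_le_of_close (PMF.pure ()) (fun x (_ : Unit) => fwIdeal x)
      matMulFwFunctionality_eq (fun x _ => fwSimA (s κ) x) (fun x θ => h2 κ z (s κ) x θ)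
      (fun k hk l => ?_) choose guess
    obtain ⟨_, _, _, _, hv⟩ := parseInput_valid (bs := bs) (dA := dA) (dB := dB) (out := out)
      (b κ) k l
    have hk := mem_support_keySetup hk
    exact fwSimA_close hv (hgood κ _ hk.1) (hgood κ _ hk.2)
  · obtain ⟨sim, h1, h2⟩ := exists_simulator (I := LayerInput bs dA dB out) fwInput
      (fun x (_ : Unit) => fwIdeal x) .B
      (fun s x _ => by rw [List.length_append, length_fwInput_B, fwIdeal, length_flat])
      (fun s x _ => fwSimB s x) (fun C hC => PPT.fwSimB hC) hadv
    refine ⟨sim, h1, fun choose guess _ _ q =>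
      ⟨_, negligible_statErr (2 * (bs * out)) (bs * out * dA) hmask, fun κ z _ => ?_⟩⟩
    refine advantage_le_of_close (PMF.pure ()) (fun x (_ : Unit) => fwIdeal x)
      matMulFwFunctionality_eq (fun x _ => fwSimB (s κ) x) (fun x θ => h2 κ z (s κ) x θ)
      (fun k hk l => ?_) choose guess
    obtain ⟨_, _, _, _, hv⟩ := parseInput_valid (bs := bs) (dA := dA) (dB := dB) (out := out)
      (b κ) k l
    have hk := mem_support_keySetup hk
    exact fwSimB_close hv (hgood κ _ hk.1) (hgood κ _ hk.2)

theorem matMulBw_secure_B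
    (hgood : ∀ κ, ∀ k ∈ (gen κ).support, GoodKey bs dA dB (b κ) (s κ) κ k)
    (hmask : Negligible fun κ => 2 ^ (2 * b κ) / 2 ^ s κ) {adv : Alg} (hadv : adv.code.PolyTime) :
    ∃ sim : Alg, sim.code.PolyTime ∧ ∃ μ : ℕ → ℝ, Negligible μ ∧
      ∀ (choose : Alg) (guess : Prog) (κ : ℕ) (z : ℤ), advantage
        (realExperiment (keySetup gen) (fun κ => knownKeys (s κ))
          (fun κ => parseInput bs dA dB out (b κ)) (fun κ => matMulBwProtocol (s κ))
          .B adv choose guess κ z)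
        (idealExperiment (keySetup gen) (fun κ => knownKeys (s κ))
          (fun κ => parseInput bs dA dB out (b κ)) (fun κ => bwInput (s κ))
          (fun κ => matMulBwFunctionality (s κ)) .B sim choose guess κ z) ≤ μ κ := by
  obtain ⟨sim, h1, h2⟩ := exists_simulator (I := LayerInput bs dA dB out) bwInput
    bwIdeal .B (fun s x _ => by
      rw [List.length_append, bwInput, List.length_append, length_fwInput_B, bwIdeal,
        List.length_append, length_flat, length_flat, length_flat])
    bwSimB (fun C hC => PPT.bwSimB hC) hadv
  refine ⟨sim, h1, _, negligible_statErr (bs * out + 2 * (dA * out)) 0 hmask,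
    fun choose guess κ z => ?_⟩
  refine advantage_le_of_close (κ := κ) (maskCoins dA out (s κ)) bwIdeal
    (fun x => matMulBwFunctionality_eq (s κ) x) (bwSimB (s κ)) (fun x θ => h2 κ z (s κ) x θ)
    (fun k hk l => ?_) choose guess
  obtain ⟨_, _, _, _, hv⟩ := parseInput_valid (bs := bs) (dA := dA) (dB := dB) (out := out)
    (b κ) k l
  exact bwSimB_close hv (hgood κ _ (mem_support_keySetup hk).2)

end Statistical

/-! ### Computational indistinguishability of many samples -/

section Product

variable {Δ Δ' : Type}

/-- The independent product. -/
noncomputable def prodPMF (P : PaillierKey → PMF Δ) (P' : PaillierKey → PMF Δ') (k : PaillierKey) :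
    PMF (Δ × Δ') :=
  (P k).bind fun y => (P' k).map fun y' => (y, y')

theorem sampleVec_succ_eq (n : ℕ) (P : PaillierKey → PMF Δ) :
    (fun k => sampleVec (n + 1) fun _ => P k) =
      fun k => (prodPMF P (fun k => sampleVec n fun _ => P k) k).map
        fun y => (Fin.cons y.1 y.2 : Fin (n + 1) → Δ) := by
  funext k
  rw [prodPMF, PMF.map_bind, sampleVec]
  congr 1
  funext y
  rw [PMF.map_comp]
  rfl

end Product

section Indist

variable {gen : ℕ → PMF PaillierKey} {Δ Δ' : Type} [Enc Δ] [Enc Δ']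

/-- The decision that is encoded by a returned register. -/
def accept (l : List ℤ) : Bool := decide (l.getD 0 0 = 1)

theorem decision_eq (D : Prog) (κ : ℕ) (l : List ℤ) :
    D.decision κ l = (Alg.output ⟨D, 1⟩ κ l).map accept := by
  rw [Alg.output, PMF.map_comp]
  rfl

/-- A sampler of one-entry lists returns register `0`, the register by which a distinguisher
accepts. -/
theorem PPT.exists_decision {Γ : Type} {C : Ctx Γ} {F : Γ → PMF (List ℤ)} (hF : PPT C F)
    (h1 : ∀ γ, ∀ l ∈ (F γ).support, l.length = 1) : ∃ D : Prog, D.PolyTime ∧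
      ∀ γ, D.decision (C.κ γ) (C.vars γ) = (F γ).map accept := by
  obtain ⟨A, hA, hA'⟩ := hF
  refine ⟨A.code, hA, fun γ => ?_⟩
  obtain ⟨l, hl⟩ := (F γ).support_nonempty
  have hlen : A.outLen = 1 := by
    rw [← h1 γ l hl, length_output (by rw [hA' γ]; exact hl)]
  rw [← hA', decision_eq, ← hlen]

/-- The list given to a distinguisher. -/
def challenge (z : ℤ) (k : PaillierKey) (y : Δ) : List ℤ := z :: (k.N : ℤ) :: toList y

/-- Families of distributions that are computationally indistinguishable, given the modulus and
an auxiliary input. -/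
def Indist (gen : ℕ → PMF PaillierKey) (P Q : PaillierKey → PMF Δ) : Prop :=
  ∀ D : Prog, D.PolyTime → ∀ q : Polynomial ℕ, ∃ μ : ℕ → ℝ, Negligible μ ∧
    ∀ (κ : ℕ) (z : ℤ), bits z ≤ q.eval κ →
      advantage
        ((gen κ).bind fun k => (P k).bind fun y => D.decision κ (challenge z k y))
        ((gen κ).bind fun k => (Q k).bind fun y => D.decision κ (challenge z k y)) ≤ μ κ

/-- The distributions can be sampled, up to a negligible error, from the modulus. -/
def Samplable (gen : ℕ → PMF PaillierKey) (P : PaillierKey → PMF Δ) : Prop :=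
  ∃ S : ℕ → PMF Δ, (∀ {Γ : Type} (C : Ctx Γ) (N : Γ → ℕ), (PolyFun C fun γ => (N γ : ℤ)) →
      (∀ γ, 0 < N γ) → PPT C fun γ => (S (N γ)).map toList) ∧
    ∃ ε : ℕ → ℝ≥0, (Negligible fun κ => (ε κ : ℝ)) ∧
      ∀ κ, ∀ k ∈ (gen κ).support, Close (ε κ) (S k.N) (P k)

theorem Indist.trans {P Q R : PaillierKey → PMF Δ} (h : Indist gen P Q) (h' : Indist gen Q R) :
    Indist gen P R := by
  intro D hD q
  obtain ⟨μ, hμ, h1⟩ := h D hD q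
  obtain ⟨ν, hν, h2⟩ := h' D hD q
  exact ⟨_, hμ.add hν, fun κ z hz =>
    (advantage_triangle _ _ _).trans (add_le_add (h1 κ z hz) (h2 κ z hz))⟩

/-- Relabelling that respects the encoding. -/
theorem Indist.map {P Q : PaillierKey → PMF Δ} (h : Indist gen P Q) {g : Δ → Δ'}
    (hg : ∀ y, toList (g y) = toList y) :
    Indist gen (fun k => (P k).map g) fun k => (Q k).map g := by
  intro D hD q
  obtain ⟨μ, hμ, h1⟩ := h D hD q
  refine ⟨μ, hμ, fun κ z hz => ?_⟩
  simp only [PMF.bind_map, Function.comp_def, challenge, hg]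
  exact h1 κ z hz

theorem Samplable.map {P : PaillierKey → PMF Δ} (h : Samplable gen P) {g : Δ → Δ'}
    (hg : ∀ y, toList (g y) = toList y) : Samplable gen fun k => (P k).map g := by
  obtain ⟨S, h1, ε, hε, h2⟩ := h
  refine ⟨fun N => (S N).map g, fun C N hN h0 => ?_, ε, hε, fun κ k hk => (h2 κ k hk).map g⟩
  refine (h1 C N hN h0).congr fun γ => ?_
  rw [PMF.map_comp]
  congr 1
  funext y
  exact (hg y).symm

/-- A distinguisher may itself sample an additional input. -/
theorem Indist.extend {Ψ : Type} [Enc Ψ] {P Q : PaillierKey → PMF Δ} (h : Indist gen P Q)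
    {R : PaillierKey → PMF Δ'} (hR : Samplable gen R) (e : Δ → Δ' → Ψ)
    (he : ∀ {Γ : Type} (C : Ctx Γ) (y : Γ → Δ) (y' : Γ → Δ'), (DetList C fun γ => toList (y γ)) →
      (DetList C fun γ => toList (y' γ)) → DetList C fun γ => toList (e (y γ) (y' γ))) :
    Indist gen (fun k => (P k).bind fun y => (R k).map fun y' => e y y')
      fun k => (Q k).bind fun y => (R k).map fun y' => e y y' := by
  intro D hD q
  obtain ⟨S, hS, ε, hε, hclose⟩ := hR
  let C : Ctx (ℕ × ℤ × PaillierKey × Δ) :=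
    ⟨fun γ => γ.1, fun γ => challenge γ.2.1 γ.2.2.1 γ.2.2.2, Enc.len Δ + 2, fun γ => by
      simp [challenge, Enc.length_toList]⟩
  have hv : DetList C fun γ => challenge γ.2.1 γ.2.2.1 γ.2.2.2 := DetList.vars
  have hz : PolyFun C fun γ => γ.2.1 := hv.head
  have hN : PolyFun C fun γ => (γ.2.2.1.N : ℤ) := hv.tail.head
  have hy : DetList C fun γ => toList γ.2.2.2 := hv.tail.tail
  have hF : PPT C fun γ => (S γ.2.2.1.N).bind fun y' =>
      Alg.output ⟨D, 1⟩ γ.1 (challenge γ.2.1 γ.2.2.1 (e γ.2.2.2 y')) := by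
    refine PPT.bind (hS C _ hN fun γ => Nat.zero_lt_of_lt γ.2.2.1.one_lt_N) ?_
    exact (DetList.cons hz.weaken (DetList.cons hN.weaken
      (he _ _ _ hy.weaken DetList.last))).call (A := ⟨D, 1⟩) hD
  obtain ⟨D', hD', hdec⟩ := hF.exists_decision fun γ l hl => by
    rw [PMF.mem_support_bind_iff] at hl
    obtain ⟨_, -, hl⟩ := hl
    exact length_output hl
  obtain ⟨μ, hμ, hadv⟩ := h D' hD' q
  refine ⟨fun κ => ε κ + (μ κ + ε κ), hε.add (hμ.add hε), fun κ z hz => ?_⟩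
  -- Sampling the additional input with `S` instead of `R` costs `ε`, whatever the first component
  -- is; this is paid once for `P` and once for `Q`.
  have key : ∀ T : PaillierKey → PMF Δ, advantage
      ((gen κ).bind fun k => ((T k).bind fun y => (R k).map fun y' => e y y').bind fun w =>
        D.decision κ (challenge z k w))
      ((gen κ).bind fun k => (T k).bind fun y => D'.decision κ (challenge z k y)) ≤ ε κ := by
    intro T
    refine advantage_bind_le _ fun k hk => ?_
    rw [PMF.bind_bind]
    refine advantage_bind_le _ fun y _ => ?_
    refine Close.advantage_le (Close.symm ?_)
    have h3 := hdec (κ, z, k, y)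
    refine cast (congrArg₂ _ ?_ ?_) ((hclose κ k hk).bind_left fun y' =>
      D.decision κ (challenge z k (e y y')))
    · refine Eq.trans ?_ h3.symm
      rw [PMF.map_bind]
      congr 1
      funext y'
      exact decision_eq _ _ _
    · rw [PMF.bind_map]
      rfl
  refine (advantage_triangle _ _ _).trans (add_le_add (key P)
    ((advantage_triangle _ _ _).trans (add_le_add (hadv κ z hz) ?_)))
  rw [advantage_comm]
  exact key Q

/-- The hybrid `(Q, P')` lies between the two products. In either step the distinguisher has to
produce the unchanged factor itself: `P'` in the one, `Q` in the other. -/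
theorem Indist.prod {P Q : PaillierKey → PMF Δ} {P' Q' : PaillierKey → PMF Δ'}
    (h : Indist gen P Q) (h' : Indist gen P' Q') (hP' : Samplable gen P')
    (hQ : Samplable gen Q) : Indist gen (prodPMF P P') (prodPMF Q Q') := by
  have h1 : Indist gen (prodPMF P P') (prodPMF Q P') :=
    h.extend hP' Prod.mk fun C y y' hy hy' => hy.append hy'
  have h2 := h'.extend hQ (fun y' y => (y, y')) fun C y y' hy hy' => hy'.append hy
  refine h1.trans ?_
  have hswap : ∀ T : PaillierKey → PMF Δ',
      (fun k => (T k).bind fun y' => (Q k).map fun y => (y, y')) = prodPMF Q T :=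
    fun T => funext fun k => PMF.bind_comm _ _ _
  rwa [hswap, hswap] at h2

theorem Samplable.prod {P : PaillierKey → PMF Δ} {P' : PaillierKey → PMF Δ'}
    (h : Samplable gen P) (h' : Samplable gen P') : Samplable gen (prodPMF P P') := by
  obtain ⟨S, h1, ε, hε, h2⟩ := h
  obtain ⟨S', h1', ε', hε', h2'⟩ := h'
  refine ⟨fun N => (S N).bind fun y => (S' N).map fun y' => (y, y'), fun C N hN h0 => ?_,
    fun κ => ε κ + ε' κ, hε.add hε', fun κ k hk => (h2 κ k hk).bind fun y _ => (h2' κ k hk).map _⟩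
  have h3 : PPT C fun γ => (S (N γ)).bind fun y => (S' (N γ)).bind fun y' =>
      PMF.pure (toList (y, y')) :=
    PPT.bind (h1 C N hN h0) (PPT.bind (h1' _ _ hN.weaken fun p => h0 p.1)
      (DetList.append DetList.last.weaken DetList.last))
  refine h3.congr fun γ => ?_
  rw [PMF.map_bind]
  congr 1
  funext y
  rw [PMF.map_comp]
  rfl

theorem negligible_zero : Negligible fun _ => 0 := Asymptotics.superpolynomialDecay_zero _ _

theorem samplable_pure (d : Δ) (hd : toList d = []) : Samplable gen fun _ => PMF.pure d :=
  ⟨fun _ => PMF.pure d, fun C N _ _ => by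
      simp only [PMF.pure_map, hd]
      exact DetList.nil, fun _ => 0, negligible_zero, fun _ _ _ => Close.refl _⟩

theorem Indist.refl (P : PaillierKey → PMF Δ) : Indist gen P P := fun _ _ _ =>
  ⟨fun _ => 0, negligible_zero, fun _ _ _ => by simp [advantage]⟩

theorem Samplable.sampleVec {P : PaillierKey → PMF Δ} (h : Samplable gen P) :
    ∀ n, Samplable gen fun k => sampleVec n fun _ => P k
  | 0 => samplable_pure _ rfl
  | n + 1 => by
    rw [sampleVec_succ_eq]
    exact (h.prod (h.sampleVec n)).map fun y => toList_cons _ _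

/-- As `n` does not depend on `κ`, finitely many negligible errors are added. -/
theorem Indist.sampleVec {P Q : PaillierKey → PMF Δ} (h : Indist gen P Q) (hP : Samplable gen P)
    (hQ : Samplable gen Q) :
    ∀ n, Indist gen (fun k => sampleVec n fun _ => P k) fun k => sampleVec n fun _ => Q k
  | 0 => Indist.refl _
  | n + 1 => by
    rw [sampleVec_succ_eq, sampleVec_succ_eq]
    exact (h.prod (h.sampleVec hP hQ n) (hP.sampleVec n) hQ).map fun y => toList_cons _ _

theorem Samplable.sampleMat {P : PaillierKey → PMF Δ} (h : Samplable gen P) (m n : ℕ) :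
    Samplable gen fun k => sampleMat m n fun _ _ => P k :=
  ((h.sampleVec n).sampleVec m).map (g := Matrix.of) fun _ => rfl

theorem Indist.sampleMat {P Q : PaillierKey → PMF Δ} (h : Indist gen P Q) (hP : Samplable gen P)
    (hQ : Samplable gen Q) (m n : ℕ) :
    Indist gen (fun k => sampleMat m n fun _ _ => P k) fun k => sampleMat m n fun _ _ => Q k :=
  ((h.sampleVec hP hQ n).sampleVec (hP.sampleVec n) (hQ.sampleVec n) m).map (g := Matrix.of)
    fun _ => rfl

end Indist

/-! ### The residuosity assumption for matrices of samples. -/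

section DCR

variable {gen : ℕ → PMF PaillierKey}

/-- A uniform unit modulo `N ^ 2`. -/
noncomputable def unitSq (k : PaillierKey) : PMF ℕ :=
  PMF.uniformOfFinset (unitReps (k.N ^ 2))
    (unitReps_nonempty (Nat.one_lt_pow two_ne_zero k.one_lt_N))

/-- A uniform `N`-th residue modulo `N ^ 2`. -/
noncomputable def residue (k : PaillierKey) : PMF ℕ := (unitSq k).map fun r => r ^ k.N % k.N ^ 2

theorem DCRAssumption.indist (h : DCRAssumption gen) : Indist gen residue unitSq := by
  intro D hD q
  obtain ⟨μ, hμ, h1⟩ := h D hD q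
  refine ⟨μ, hμ, fun κ z hz => ?_⟩
  simp only [residue, PMF.bind_map]
  exact h1 κ z hz

theorem negligible_unit_error : Negligible fun κ => (((6 / 2 ^ κ : ℝ≥0)) : ℝ) := by
  refine (negligible_two_pow.const_mul 6).congr fun κ => ?_
  push_cast
  ring

theorem samplable_unitSq (hgen : ∀ κ, ∀ k ∈ (gen κ).support, κ ≤ k.p.size ∧ κ ≤ k.q.size) :
    Samplable gen unitSq :=
  ⟨fun N => approxUnit (N ^ 2), fun C N hN _ => PPT.approxUnit (n := fun γ => N γ ^ 2)
      ((hN.mul hN).congr fun γ => by push_cast; ring), _, negligible_unit_error,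
    fun κ k hk => (close_approxUnit_N k (hgen κ k hk).1 (hgen κ k hk).2).2⟩

theorem samplable_residue (hgen : ∀ κ, ∀ k ∈ (gen κ).support, κ ≤ k.p.size ∧ κ ≤ k.q.size) :
    Samplable gen residue := by
  refine ⟨fun N => (approxUnit (N ^ 2)).map fun r => r ^ N % N ^ 2, fun C N hN h0 => ?_, _,
    negligible_unit_error,
    fun κ k hk => (close_approxUnit_N k (hgen κ k hk).1 (hgen κ k hk).2).2.map _⟩
  refine PPT.mapEnc (g := fun γ r => r ^ N γ % N γ ^ 2) (PPT.approxUnit (n := fun γ => N γ ^ 2)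
    ((hN.mul hN).congr fun γ => by push_cast; ring)) ?_
  have hr : PolyFun (C.ext ℕ) fun p => (p.2 : ℤ) := DetList.last
  exact PolyFun.powSelf hN.weaken hr fun p => h0 p.1

/-- The assumption for two independent matrices of samples. -/
theorem DCRAssumption.indist_matrices (h : DCRAssumption gen)
    (hgen : ∀ κ, ∀ k ∈ (gen κ).support, κ ≤ k.p.size ∧ κ ≤ k.q.size) (m n m' n' : ℕ) :
    Indist gen
      (prodPMF (fun k => sampleMat m n fun _ _ => residue k)
        fun k => sampleMat m' n' fun _ _ => residue k)
      (prodPMF (fun k => sampleMat m n fun _ _ => unitSq k)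
        fun k => sampleMat m' n' fun _ _ => unitSq k) := by
  have hr := samplable_residue hgen
  have hu := samplable_unitSq hgen
  exact (h.indist.sampleMat hr hu m n).prod (h.indist.sampleMat hr hu m' n') (hr.sampleMat m' n')
    (hu.sampleMat m n)

end DCR

/-! ### The view of `A` in the backward propagation -/

section Game

variable {bs dA dB out : ℕ}

/-- Entrywise blinding of a matrix of plaintexts. -/
def blindMat {m n : ℕ} (N : ℕ) (M : Matrix (Fin m) (Fin n) ℤ) (y : Matrix (Fin m) (Fin n) ℕ) :
    Matrix (Fin m) (Fin n) ℕ :=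
  Matrix.of fun i j => blind N (M i j) (y i j)

/-- Blinding by residues is genuine encryption, since `r ^ N` has the same distribution for units
modulo `N ^ 2` and modulo `N`. -/
theorem residue_map_blindMat {m n : ℕ} (k : PaillierKey) (M : Matrix (Fin m) (Fin n) ℤ) :
    (sampleMat m n fun _ _ => residue k).map (blindMat k.N M) =
      (encCoins m n k).map (encMat k.N M) := by
  have h1 := sampleMat_map (fun (_ : Fin m) (_ : Fin n) => residue k) fun i j => blind k.N (M i j)
  have h2 := sampleMat_map (fun (_ : Fin m) (_ : Fin n) =>
    PMF.uniformOfFinset (unitReps k.N) (unitReps_nonempty k.one_lt_N)) fun i j => enc k.N (M i j)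
  rw [encCoins, uniformMat_eq_sampleMat]
  refine h1.trans (Eq.trans ?_ h2.symm)
  congr 1
  funext i j
  rw [residue, unitSq, uniform_unitReps_sq_map_pow, PMF.map_comp]
  congr 1
  funext r
  exact (enc_eq_blind (Nat.zero_lt_of_lt k.one_lt_N) _ _).symm

theorem unitSq_map_blindMat {m n : ℕ} (k : PaillierKey) (M : Matrix (Fin m) (Fin n) ℤ) :
    (sampleMat m n fun _ _ => unitSq k).map (blindMat k.N M) =
      sampleMat m n fun _ _ => unitSq k := by
  refine (sampleMat_map (fun (_ : Fin m) (_ : Fin n) => unitSq k)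
    fun i j => blind k.N (M i j)).trans ?_
  congr 1
  funext i j
  exact uniform_unitReps_blind k _

/-- The view of `A` with the messages `m₁`, `m₃` from `B`, and the outputs of both parties. -/
def bwTriple (s : ℕ) (x : LayerInput bs dA dB out) (φ : Matrix (Fin dA) (Fin out) ℤ)
    (r : Matrix (Fin dA) (Fin out) ℕ) (m₁ : Matrix (Fin bs) (Fin out) ℕ)
    (m₃ : Matrix (Fin dA) (Fin out) ℕ) : List ℤ × List ℤ × List ℤ :=
  (bwInput s .A x ++ flat φ ++ flatNat r ++ flatNat m₁ ++ flatNat m₃,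
    bwIdeal x φ .A, bwIdeal x φ .B)

/-- The backward propagation as seen by `A`, with plaintexts multiplied by `c` and blinded by the
entries of `y`. -/
noncomputable def bwGame (c : ℤ) (s : ℕ) (x : LayerInput bs dA dB out)
    (y : Matrix (Fin bs) (Fin out) ℕ × Matrix (Fin dA) (Fin out) ℕ) :
    PMF (List ℤ × List ℤ × List ℤ) :=
  (maskCoins dA out s).bind fun φ =>
  (approxCoins dA out x.keyB.N).map fun r =>
    bwTriple s x φ r (blindMat x.keyB.N (c • x.dZ) y.1)
      (blindMat x.keyB.N (c • (x.a.X.transpose * x.dZ - φ)) y.2)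

/-- The blinding matrices are independent of `φ` and `r` and may be drawn after them. Then each is
blinded by a plaintext that is already fixed, although the second plaintext involves `φ`. -/
theorem prodPMF_bind_bwGame (c : ℤ) (s : ℕ) (x : LayerInput bs dA dB out)
    (Y : PaillierKey → PMF (Matrix (Fin bs) (Fin out) ℕ))
    (Y' : PaillierKey → PMF (Matrix (Fin dA) (Fin out) ℕ)) :
    (prodPMF Y Y' x.keyB).bind (bwGame c s x) =
      (maskCoins dA out s).bind fun φ =>
      (approxCoins dA out x.keyB.N).bind fun r =>
      ((Y x.keyB).map (blindMat x.keyB.N (c • x.dZ))).bind fun m₁ =>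
      ((Y' x.keyB).map (blindMat x.keyB.N (c • (x.a.X.transpose * x.dZ - φ)))).map fun m₃ =>
        bwTriple s x φ r m₁ m₃ := by
  refine (PMF.bind_comm (prodPMF Y Y' x.keyB) (maskCoins dA out s) _).trans
    (congrArg _ (funext fun φ => ?_))
  refine (PMF.bind_comm (prodPMF Y Y' x.keyB) (approxCoins dA out x.keyB.N) _).trans
    (congrArg _ (funext fun r => ?_))
  rw [prodPMF, PMF.bind_bind, PMF.bind_map]
  refine congrArg _ (funext fun y => ?_)
  rw [PMF.bind_map, Function.comp_apply, PMF.map_comp]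
  rfl

/-- For `c = 1` the blinded matrices are the real ciphertexts. The only discrepancy is in the coins
`r` of `A`, which are approximate in the game so that a reduction can sample them. -/
theorem bwProtocol_close {b s κ : ℕ} {x : LayerInput bs dA dB out} {VA ρA VB ρB}
    (hx : x.Valid b VA ρA VB ρB) (hB : GoodKey bs dA dB b s κ x.keyB) :
    Close (statErr (dA * out) 0 b s κ)
      ((matMulBwProtocol s x).map fun e => (e.view .A, e.out .A, e.out .B))
      ((prodPMF (fun k => sampleMat bs out fun _ _ => residue k)
        (fun k => sampleMat dA out fun _ _ => residue k) x.keyB).bind (bwGame 1 s x)) := by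
  have hreal : (matMulBwProtocol s x).map (fun e => (e.view .A, e.out .A, e.out .B)) =
      (maskCoins dA out s).bind fun φ =>
      (encCoins dA out x.keyB).bind fun r =>
      (encCoins bs out x.keyB).bind fun t =>
      (encCoins dA out x.keyB).map fun u =>
        bwTriple s x φ r (encMat x.keyB.N x.dZ t)
          (encMat x.keyB.N (x.a.X.transpose * x.dZ - φ) u) := by
    rw [matMulBwProtocol_eq hx hB fun v o => (v .A, o .A, o .B), PMF.bind_comm]
    refine congrArg _ (funext fun φ => ?_)
    rw [PMF.bind_comm]
    rfl
  rw [hreal, prodPMF_bind_bwGame]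
  simp only [residue_map_blindMat, one_smul, PMF.bind_map, PMF.map_comp]
  refine Close.mono (Close.bind_right _ fun φ _ =>
    (close_approxCoins x.keyB hB.size_p hB.size_q _ _).symm.bind_left _) (le_of_eq ?_)
  rw [statErr]
  push_cast
  ring

/-- For `c = 0` the game shows encryptions of zero with exact randomness; the simulator uses
approximate randomness for both messages. -/
theorem bwSimA_close {b s κ : ℕ} {x : LayerInput bs dA dB out}
    (hB : GoodKey bs dA dB b s κ x.keyB) :
    Close (statErr (bs * out + dA * out) 0 b s κ)
      ((prodPMF (fun k => sampleMat bs out fun _ _ => residue k)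
        (fun k => sampleMat dA out fun _ _ => residue k) x.keyB).bind (bwGame 0 s x))
      ((maskCoins dA out s).bind fun φ => (bwSimA s x φ).map
        fun v => (v, bwIdeal x φ .A, bwIdeal x φ .B)) := by
  rw [prodPMF_bind_bwGame]
  simp only [residue_map_blindMat, zero_smul, bwSimA, PMF.map_bind, PMF.bind_map, PMF.map_comp]
  refine Close.mono (Close.bind_right _ fun φ _ => Close.bind_right _ fun r _ =>
    (close_approxCoins x.keyB hB.size_p hB.size_q _ _).symm.bind fun t _ =>
    (close_approxCoins x.keyB hB.size_p hB.size_q _ _).symm.map _) (le_of_eq ?_)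
  rw [statErr]
  push_cast
  ring

/-- Uniform units hide the plaintexts. -/
theorem unitSq_bind_bwGame (c c' : ℤ) (s : ℕ) (x : LayerInput bs dA dB out) :
    (prodPMF (fun k => sampleMat bs out fun _ _ => unitSq k)
      (fun k => sampleMat dA out fun _ _ => unitSq k) x.keyB).bind (bwGame c s x) =
    (prodPMF (fun k => sampleMat bs out fun _ _ => unitSq k)
      (fun k => sampleMat dA out fun _ _ => unitSq k) x.keyB).bind (bwGame c' s x) := by
  simp only [prodPMF_bind_bwGame, unitSq_map_blindMat]

end Game

/-! ### The reduction -/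

section Reduction

variable {bs dA dB out : ℕ} {Γ : Type} {C : Ctx Γ}

theorem toList_getD {n : ℕ} {l : List ℤ} (h : l.length = n) :
    toList (fun i : Fin n => l.getD i 0) = l := by
  subst h
  rw [toList_fin]
  simp only [toList_int, ← List.map_eq_flatMap]
  apply List.ext_getElem <;> simp

/-- A sampled list may be used in further computations. -/
theorem PPT.bindList {F : Γ → PMF (List ℤ)} {G : Γ → List ℤ → PMF (List ℤ)} {n : ℕ}
    (hn : ∀ γ, ∀ l ∈ (F γ).support, l.length = n) (hF : PPT C F)
    (hG : PPT (C.ext (Fin n → ℤ)) fun p => G p.1 (toList p.2)) :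
    PPT C fun γ => (F γ).bind (G γ) := by
  have h : ∀ γ, ((F γ).map fun l (i : Fin n) => l.getD i 0).map toList = F γ := fun γ => by
    rw [PMF.map_comp]
    conv_rhs => rw [← PMF.map_id (F γ)]
    exact map_congr_support fun l hl => toList_getD (hn γ l hl)
  refine (PPT.bind (F := fun γ => (F γ).map fun l (i : Fin n) => l.getD i 0)
    (G := fun γ v => G γ (toList v)) (hF.congr fun γ => (h γ).symm) hG).congr fun γ => ?_
  conv_rhs => rw [← h γ, PMF.bind_map]
  rfl

/-- What has to be known of the inputs for the simulation of `bwGame`. -/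
structure KnownLayer (C : Ctx Γ) (s : Γ → ℕ) (x : Γ → LayerInput bs dA dB out) : Prop where
  range : PolyFun C fun γ => 2 ^ s γ
  modulus : PolyFun C fun γ => ((x γ).keyB.N : ℤ)
  input : DetList C fun γ => bwInput (s γ) .A (x γ)
  dZ : ∀ i j, PolyFun C fun γ => (x γ).dZ i j
  gradA : ∀ i j, PolyFun C fun γ => ((x γ).a.X.transpose * (x γ).dZ) i j
  gradB : DetList C fun γ => flat ((x γ).b.X.transpose * (x γ).dZ)

theorem DetList.blindMat {m n : ℕ} {N : Γ → ℕ} {M : Γ → Matrix (Fin m) (Fin n) ℤ}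
    {y : Γ → Matrix (Fin m) (Fin n) ℕ} (hN : PolyFun C fun γ => (N γ : ℤ))
    (hM : ∀ i j, PolyFun C fun γ => M γ i j) (hy : ∀ i j, PolyFun C fun γ => (y γ i j : ℤ))
    (h0 : ∀ γ, 0 < N γ) : DetList C fun γ => MatMulSource.flatNat (blindMat (N γ) (M γ) (y γ)) :=
  DetList.flatNat fun i j => PolyFun.blind hN (hM i j) (hy i j) h0

/-- Given blinding matrices, the rest of the experiment can be played: the view of `A`, the
adversary, the ideal outputs of both parties and the final guess. -/
theorem KnownLayer.bwGame {s : Γ → ℕ} {x : Γ → LayerInput bs dA dB out} (h : KnownLayer C s x)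
    (c : ℤ) {y : Γ → Matrix (Fin bs) (Fin out) ℕ × Matrix (Fin dA) (Fin out) ℕ}
    (hy : DetList C fun γ => toList (y γ)) {z : Γ → ℤ} (hz : PolyFun C z) {L : Γ → List ℤ}
    (hL : DetList C L) {adv : Alg} (hadv : adv.code.PolyTime) {guess : Prog}
    (hguess : guess.PolyTime) :
    PPT C fun γ => (bwGame c (s γ) (x γ) (y γ)).bind fun e =>
      (adv.output (C.κ γ) (z γ :: e.1)).bind fun a =>
        Alg.output ⟨guess, 1⟩ (C.κ γ) (z γ :: (L γ ++ a ++ e.2.1 ++ e.2.2)) := by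
  have h0 : ∀ γ, 0 < (x γ).keyB.N := fun γ => Nat.zero_lt_of_lt (x γ).keyB.one_lt_N
  have hy1 : ∀ i j, PolyFun C fun γ => ((y γ).1 i j : ℤ) :=
    DetList.flatNat_apply (M := fun γ => (y γ).1)
      ((DetList.left hy fun γ => Enc.length_toList _).congr fun γ => toList_matNat _)
  have hy2 : ∀ i j, PolyFun C fun γ => ((y γ).2 i j : ℤ) :=
    DetList.flatNat_apply (M := fun γ => (y γ).2)
      ((DetList.right hy fun γ => Enc.length_toList _).congr fun γ => toList_matNat _)
  have key : PPT C fun γ => (MatMulSource.maskCoins dA out (s γ)).bind fun φ =>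
      (MatMulSource.approxCoins dA out (x γ).keyB.N).bind fun r =>
      (adv.output (C.κ γ) (z γ :: (bwTriple (s γ) (x γ) φ r
        (MatMulSource.blindMat (x γ).keyB.N (c • (x γ).dZ) (y γ).1)
        (MatMulSource.blindMat (x γ).keyB.N (c • ((x γ).a.X.transpose * (x γ).dZ - φ))
          (y γ).2)).1)).bind fun a =>
        Alg.output ⟨guess, 1⟩ (C.κ γ) (z γ :: (L γ ++ a ++ flat φ ++
          (flat ((x γ).a.X.transpose * (x γ).dZ - φ) ++
            flat ((x γ).b.X.transpose * (x γ).dZ)))) := by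
    refine PPT.bind (PPT.maskCoins h.range dA out)
      (PPT.bind (PPT.approxCoins h.modulus.weaken dA out)
      (PPT.bindList (n := adv.outLen) (fun _ _ hl => length_output hl) (DetList.call ?_ hadv)
      (DetList.call (A := ⟨guess, 1⟩) ?_ hguess)))
    · refine DetList.cons hz.weaken.weaken (DetList.append (DetList.append (DetList.append
        (DetList.append h.input.weaken.weaken ?_) ?_) ?_) ?_)
      · exact DetList.weaken (DetList.flat fun i j => DetList.lastMat i j)
      · exact DetList.flatNat fun i j => DetList.lastMatNat i j
      · exact DetList.blindMat h.modulus.weaken.weaken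
          (fun i j => (PolyFun.const c).mul (h.dZ i j).weaken.weaken)
          (fun i j => (hy1 i j).weaken.weaken) fun p => h0 p.1.1
      · exact DetList.blindMat h.modulus.weaken.weaken
          (fun i j => (PolyFun.const c).mul
            ((h.gradA i j).weaken.weaken.sub (DetList.lastMat i j).weaken))
          (fun i j => (hy2 i j).weaken.weaken) fun p => h0 p.1.1
    · refine DetList.cons hz.weaken.weaken.weaken (DetList.append (DetList.append (DetList.append
        hL.weaken.weaken.weaken DetList.last) ?_) (DetList.append ?_ h.gradB.weaken.weaken.weaken))
      · exact DetList.weaken (DetList.weaken (DetList.flat fun i j => DetList.lastMat i j))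
      · exact DetList.flat fun i j => (h.gradA i j).weaken.weaken.weaken.sub
          (DetList.lastMat i j).weaken.weaken
  refine key.congr fun γ => ?_
  rw [MatMulSource.bwGame, PMF.bind_bind]
  refine congrArg _ (funext fun φ => ?_)
  rw [PMF.bind_map]
  rfl

theorem PolyFun.readMat {l : Γ → List ℤ} (hl : DetList C l) (off m n : ℕ) (i : Fin m) (j : Fin n) :
    PolyFun C fun γ => readMat (l γ) off m n i j :=
  hl.getD _

/-- A reduction that runs the environment sees the chosen inputs of both parties, including those of
`B`. Of the key of `B` only the modulus enters, so the secret factors of the challenge are not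
needed. -/
theorem knownLayer_parseInput {b s : Γ → ℕ} {k : Γ → PaillierKey × PaillierKey} {l : Γ → List ℤ}
    (hb : PolyFun C fun γ => 2 ^ b γ)
    (hk : DetList C fun γ => knownKeys (s γ) .A (k γ)) (hl : DetList C l) :
    KnownLayer C s fun γ => parseInput bs dA dB out (b γ) (k γ) (l γ) := by
  have hN : PolyFun C fun γ => ((k γ).2.N : ℤ) := hk.tail.tail.tail.head
  have h0 : ∀ γ, 0 < (k γ).2.N := fun γ => Nat.zero_lt_of_lt (k γ).2.one_lt_N
  have hXA : ∀ i j, PolyFun C fun γ => (parseInput bs dA dB out (b γ) (k γ) (l γ)).a.X i j :=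
    fun i j => PolyFun.clamp hb (PolyFun.readMat hl _ _ _ i j)
  have hXB : ∀ i j, PolyFun C fun γ => (parseInput bs dA dB out (b γ) (k γ) (l γ)).b.X i j :=
    fun i j => PolyFun.clamp hb (PolyFun.readMat hl _ _ _ i j)
  have hdZ : ∀ i j, PolyFun C fun γ => (parseInput bs dA dB out (b γ) (k γ) (l γ)).dZ i j :=
    fun i j => PolyFun.clamp hb (PolyFun.readMat hl _ _ _ i j)
  refine ⟨hk.head, hN, ?_, hdZ, PolyFun.mulApply (fun i j => hXA j i) hdZ,
    DetList.flat (PolyFun.mulApply (fun i j => hXB j i) hdZ)⟩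
  have hD : DetList C fun γ => (parseInput bs dA dB out (b γ) (k γ) (l γ)).a.toList :=
    DetList.append (DetList.append (DetList.flat hXA)
      (DetList.flat fun i j => PolyFun.readMat hl _ _ _ i j))
      (DetList.encMat hN (fun i j => PolyFun.clamp hb (PolyFun.readMat hl _ _ _ i j))
        (fun i j => PolyFun.toUnit hN (PolyFun.readMat hl _ _ _ i j) h0) h0)
  refine (hk.append hD).congr fun γ => ?_
  rw [bwInput, List.append_nil]
  rfl

/-- The whole experiment with the backward propagation as seen by `A`. -/
noncomputable def bwPlay (bs dA dB out : ℕ) (adv choose : Alg) (guess : Prog) (c : ℤ) (b s κ : ℕ)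
    (z : ℤ) (k : PaillierKey × PaillierKey)
    (y : Matrix (Fin bs) (Fin out) ℕ × Matrix (Fin dA) (Fin out) ℕ) : PMF Bool :=
  (choose.output κ (z :: knownKeys s .A k)).bind fun l =>
  (bwGame c s (parseInput bs dA dB out b k l) y).bind fun e =>
  (adv.output κ (z :: e.1)).bind fun a =>
  guess.decision κ (z :: (knownKeys s .A k ++ l ++ a ++ e.2.1 ++ e.2.2))

theorem exists_bwPlay_decision {adv choose : Alg} {guess : Prog} (hadv : adv.code.PolyTime)
    (hchoose : choose.code.PolyTime) (hguess : guess.PolyTime) (c : ℤ) {b s : Γ → ℕ} {z : Γ → ℤ}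
    {k : Γ → PaillierKey × PaillierKey}
    {y : Γ → Matrix (Fin bs) (Fin out) ℕ × Matrix (Fin dA) (Fin out) ℕ}
    (hz : PolyFun C z) (hb : PolyFun C fun γ => 2 ^ b γ)
    (hk : DetList C fun γ => knownKeys (s γ) .A (k γ)) (hy : DetList C fun γ => toList (y γ)) :
    ∃ D : Prog, D.PolyTime ∧ ∀ γ, D.decision (C.κ γ) (C.vars γ) =
      bwPlay bs dA dB out adv choose guess c (b γ) (s γ) (C.κ γ) (z γ) (k γ) (y γ) := by
  have hl : DetList (C.ext (Fin choose.outLen → ℤ)) fun p => toList p.2 := DetList.last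
  have h := PPT.bindList (n := choose.outLen) (fun _ _ hl => length_output hl)
    ((DetList.cons hz hk).call hchoose)
    (G := fun γ l => (bwGame c (s γ) (parseInput bs dA dB out (b γ) (k γ) l) (y γ)).bind fun e =>
      (adv.output (C.κ γ) (z γ :: e.1)).bind fun a => Alg.output ⟨guess, 1⟩ (C.κ γ)
        (z γ :: (knownKeys (s γ) .A (k γ) ++ l ++ a ++ e.2.1 ++ e.2.2)))
    ((knownLayer_parseInput hb.weaken hk.weaken hl).bwGame c hy.weaken hz.weaken
      (hk.weaken.append hl) hadv hguess)
  obtain ⟨D, hD, hdec⟩ := h.exists_decision fun γ l hl => by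
    simp only [PMF.mem_support_bind_iff] at hl
    obtain ⟨_, -, _, -, _, -, hl⟩ := hl
    exact length_output hl
  refine ⟨D, hD, fun γ => (hdec γ).trans ?_⟩
  simp only [PMF.map_bind, bwPlay, decision_eq]

/-! #### Auxiliary input -/

/-- A number `z` followed by four digits in base `B`. -/
def pack (B z d₁ d₂ d₃ d₄ : ℤ) : ℤ := (((z * B + d₁) * B + d₂) * B + d₃) * B + d₄

/-- Euclidean division separates the last digit from the rest, also when the leading number is
negative. -/
theorem PolyFun.unpack {B w d : Γ → ℤ} (h : PolyFun C fun γ => w γ * B γ + d γ)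
    (hB : PolyFun C B) (hd : ∀ γ, 0 ≤ d γ ∧ d γ < B γ) : PolyFun C w ∧ PolyFun C d := by
  refine ⟨(h.div hB).congr fun γ => ?_, (h.mod hB).congr fun γ => ?_⟩
  · have hB' : 0 < B γ := (hd γ).1.trans_lt (hd γ).2
    rw [add_comm, Int.add_mul_ediv_right _ _ hB'.ne', Int.ediv_eq_zero_of_lt (hd γ).1 (hd γ).2,
      zero_add]
  · rw [add_comm, Int.add_mul_emod_self_right, Int.emod_eq_of_lt (hd γ).1 (hd γ).2]

theorem bits_digit_le {B w d : ℤ} (hd : 0 ≤ d ∧ d < B) :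
    bits (w * B + d) ≤ bits w + bits B + 1 := by
  have h1 := bits_add_le (w * B) d
  have h2 := bits_mul_le w B
  have h3 : bits d ≤ bits B := bits_mono (by omega)
  omega

theorem bits_pack_le {B z d₁ d₂ d₃ d₄ : ℤ} (h₁ : 0 ≤ d₁ ∧ d₁ < B) (h₂ : 0 ≤ d₂ ∧ d₂ < B)
    (h₃ : 0 ≤ d₃ ∧ d₃ < B) (h₄ : 0 ≤ d₄ ∧ d₄ < B) :
    bits (pack B z d₁ d₂ d₃ d₄) ≤ bits z + 4 * (bits B + 1) := by
  have e1 := bits_digit_le (w := z) h₁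
  have e2 := bits_digit_le (w := z * B + d₁) h₂
  have e3 := bits_digit_le (w := (z * B + d₁) * B + d₂) h₃
  have e4 := bits_digit_le (w := ((z * B + d₁) * B + d₂) * B + d₃) h₄
  rw [pack]
  omega

/-- If `β = 2 ^ (κ + 2) ^ c`, then `β ^ κ * β * β` has exponent `(κ + 2) ^ (c + 1)`. So the base of
the digits is computed from `κ` and need not be transmitted. -/
theorem PolyFun.base (c : ℕ) : PolyFun C fun γ => 2 ^ (C.κ γ + 2) ^ c := by
  induction c with
  | zero => exact (PolyFun.const 2).congr fun γ => by simp
  | succ c ih =>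
    refine ((ih.powKappa.mul ih).mul ih).congr fun γ => ?_
    rw [← pow_succ, ← pow_succ, ← pow_mul, pow_succ (C.κ γ + 2)]

/-- Since `κ + 2 ≥ 2`, coefficients and sums are absorbed by larger exponents. This brings a length
bound into the form required by `PolyFun.base`. -/
theorem eval_le_pow (p : Polynomial ℕ) : ∃ c, ∀ κ : ℕ, p.eval κ ≤ (κ + 2) ^ c := by
  induction p using Polynomial.induction_on' with
  | add p q hp hq =>
    obtain ⟨c, hc⟩ := hp
    obtain ⟨d, hd⟩ := hq
    refine ⟨max c d + 1, fun κ => ?_⟩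
    have h1 : (κ + 2) ^ c ≤ (κ + 2) ^ max c d := Nat.pow_le_pow_right (by omega) (le_max_left _ _)
    have h2 : (κ + 2) ^ d ≤ (κ + 2) ^ max c d := Nat.pow_le_pow_right (by omega) (le_max_right _ _)
    rw [Polynomial.eval_add, pow_succ]
    nlinarith [hc κ, hd κ]
  | monomial n a =>
    refine ⟨a + n, fun κ => ?_⟩
    rw [Polynomial.eval_monomial, pow_add]
    refine Nat.mul_le_mul ?_ (Nat.pow_le_pow_left (by omega) _)
    exact (Nat.lt_two_pow_self).le.trans (Nat.pow_le_pow_left (by omega) _)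

/-- The digits in the auxiliary input of the reduction. -/
def Fits (B : ℕ) (b s : ℕ) (k : PaillierKey) : Prop :=
  k.p < B ∧ k.q < B ∧ 2 ^ s < B ∧ 2 ^ b < B

/-- The auxiliary input of the reduction: the one of the experiment, the secret key of `A` and the
public parameters. -/
def advice (B : ℕ) (b s : ℕ) (k : PaillierKey) (z : ℤ) : ℤ := pack B z k.p k.q (2 ^ s) (2 ^ b)

theorem bits_advice_le {c b s κ : ℕ} {k : PaillierKey} (h : Fits (2 ^ (κ + 2) ^ c) b s k) (z : ℤ) :
    bits (advice (2 ^ (κ + 2) ^ c) b s k z) ≤ bits z + 4 * ((κ + 2) ^ c + 2) := by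
  obtain ⟨h1, h2, h3, h4⟩ := h
  refine (bits_pack_le ⟨by positivity, by exact_mod_cast h1⟩ ⟨by positivity, by exact_mod_cast h2⟩
    ⟨by positivity, by exact_mod_cast h3⟩ ⟨by positivity, by exact_mod_cast h4⟩).trans ?_
  have : bits ((2 ^ (κ + 2) ^ c : ℕ) : ℤ) ≤ (κ + 2) ^ c + 1 := by
    rw [bits_le_iff, Int.natAbs_natCast]
    exact Nat.pow_lt_pow_right (by omega) (by omega)
  omega

/-- A distinguisher of blinding matrices that plays the experiment. -/
theorem exists_reduction {adv choose : Alg} {guess : Prog} (hadv : adv.code.PolyTime)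
    (hchoose : choose.code.PolyTime) (hguess : guess.PolyTime) (c : ℤ) (e : ℕ) (b s : ℕ → ℕ) :
    ∃ D : Prog, D.PolyTime ∧ ∀ (κ : ℕ) (z : ℤ) (kA kB : PaillierKey)
      (y : Matrix (Fin bs) (Fin out) ℕ × Matrix (Fin dA) (Fin out) ℕ),
      Fits (2 ^ (κ + 2) ^ e) (b κ) (s κ) kA →
      D.decision κ (challenge (advice (2 ^ (κ + 2) ^ e) (b κ) (s κ) kA z) kB y) =
        bwPlay bs dA dB out adv choose guess c (b κ) (s κ) κ z (kA, kB) y := by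
  -- Digits are recovered correctly only if they are smaller than the base, so the context is
  -- restricted to fitting keys.
  let Γ := {γ : ℕ × ℤ × PaillierKey × PaillierKey ×
    (Matrix (Fin bs) (Fin out) ℕ × Matrix (Fin dA) (Fin out) ℕ) //
      Fits (2 ^ (γ.1 + 2) ^ e) (b γ.1) (s γ.1) γ.2.2.1}
  let C : Ctx Γ := ⟨fun γ => γ.1.1, fun γ => challenge (advice (2 ^ (γ.1.1 + 2) ^ e) (b γ.1.1)
    (s γ.1.1) γ.1.2.2.1 γ.1.2.1) γ.1.2.2.2.1 γ.1.2.2.2.2, _, fun γ => by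
      rw [challenge, List.length_cons, List.length_cons, Enc.length_toList]⟩
  have hv : DetList C fun γ => challenge (advice (2 ^ (γ.1.1 + 2) ^ e) (b γ.1.1)
    (s γ.1.1) γ.1.2.2.1 γ.1.2.1) γ.1.2.2.2.1 γ.1.2.2.2.2 := DetList.vars
  have hB : PolyFun C fun γ => ((2 ^ (γ.1.1 + 2) ^ e : ℕ) : ℤ) :=
    (PolyFun.base e).congr fun γ => by push_cast; rfl
  -- The digits come off from the last to the first: `2 ^ b`, `2 ^ s`, `q`, `p`; what remains is
  -- `z`.
  have h4 := PolyFun.unpack (d := fun γ : Γ => 2 ^ b γ.1.1) hv.head hB fun γ =>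
    ⟨by positivity, by exact_mod_cast γ.2.2.2.2⟩
  have h3 := PolyFun.unpack (d := fun γ : Γ => 2 ^ s γ.1.1) h4.1 hB fun γ =>
    ⟨by positivity, by exact_mod_cast γ.2.2.2.1⟩
  have h2 := PolyFun.unpack (d := fun γ : Γ => (γ.1.2.2.1.q : ℤ)) h3.1 hB fun γ =>
    ⟨by positivity, by exact_mod_cast γ.2.2.1⟩
  have h1 := PolyFun.unpack (d := fun γ : Γ => (γ.1.2.2.1.p : ℤ)) h2.1 hB fun γ =>
    ⟨by positivity, by exact_mod_cast γ.2.1⟩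
  have hk : DetList C fun γ => knownKeys (s γ.1.1) .A (γ.1.2.2.1, γ.1.2.2.2.1) :=
    DetList.cons h3.2 (DetList.triple h1.2 h2.2 hv.tail.head)
  obtain ⟨D, hD, hdec⟩ := exists_bwPlay_decision (dB := dB) hadv hchoose hguess c
    (b := fun γ : Γ => b γ.1.1) (y := fun γ : Γ => γ.1.2.2.2.2) h1.1 h4.2 hk hv.tail.tail
  exact ⟨D, hD, fun κ z kA kB y hfit => hdec ⟨(κ, z, kA, kB, y), hfit⟩⟩

end Reduction

/-! ### The chain of hybrids for `A` and the security of the backward propagation. -/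

section Secure

variable {bs dA dB out : ℕ} {gen : ℕ → PMF PaillierKey} {b s : ℕ → ℕ}

theorem advantage_bind_le_real {α : Type} (P : PMF α) {g g' : α → PMF Bool} {ε : ℝ}
    (h : ∀ a ∈ P.support, advantage (g a) (g' a) ≤ ε) : advantage (P.bind g) (P.bind g') ≤ ε := by
  obtain ⟨a, ha⟩ := P.support_nonempty
  exact advantage_bind_le P (ε := ⟨ε, (advantage_nonneg _ _).trans (h a ha)⟩) h

/-- The experiment with blinding matrices from the distributions `Y`. -/
noncomputable def bwHybrid (bs dA dB out : ℕ) (gen : ℕ → PMF PaillierKey) (b s : ℕ → ℕ)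
    (adv choose : Alg) (guess : Prog) (c : ℤ)
    (Y : PaillierKey → PMF (Matrix (Fin bs) (Fin out) ℕ × Matrix (Fin dA) (Fin out) ℕ))
    (κ : ℕ) (z : ℤ) : PMF Bool :=
  (keySetup gen κ).bind fun k => (Y k.2).bind fun y =>
    bwPlay bs dA dB out adv choose guess c (b κ) (s κ) κ z k y

/-- The inputs are chosen without knowledge of the blinding matrices, which may thus be drawn
afterwards; then the results on `bwGame` apply for fixed inputs. -/
theorem bind_bwPlay (adv choose : Alg) (guess : Prog) (c : ℤ) (b s κ : ℕ) (z : ℤ)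
    (k : PaillierKey × PaillierKey)
    (Y : PMF (Matrix (Fin bs) (Fin out) ℕ × Matrix (Fin dA) (Fin out) ℕ)) :
    (Y.bind fun y => bwPlay bs dA dB out adv choose guess c b s κ z k y) =
      (choose.output κ (z :: knownKeys s .A k)).bind fun l =>
      (Y.bind (bwGame c s (parseInput bs dA dB out b k l))).bind fun e =>
      (adv.output κ (z :: e.1)).bind fun a =>
      guess.decision κ (z :: (knownKeys s .A k ++ l ++ a ++ e.2.1 ++ e.2.2)) := by
  simp only [bwPlay]
  rw [PMF.bind_comm]
  simp only [PMF.bind_bind]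

theorem real_bwHybrid (hgood : ∀ κ, ∀ k ∈ (gen κ).support, GoodKey bs dA dB (b κ) (s κ) κ k)
    (adv choose : Alg) (guess : Prog) (κ : ℕ) (z : ℤ) :
    advantage
      (realExperiment (keySetup gen) (fun κ => knownKeys (s κ))
        (fun κ => parseInput bs dA dB out (b κ)) (fun κ => matMulBwProtocol (s κ))
        .A adv choose guess κ z)
      (bwHybrid bs dA dB out gen b s adv choose guess 1
        (prodPMF (fun k => sampleMat bs out fun _ _ => residue k)
          fun k => sampleMat dA out fun _ _ => residue k) κ z) ≤
      statErr (dA * out) 0 (b κ) (s κ) κ := by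
  refine advantage_bind_le _ fun k hk => ?_
  rw [bind_bwPlay]
  refine advantage_bind_le _ fun l _ => Close.advantage_le ?_
  obtain ⟨_, _, _, _, hv⟩ := parseInput_valid (bs := bs) (dA := dA) (dB := dB) (out := out)
    (b κ) k l
  have h := (bwProtocol_close hv (hgood κ _ (mem_support_keySetup hk).2)).bind_left fun e =>
    (adv.output κ (z :: e.1)).bind fun a =>
      guess.decision κ (z :: (knownKeys (s κ) .A k ++ l ++ a ++ e.2.1 ++ e.2.2))
  rw [PMF.bind_map] at h
  exact h

theorem bwHybrid_ideal (hgood : ∀ κ, ∀ k ∈ (gen κ).support, GoodKey bs dA dB (b κ) (s κ) κ k)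
    (adv sim choose : Alg) (guess : Prog) (κ : ℕ) (z : ℤ)
    (hsim : ∀ (x : LayerInput bs dA dB out) φ,
      sim.output κ (z :: (bwInput (s κ) .A x ++ bwIdeal x φ .A)) =
        (bwSimA (s κ) x φ).bind fun v => adv.output κ (z :: v)) :
    advantage
      (bwHybrid bs dA dB out gen b s adv choose guess 0
        (prodPMF (fun k => sampleMat bs out fun _ _ => residue k)
          fun k => sampleMat dA out fun _ _ => residue k) κ z)
      (idealExperiment (keySetup gen) (fun κ => knownKeys (s κ))
        (fun κ => parseInput bs dA dB out (b κ)) (fun κ => bwInput (s κ))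
        (fun κ => matMulBwFunctionality (s κ)) .A sim choose guess κ z) ≤
      statErr (bs * out + dA * out) 0 (b κ) (s κ) κ := by
  refine advantage_bind_le _ fun k hk => ?_
  rw [bind_bwPlay]
  refine advantage_bind_le _ fun l _ => Close.advantage_le ?_
  have h := (bwSimA_close (x := parseInput bs dA dB out (b κ) k l)
    (hgood κ _ (mem_support_keySetup hk).2)).bind_left fun e =>
    (adv.output κ (z :: e.1)).bind fun a =>
      guess.decision κ (z :: (knownKeys (s κ) .A k ++ l ++ a ++ e.2.1 ++ e.2.2))
  refine cast (congrArg _ ?_) h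
  dsimp only
  rw [matMulBwFunctionality_eq, PMF.bind_bind, PMF.bind_map]
  refine bind_congr_support fun φ _ => ?_
  rw [Function.comp_apply, hsim, PMF.bind_map, PMF.bind_bind]
  rfl

/-- The only step in which the plaintexts are exchanged, and it is free of error. -/
theorem bwHybrid_unitSq (adv choose : Alg) (guess : Prog) (c c' : ℤ) (κ : ℕ) (z : ℤ) :
    bwHybrid bs dA dB out gen b s adv choose guess c
      (prodPMF (fun k => sampleMat bs out fun _ _ => unitSq k)
        fun k => sampleMat dA out fun _ _ => unitSq k) κ z =
    bwHybrid bs dA dB out gen b s adv choose guess c'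
      (prodPMF (fun k => sampleMat bs out fun _ _ => unitSq k)
        fun k => sampleMat dA out fun _ _ => unitSq k) κ z := by
  simp only [bwHybrid, bind_bwPlay]
  refine congrArg _ (funext fun k => congrArg _ (funext fun l => ?_))
  exact congrArg (fun P : PMF _ => P.bind _)
    (unitSq_bind_bwGame c c' (s κ) (parseInput bs dA dB out (b κ) k l))

/-- Indistinguishable blinding matrices cannot be told apart by the experiment. -/
theorem bwHybrid_indist {len : ℕ → ℕ}
    (hgen : ∀ κ, ∀ k ∈ (gen κ).support, k.p.size = len κ ∧ k.q.size = len κ)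
    (hpoly : ∃ p : Polynomial ℕ, ∀ κ, len κ ≤ p.eval κ)
    (hgood : ∀ κ, ∀ k ∈ (gen κ).support, GoodKey bs dA dB (b κ) (s κ) κ k)
    {Y Y' : PaillierKey → PMF (Matrix (Fin bs) (Fin out) ℕ × Matrix (Fin dA) (Fin out) ℕ)}
    (hY : Indist gen Y Y') {adv choose : Alg} {guess : Prog} (hadv : adv.code.PolyTime)
    (hchoose : choose.code.PolyTime) (hguess : guess.PolyTime) (c : ℤ) (q : Polynomial ℕ) :
    ∃ μ : ℕ → ℝ, Negligible μ ∧ ∀ (κ : ℕ) (z : ℤ), bits z ≤ q.eval κ →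
      advantage (bwHybrid bs dA dB out gen b s adv choose guess c Y κ z)
        (bwHybrid bs dA dB out gen b s adv choose guess c Y' κ z) ≤ μ κ := by
  obtain ⟨p, hp⟩ := hpoly
  -- Twice the length of the primes, because `2 ^ s` and `2 ^ b` are bounded through `N < 2 ^ (2 *
  -- len κ)`.
  obtain ⟨e, he⟩ := eval_le_pow (2 * p)
  obtain ⟨D, hD, hdec⟩ := exists_reduction (bs := bs) (dA := dA) (dB := dB) (out := out) hadv
    hchoose hguess c e b s
  obtain ⟨μ, hμ, h⟩ := hY D hD (q + 4 * ((Polynomial.X + 2) ^ e + 2))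
  refine ⟨μ, hμ, fun κ z hz => ?_⟩
  simp only [bwHybrid, keySetup, PMF.bind_bind, PMF.bind_map]
  -- The key of `A` is fixed and becomes part of the advice; the key of `B` remains random as the
  -- challenge. Independence of the keys and uniformity of `μ` in the advice give the bound for
  -- every `kA`, hence on average.
  refine advantage_bind_le_real _ fun kA hA => ?_
  have hfits : Fits (2 ^ (κ + 2) ^ e) (b κ) (s κ) kA := by
    have h1 : 2 * len κ ≤ (κ + 2) ^ e := by
      have := he κ
      rw [Polynomial.eval_mul, Polynomial.eval_ofNat] at this
      have := hp κ
      omega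
    have h2 : 2 ^ (2 * len κ) ≤ 2 ^ (κ + 2) ^ e := Nat.pow_le_pow_right (by omega) h1
    have h3 : 2 ^ len κ ≤ 2 ^ (2 * len κ) := Nat.pow_le_pow_right (by omega) (by omega)
    have hp' : kA.p < 2 ^ len κ := Nat.size_le.1 (hgen κ kA hA).1.le
    have hq' : kA.q < 2 ^ len κ := Nat.size_le.1 (hgen κ kA hA).2.le
    have hN : kA.N < 2 ^ (2 * len κ) := by
      rw [two_mul, pow_add]
      exact Nat.mul_lt_mul'' hp' hq'
    have hf := (hgood κ kA hA).fit_of_le (d := 1) (by omega)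
    have h4 : 2 ^ b κ ≤ 2 ^ (2 * b κ) := Nat.pow_le_pow_right (by omega) (by omega)
    have h5 : 0 < 2 ^ s κ := by positivity
    have h6 : 0 < 2 ^ b κ := by positivity
    exact ⟨by omega, by omega, by omega, by omega⟩
  have hbits := bits_advice_le hfits z
  have h1 := h κ (advice (2 ^ (κ + 2) ^ e) (b κ) (s κ) kA z) (by
    simp only [Polynomial.eval_add, Polynomial.eval_mul, Polynomial.eval_pow, Polynomial.eval_X,
      Polynomial.eval_ofNat]
    omega)
  simp only [hdec κ z kA _ _ hfits] at h1
  exact h1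

theorem matMulBw_secure {len : ℕ → ℕ}
    (hgen : ∀ κ, ∀ k ∈ (gen κ).support, k.p.size = len κ ∧ k.q.size = len κ)
    (hpoly : ∃ p : Polynomial ℕ, ∀ κ, len κ ≤ p.eval κ)
    (hgood : ∀ κ, ∀ k ∈ (gen κ).support, GoodKey bs dA dB (b κ) (s κ) κ k)
    (hmask : Negligible fun κ => 2 ^ (2 * b κ) / 2 ^ s κ) (hDCR : DCRAssumption gen) :
    SecurelyRealizes (keySetup gen) (fun κ => knownKeys (s κ))
      (fun κ => parseInput bs dA dB out (b κ)) (fun κ => bwInput (s κ))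
      (fun κ => matMulBwProtocol (s κ)) (fun κ => matMulBwFunctionality (s κ)) := by
  intro c adv hadv
  cases c
  · obtain ⟨sim, hsim, hsim'⟩ := exists_simulator (I := LayerInput bs dA dB out) bwInput
      bwIdeal .A (fun s x _ => by
        rw [List.length_append, bwInput, List.length_append, length_fwInput_A, bwIdeal,
          List.length_nil, length_flat])
      bwSimA (fun C hC => PPT.bwSimA hC) hadv
    refine ⟨sim, hsim, fun choose guess hchoose hguess q => ?_⟩
    have hY := hDCR.indist_matrices (fun κ k hk => ⟨(hgood κ k hk).size_p, (hgood κ k hk).size_q⟩)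
      bs out dA out
    -- The assumption is used twice: from residues to units with the real plaintexts (`c = 1`), and
    -- from units back to residues with zero plaintexts (`c = 0`).
    obtain ⟨μ, hμ, h⟩ := bwHybrid_indist (dB := dB) hgen hpoly hgood hY hadv hchoose hguess 1 q
    obtain ⟨ν, hν, h'⟩ := bwHybrid_indist (dB := dB) hgen hpoly hgood hY hadv hchoose hguess 0 q
    refine ⟨_, (negligible_statErr (dA * out) 0 hmask).add (hμ.add (hν.add
      (negligible_statErr (bs * out + dA * out) 0 hmask))), fun κ z hz => ?_⟩
    refine (advantage_triangle _ _ _).trans (add_le_add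
      (real_bwHybrid hgood adv choose guess κ z) ((advantage_triangle _ _ _).trans
      (add_le_add (h κ z hz) ((advantage_triangle _ _ _).trans (add_le_add ?_
      (bwHybrid_ideal hgood adv sim choose guess κ z fun x φ => hsim' κ z (s κ) x φ))))))
    rw [advantage_comm, bwHybrid_unitSq adv choose guess 1 0]
    exact h' κ z hz
  · obtain ⟨sim, hsim, μ, hμ, h⟩ := matMulBw_secure_B hgood hmask hadv
    exact ⟨sim, hsim, fun choose guess _ _ q => ⟨μ, hμ, fun κ z _ => h choose guess κ z⟩⟩

end Secure

end MatMulSource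

open MatMulSource in
theorem mainTheorem1 (bs dA dB out : ℕ) (gen : ℕ → PMF PaillierKey) (len b s : ℕ → ℕ)
    (hgen : ∀ κ, ∀ k ∈ (gen κ).support, k.p.size = len κ ∧ k.q.size = len κ)
    (hlen : ∀ κ, κ ≤ len κ)
    (hpoly : ∃ p : Polynomial ℕ, ∀ κ, len κ ≤ p.eval κ)
    (hfit : ∀ κ, ∀ k ∈ (gen κ).support,
      2 * ((bs + dA + dB + 1) * 2 ^ (2 * b κ) + 2 ^ s κ) < k.N)
    (hmask : Negligible fun κ => 2 ^ (2 * b κ) / 2 ^ s κ)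
    (hDCR : DCRAssumption gen) :
    SecurelyRealizes (keySetup gen) (fun κ => knownKeys (s κ))
      (fun κ => parseInput bs dA dB out (b κ)) (fun κ => fwInput (s κ))
      (fun κ => matMulFwProtocol (s κ)) (fun _ => matMulFwFunctionality) ∧
    SecurelyRealizes (keySetup gen) (fun κ => knownKeys (s κ))
      (fun κ => parseInput bs dA dB out (b κ)) (fun κ => bwInput (s κ))
      (fun κ => matMulBwProtocol (s κ)) (fun κ => matMulBwFunctionality (s κ)) := by
  have hgood : ∀ κ, ∀ k ∈ (gen κ).support, GoodKey bs dA dB (b κ) (s κ) κ k := fun κ k hk =>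
    ⟨(hlen κ).trans (hgen κ k hk).1.ge, (hlen κ).trans (hgen κ k hk).2.ge, hfit κ k hk⟩
  exact ⟨matMulFw_secure hgood hmask, matMulBw_secure hgen hpoly hgood hmask hDCR⟩
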